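/- Corollary. There is a randomized algorithm that maintains a maximal independent set (MIS) of a fully dynamic graph on $n$ fixed vertices, starting from the empty graph, against an oblivious adversary, in $O(\sqrt m\,\log^{1.5} m)$ expected amortized update time, where $m$ is the (changing) number of edges; moreover the MIS is rebuilt by random-order greedy every $\lceil\sqrt m\rceil$ updates. Precisely: there are a constant $C$ and one randomized program for the word RAM (words of $\Theta(\log n)$ bits, blank memory at the start, unit cost for the word operations and for drawing a uniformly random integer from $\{0,\dots,b-1\}$, where $b$ is a word) such that the following holds for every $n$ and every sequence of $T$ edge insertions and deletions that starts from the empty graph on $n$ vertices, inserts only absent and deletes only present edges, and is fixed in advance, independently of the random choices (the program sees the updates one at a time). Let $G_t$ be the graph after $t$ updates and $m_t$ its number of edges. 1. After every update, whatever the random choices, once the program has finished processing that update, the vertex set stored in memory is a maximal independent set of the current graph. 2. The expected total running time over all $T$ updates (which includes every preparation) is at most $C\sum_{t=1}^{T}\sqrt{m_t}\,(\log m_t)^{3/2}$, where $m_t$ is replaced by $2$ if $m_t<2$. 3. Let $r_0=0$ and $r_{i+1}=r_i+\lceil\sqrt{\max(m_{r_i},1)}\rceil$. For each $i\ge 1$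 with $r_i\le T$, the set stored after update $r_i$ has, conditionally on the memory contents before that update, the distribution of the greedy MIS of $G_{r_i}$ for a uniformly random order of the vertices: go through the vertices in this order and take each one that has no neighbour among those taken before. -/

import Mathlib

open scoped ENNReal

namespace DynMIS

/-! ## Word random access machines with a structured programming language

A program is one fixed finite piece of syntax. It works on finitely many word variables and
finitely many word-indexed arrays (both named by natural numbers). All words are numbers below
`2 ^ w`, where `w` is the word length. -/

/-- Expressions. Comparisons return `1` (true) or `0` (false). -/
inductive Expr : Type
  | lit (a : ℕ)
  | var (x : ℕ)
  | get (a : ℕ) (i : Expr)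
  | add (e f : Expr)
  | sub (e f : Expr)
  | mul (e f : Expr)
  | div (e f : Expr)
  | lt (e f : Expr)
  | eq (e f : Expr)

/-- Statements. `rand x e` sets `x` to a fresh uniformly random element of `{0, …, e - 1}`. -/
inductive Stmt : Type
  | skip
  | assign (x : ℕ) (e : Expr)
  | store (a : ℕ) (i e : Expr)
  | rand (x : ℕ) (e : Expr)
  | seq (s t : Stmt)
  | ite (e : Expr) (s t : Stmt)
  | while (e : Expr) (s : Stmt)

/-- The contents of the variables and of the arrays. -/
structure Store : Type where
  var : ℕ → ℕ
  arr : ℕ → ℕ → ℕ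

/-- Blank memory. -/
def Store.blank : Store := ⟨fun _ => 0, fun _ _ => 0⟩

/-- Assign the word `a` to the variable `x`. -/
def Store.setVar (s : Store) (x a : ℕ) : Store :=
  { s with var := Function.update s.var x a }

/-- Write the word `b` into cell `i` of the array `a`. -/
def Store.setArr (s : Store) (a i b : ℕ) : Store :=
  { s with arr := Function.update s.arr a (Function.update (s.arr a) i b) }

/-- Value of an expression, with word length `w`: literals, sums and products are reduced modulo
`2 ^ w`; subtraction is truncated at `0`; division rounds down (and gives `0` for divisor `0`). -/
def Expr.eval (w : ℕ) (s : Store) : Expr → ℕ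
  | .lit a => a % 2 ^ w
  | .var x => s.var x
  | .get a i => s.arr a (i.eval w s)
  | .add e f => (e.eval w s + f.eval w s) % 2 ^ w
  | .sub e f => e.eval w s - f.eval w s
  | .mul e f => (e.eval w s * f.eval w s) % 2 ^ w
  | .div e f => e.eval w s / f.eval w s
  | .lt e f => if e.eval w s < f.eval w s then 1 % 2 ^ w else 0
  | .eq e f => if e.eval w s = f.eval w s then 1 % 2 ^ w else 0

/-! ## Dynamic graphs -/

/-- An edge update of a graph with vertex set `Fin n`. -/
inductive Update (n : ℕ) : Type
  | insert (u v : Fin n)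
  | delete (u v : Fin n)

/-- The graph after one update. -/
def Update.apply {n : ℕ} (G : SimpleGraph (Fin n)) : Update n → SimpleGraph (Fin n)
  | .insert u v => G ⊔ SimpleGraph.fromEdgeSet {s(u, v)}
  | .delete u v => G \ SimpleGraph.fromEdgeSet {s(u, v)}

/-- Only absent edges are inserted (no loops), and only present edges are deleted. -/
def Update.Valid {n : ℕ} (G : SimpleGraph (Fin n)) : Update n → Prop
  | .insert u v => u ≠ v ∧ ¬ G.Adj u v
  | .delete u v => G.Adj u v

/-- The graph after a sequence of updates (first update first), starting from the empty graph. -/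
def graphAfter {n : ℕ} (us : List (Update n)) : SimpleGraph (Fin n) :=
  us.foldl Update.apply ⊥

/-- A sequence of updates, starting from `G`, in which every update is valid when it arrives. -/
def ValidFrom {n : ℕ} (G : SimpleGraph (Fin n)) : List (Update n) → Prop
  | [] => True
  | u :: us => u.Valid G ∧ ValidFrom (u.apply G) us

/-- The number of edges present after the first `t` updates. -/
noncomputable def edgesAfter {n : ℕ} (us : List (Update n)) (t : ℕ) : ℕ :=
  (graphAfter (us.take t)).edgeSet.ncard

/-! ## Running a program on a sequence of updates -/

/-- A configuration: the statements still to be executed for the current update, the memory, and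
the updates that have not arrived yet (which the program cannot see). -/
structure Config (n : ℕ) : Type where
  stack : List Stmt
  store : Store
  pending : List (Update n)

/-- All updates have been processed. -/
def Config.Done {n : ℕ} (c : Config n) : Prop := c.stack = [] ∧ c.pending = []

/-- An update arrives: the input is written to the variables `0, 1, 2, 3`, namely the number of
vertices, the kind of the update (`1` for an insertion, `0` for a deletion) and its end points. -/
def Update.load {n : ℕ} (s : Store) : Update n → Store
  | .insert u v => (((s.setVar 0 n).setVar 1 1).setVar 2 u).setVar 3 v
  | .delete u v => (((s.setVar 0 n).setVar 1 0).setVar 2 u).setVar 3 v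

/-- A uniformly random element of `{0, …, b - 1}` (and `0` if `b = 0`). -/
noncomputable def uniformBelow (b : ℕ) : PMF ℕ :=
  if h : 0 < b then PMF.uniformOfFinset (Finset.range b) ⟨0, Finset.mem_range.2 h⟩ else PMF.pure 0

/-- One time step of the program `P` with word length `w`. Each step executes one simple statement,
evaluates one guard, or fetches the next update; the expressions in it have a size bounded by a
constant that depends on `P` only. A configuration in which all is done stays unchanged. -/
noncomputable def step (P : Stmt) (w : ℕ) {n : ℕ} (c : Config n) : PMF (Config n) :=
  match c with
  | ⟨[], s, []⟩ => PMF.pure ⟨[], s, []⟩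
  | ⟨[], s, u :: us⟩ => PMF.pure ⟨[P], u.load s, us⟩
  | ⟨.skip :: k, s, us⟩ => PMF.pure ⟨k, s, us⟩
  | ⟨.assign x e :: k, s, us⟩ => PMF.pure ⟨k, s.setVar x (e.eval w s), us⟩
  | ⟨.store a i e :: k, s, us⟩ => PMF.pure ⟨k, s.setArr a (i.eval w s) (e.eval w s), us⟩
  | ⟨.rand x e :: k, s, us⟩ =>
      (uniformBelow (e.eval w s)).map fun r => ⟨k, s.setVar x r, us⟩
  | ⟨.seq p q :: k, s, us⟩ => PMF.pure ⟨p :: q :: k, s, us⟩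
  | ⟨.ite e p q :: k, s, us⟩ => PMF.pure ⟨(if e.eval w s ≠ 0 then p else q) :: k, s, us⟩
  | ⟨.while e p :: k, s, us⟩ =>
      PMF.pure ⟨if e.eval w s ≠ 0 then p :: .while e p :: k else k, s, us⟩

/-- The distribution of the configuration after `k` steps from `c`. -/
noncomputable def runFrom (P : Stmt) (w : ℕ) {n : ℕ} (c : Config n) : ℕ → PMF (Config n)
  | 0 => PMF.pure c
  | k + 1 => (runFrom P w c k).bind (step P w)

/-- The start: blank memory, and the updates `us` still to come. -/
def Config.start {n : ℕ} (us : List (Update n)) : Config n := ⟨[], Store.blank, us⟩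

/-- The vertex set stored in memory: the vertices `v` for which cell `v` of array `0` holds `0`.
So blank memory stands for the set of all vertices, and no time is needed for preparations. -/
def Config.output {n : ℕ} (c : Config n) : Finset (Fin n) :=
  Finset.univ.filter fun v => c.store.arr 0 v = 0

/-- The expected number of steps from `c` until all updates are processed:
`E T = ∑ k, Pr (T > k)`. -/
noncomputable def expectedTime (P : Stmt) (w : ℕ) {n : ℕ} (c : Config n) : ℝ≥0∞ :=
  ∑' k : ℕ, (runFrom P w c k).toOuterMeasure {c' | ¬ c'.Done}

/-- The probability that the run from `c` ends with the vertex set `S` stored in memory (the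
probability that it has done so within `k` steps is nondecreasing in `k`). -/
noncomputable def outcomeProb (P : Stmt) (w : ℕ) {n : ℕ} (c : Config n) (S : Finset (Fin n)) :
    ℝ≥0∞ :=
  ⨆ k : ℕ, (runFrom P w c k).toOuterMeasure {c' | c'.Done ∧ c'.output = S}

/-- Words of `c * (⌊log₂ n⌋ + 1)` bits. -/
def wordLength (c n : ℕ) : ℕ := c * (Nat.log 2 n + 1)

/-! ## Random-order greedy and the bound -/

open Classical in
/-- The greedy independent set for the order `σ 0, σ 1, …` of the vertices: every vertex is taken
unless it has a neighbour that has been taken before. -/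
noncomputable def greedy {n : ℕ} (G : SimpleGraph (Fin n)) (σ : Equiv.Perm (Fin n)) :
    Finset (Fin n) :=
  (List.finRange n).foldl
    (fun S i => if ∃ u ∈ S, G.Adj (σ i) u then S else insert (σ i) S) ∅

/-- The distribution of the greedy independent set for a uniformly random order. -/
noncomputable def randomGreedy {n : ℕ} (G : SimpleGraph (Fin n)) : PMF (Finset (Fin n)) :=
  (PMF.uniformOfFintype (Equiv.Perm (Fin n))).map (greedy G)

/-- The times of reconstruction: after a reconstruction with `m` edges present, the next one comes
`⌈√m⌉` updates later (with `m = 1` in place of `m = 0`). -/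
noncomputable def rebuildTime {n : ℕ} (us : List (Update n)) : ℕ → ℕ
  | 0 => 0
  | i + 1 => rebuildTime us i + ⌈√((max (edgesAfter us (rebuildTime us i)) 1 : ℕ) : ℝ)⌉₊

/-- `√m (log m) ^ (3 / 2)`, with `m = 2` in place of `m = 0` and `m = 1`. -/
noncomputable def updateBound (m : ℕ) : ℝ :=
  √((max m 2 : ℕ) : ℝ) * Real.log ((max m 2 : ℕ) : ℝ) ^ (3 / 2 : ℝ)

end DynMIS

namespace DynMIS

/-! ## Expectations -/

/-! The updates are cut into phases of `r = ⌈√m⌉` updates, and each phase begins with random-order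
greedy on the `N` non-isolated vertices. Let `T` be the part of the greedy set found among the first
`N / (8 * r)` vertices of the order, and let `H` be the vertices that are neither in `T` nor
adjacent to `T`. The stored set is `T` together with a maximal independent set of the graph induced
on `H`. As long as no updated edge has an end point in `T`, the set `T` keeps dominating everything
outside `T ∪ H` and stays free of edges to `H`. So only edges inside `H` need attention, and they
are handled by counters of neighbours in the set. An update that touches `T` triggers a new greedy
run with a fresh order, the same `r`, and the clock of the phase still running.

Two facts about a random order keep both kinds of work small; they apply because the updates are
fixed in advance. A given vertex is among the first `k` of `N` with probability at most `k / N`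
(`card_mul_expect_mem_take`), so a rerun, which takes time `O(r²)`, happens with probability `O(1 /
r)` per update. The expected degree of a given vertex in the residual graph is at most `N / k`
(`mul_expect_card_nbrsIn_le`): a vertex with many residual neighbours is likely to see one of them
drawn, and then it is dominated and disappears. With `k = N / (8 * r)` this is `O(r)`.

Inside `H` the expensive event is an insertion between two members: one of them leaves, and several
of its neighbours may join. The potential `outDeg`, the sum of the residual degrees outside the set,
pays for each joining vertex, so the amortized cost is the degree of the leaving vertex
(`det_leaveVertex`, `det_localInsert`, `det_localDelete`).

The time bound `expectedTime_le` is an induction over the updates. The potential consists of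
`outDeg`, the charges `futureCost` of the remaining updates of the phase, and the deterministic cost
`work`. The charge for touching `T` is large enough to pay for the rerun and for the expected
charges under the fresh order, and this closes the induction. By `work_le` everything sums to `O(∑
√m)`; the logarithm in the bound is slack.

For the law of the set at a reconstruction, isolated vertices are always taken by greedy, and
deleting them from a uniform order leaves a uniform order (`randomGreedy_eq`). Hence the program may
order the non-isolated vertices only, and its time depends on `m` but not on `n`.

Programs are analysed by first-step equations. Expected time and the probability of ending in a
given event both satisfy `Harmonic`, with cost `1` and `0` per step. A statement is described by its
effect on all such functionals (`Runs`), together with a coupling to an abstract random value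
(`Spec`). One specification of the program then yields the time bound, correctness and the law. -/

/-- The expectation of `F` under `ν`. -/
noncomputable def expect {α : Type*} (ν : PMF α) (F : α → ℝ≥0∞) : ℝ≥0∞ := ∑' a, ν a * F a

section Expect
variable {α β : Type*}

@[simp] theorem expect_pure (a : α) (F : α → ℝ≥0∞) : expect (PMF.pure a) F = F a := by
  unfold expect
  rw [tsum_eq_single a]
  · simp
  · intro b hb
    simp [PMF.pure_apply, hb]

theorem expect_bind (ν : PMF α) (f : α → PMF β) (F : β → ℝ≥0∞) :
    expect (ν.bind f) F = expect ν fun a => expect (f a) F := by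
  unfold expect
  simp only [PMF.bind_apply, ← ENNReal.tsum_mul_right, ← ENNReal.tsum_mul_left]
  rw [ENNReal.tsum_comm]
  simp only [mul_assoc]

theorem expect_map (ν : PMF α) (g : α → β) (F : β → ℝ≥0∞) :
    expect (ν.map g) F = expect ν (F ∘ g) := by
  simp [PMF.map, expect_bind, Function.comp_def]

theorem expect_mono {ν : PMF α} {F F' : α → ℝ≥0∞} (h : ∀ a ∈ ν.support, F a ≤ F' a) :
    expect ν F ≤ expect ν F' := by
  refine ENNReal.tsum_le_tsum fun a => ?_
  by_cases ha : ν a = 0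
  · simp [ha]
  · gcongr
    exact h a ((PMF.mem_support_iff _ _).2 ha)

theorem expect_congr {ν : PMF α} {F F' : α → ℝ≥0∞} (h : ∀ a ∈ ν.support, F a = F' a) :
    expect ν F = expect ν F' :=
  le_antisymm (expect_mono fun a ha => (h a ha).le) (expect_mono fun a ha => (h a ha).ge)

theorem expect_add (ν : PMF α) (F F' : α → ℝ≥0∞) :
    (expect ν fun a => F a + F' a) = expect ν F + expect ν F' := by
  simp only [expect, mul_add, ENNReal.tsum_add]

@[simp] theorem expect_const (ν : PMF α) (b : ℝ≥0∞) : (expect ν fun _ => b) = b := by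
  simp only [expect, ENNReal.tsum_mul_right, ν.tsum_coe, one_mul]

theorem expect_const_mul (ν : PMF α) (b : ℝ≥0∞) (F : α → ℝ≥0∞) :
    (expect ν fun a => b * F a) = b * expect ν F := by
  simp only [expect, ← ENNReal.tsum_mul_left]
  exact tsum_congr fun a => by ring

theorem expect_eq_zero {ν : PMF α} {F : α → ℝ≥0∞} :
    expect ν F = 0 ↔ ∀ a ∈ ν.support, F a = 0 := by
  simp only [expect, ENNReal.tsum_eq_zero, mul_eq_zero, PMF.mem_support_iff, or_iff_not_imp_left,
    ne_eq]

/-- Monotone convergence for sums; it lets the supremum in `doneProb` pass through one step of the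
machine. -/
theorem tsum_iSup_of_monotone {f : ℕ → α → ℝ≥0∞} (hf : ∀ a, Monotone fun k => f k a) :
    ∑' a, ⨆ k, f k a = ⨆ k, ∑' a, f k a := by
  simp only [ENNReal.tsum_eq_iSup_sum]
  rw [iSup_comm]
  exact iSup_congr fun s => ENNReal.finsetSum_iSup_of_monotone fun a => hf a

theorem toOuterMeasure_eq_expect (ν : PMF α) (s : Set α) :
    ν.toOuterMeasure s = expect ν (s.indicator 1) := by
  rw [PMF.toOuterMeasure_apply]
  refine tsum_congr fun a => ?_
  by_cases h : a ∈ s <;> simp [h]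

end Expect

/-! ## From single steps to statements -/

section Run
variable {P : Stmt} {w n : ℕ}

theorem step_of_done {c : Config n} (hc : c.Done) : step P w c = PMF.pure c := by
  obtain ⟨k, s, us⟩ := c
  obtain ⟨rfl, rfl⟩ : k = [] ∧ us = [] := hc
  rfl

theorem runFrom_succ (c : Config n) (k : ℕ) :
    runFrom P w c (k + 1) = (step P w c).bind fun c' => runFrom P w c' k := by
  induction k with
  | zero => simp [runFrom]
  | succ k ih =>
    rw [runFrom, ih, PMF.bind_bind]
    rfl

theorem runFrom_of_done {c : Config n} (hc : c.Done) (k : ℕ) :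
    runFrom P w c k = PMF.pure c := by
  induction k with
  | zero => rfl
  | succ k ih => rw [runFrom, ih, PMF.pure_bind, step_of_done hc]

/-- The probability that the run from `c` is done after `k` steps, in a configuration in `A`. -/
noncomputable def doneBy (P : Stmt) (w : ℕ) (A : Config n → Prop) (c : Config n) (k : ℕ) : ℝ≥0∞ :=
  (runFrom P w c k).toOuterMeasure {c' | c'.Done ∧ A c'}

/-- The probability that the run from `c` ends in a configuration in `A`. -/
noncomputable def doneProb (P : Stmt) (w : ℕ) (A : Config n → Prop) (c : Config n) : ℝ≥0∞ :=
  ⨆ k, doneBy P w A c k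

theorem doneBy_succ (A : Config n → Prop) (c : Config n) (k : ℕ) :
    doneBy P w A c (k + 1) = expect (step P w c) fun c' => doneBy P w A c' k := by
  simp only [doneBy, runFrom_succ, toOuterMeasure_eq_expect, expect_bind]

theorem doneBy_of_done (A : Config n → Prop) {c : Config n} (hc : c.Done) (k : ℕ) :
    doneBy P w A c k = Set.indicator {c' | A c'} 1 c := by
  rw [doneBy, toOuterMeasure_eq_expect, runFrom_of_done hc, expect_pure]
  by_cases h : A c <;> simp [h, hc]

theorem doneBy_zero (A : Config n → Prop) {c : Config n} (hc : ¬ c.Done) :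
    doneBy P w A c 0 = 0 := by
  rw [doneBy, toOuterMeasure_eq_expect, runFrom, expect_pure]
  simp [hc]

/-- Configurations in which all is done are absorbing; the general case follows by conditioning on
the first step. -/
theorem doneBy_mono (A : Config n → Prop) (c : Config n) : Monotone (doneBy P w A c) := by
  refine monotone_nat_of_le_succ fun k => ?_
  induction k generalizing c with
  | zero =>
    by_cases hc : c.Done
    · simp only [doneBy_of_done A hc, le_refl]
    · simp [doneBy_zero A hc]
  | succ k ih =>
    rw [doneBy_succ, doneBy_succ A c (k + 1)]
    exact expect_mono fun a _ => ih a

/-- `F` satisfies the one-step equation with cost `γ` per step. -/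
def Harmonic (P : Stmt) (w : ℕ) {n : ℕ} (γ : ℝ≥0∞) (F : Config n → ℝ≥0∞) : Prop :=
  ∀ c : Config n, ¬ c.Done → F c = γ + expect (step P w c) F

/-- By monotonicity the supremum may start at `k = 1`, where the first step can be split off. -/
theorem harmonic_doneProb (A : Config n → Prop) : Harmonic P w 0 (doneProb P w A) := by
  intro c hc
  rw [zero_add, doneProb, ← (doneBy_mono A c).iSup_nat_add 1]
  simp only [doneBy_succ, expect, doneProb, ENNReal.mul_iSup]
  rw [tsum_iSup_of_monotone]
  intro a i j hij
  exact mul_le_mul_right (doneBy_mono A a hij) _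

/-- The summand for `k = 0` is the cost `1`, since `c` is not done; the rest is the same series
started one step later. -/
theorem harmonic_expectedTime : Harmonic P w 1 (expectedTime P w (n := n)) := by
  intro c hc
  rw [expectedTime, tsum_eq_zero_add' ENNReal.summable]
  congr 1
  · rw [runFrom, toOuterMeasure_eq_expect, expect_pure]
    simp [hc]
  · simp only [runFrom_succ, toOuterMeasure_eq_expect, expect_bind]
    simp only [expect]
    rw [ENNReal.tsum_comm]
    simp only [ENNReal.tsum_mul_left, expectedTime, toOuterMeasure_eq_expect, expect]

theorem expectedTime_of_done {c : Config n} (hc : c.Done) : expectedTime P w c = 0 := by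
  simp [expectedTime, runFrom_of_done hc, toOuterMeasure_eq_expect, hc]

theorem doneProb_of_done (A : Config n → Prop) {c : Config n} (hc : c.Done) :
    doneProb P w A c = Set.indicator {c' | A c'} 1 c := by
  simp [doneProb, doneBy_of_done A hc]

theorem outcomeProb_eq (c : Config n) (S : Finset (Fin n)) :
    outcomeProb P w c S = doneProb P w (fun c' => c'.output = S) c := rfl

/-- Turns a statement about all random choices into the vanishing of a functional that satisfies
`Harmonic`, so that correctness uses the same specifications as the running time. -/
theorem doneProb_not_eq_zero_iff (A : Config n → Prop) (c : Config n) :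
    doneProb P w (fun c' => ¬ A c') c = 0 ↔
      ∀ k, ∀ x ∈ (runFrom P w c k).support, x.Done → A x := by
  simp only [doneProb, ENNReal.iSup_eq_zero, doneBy, toOuterMeasure_eq_expect, expect_eq_zero]
  refine forall_congr' fun k => forall_congr' fun x => imp_congr_right fun _ => ?_
  by_cases h : x.Done <;> by_cases h' : A x <;> simp [h, h']

/-- Started from `s`, the statement `p` stops, and `μ` is the joint distribution of its running time
and of the store that it leaves. -/
def Runs (w : ℕ) (p : Stmt) (s : Store) (μ : PMF (ℕ × Store)) : Prop :=
  ∀ (P : Stmt) (n : ℕ) (γ : ℝ≥0∞) (F : Config n → ℝ≥0∞), Harmonic P w γ F →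
    ∀ k us, F ⟨p :: k, s, us⟩ = expect μ fun z => γ * z.1 + F ⟨k, z.2, us⟩

/-- Started from `s`, the statement `p` stops, and its run can be coupled with `ν` in such a way that
the running time, the final store and the value drawn from `ν` are always related by `Q`. -/
def Spec (w : ℕ) (p : Stmt) (s : Store) {α : Type} (ν : PMF α) (Q : α → ℕ → Store → Prop) : Prop :=
  ∃ ξ : PMF (α × ℕ × Store), Runs w p s (ξ.map Prod.snd) ∧ ξ.map Prod.fst = ν ∧
    ∀ z ∈ ξ.support, Q z.1 z.2.1 z.2.2

/-- Started from `s`, the statement `p` stops without using its random choices, and the running time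
and the final store are related by `Q`. -/
def Det (w : ℕ) (p : Stmt) (s : Store) (Q : ℕ → Store → Prop) : Prop :=
  Spec w p s (PMF.pure ()) fun _ => Q

end Run

/-! ### Proof rules for statements: composition of couplings. -/

section Rules
variable {w : ℕ} {s : Store} {α β : Type}

theorem Spec.mono {p : Stmt} {ν : PMF α} {Q Q' : α → ℕ → Store → Prop} (h : Spec w p s ν Q)
    (hQ : ∀ a t s', Q a t s' → Q' a t s') : Spec w p s ν Q' := by
  obtain ⟨ξ, h1, h2, h3⟩ := h
  exact ⟨ξ, h1, h2, fun z hz => hQ _ _ _ (h3 z hz)⟩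

theorem Spec.mono_support {p : Stmt} {ν : PMF α} {Q Q' : α → ℕ → Store → Prop}
    (h : Spec w p s ν Q) (hQ : ∀ a ∈ ν.support, ∀ t s', Q a t s' → Q' a t s') :
    Spec w p s ν Q' := by
  obtain ⟨ξ, h1, h2, h3⟩ := h
  refine ⟨ξ, h1, h2, fun z hz => hQ _ ?_ _ _ (h3 z hz)⟩
  rw [← h2, PMF.mem_support_map_iff]
  exact ⟨z, hz, rfl⟩

theorem Det.mono {p : Stmt} {Q Q' : ℕ → Store → Prop} (h : Det w p s Q)
    (hQ : ∀ t s', Q t s' → Q' t s') : Det w p s Q' :=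
  Spec.mono h fun _ => hQ

theorem Spec.map {p : Stmt} {ν : PMF α} (g : α → β) {Q : β → ℕ → Store → Prop}
    (h : Spec w p s ν fun a => Q (g a)) : Spec w p s (ν.map g) Q := by
  obtain ⟨ξ, h1, h2, h3⟩ := h
  refine ⟨ξ.map fun z => (g z.1, z.2), ?_, ?_, ?_⟩
  · rw [PMF.map_comp]
    exact h1
  · rw [← h2, PMF.map_comp, PMF.map_comp]
    rfl
  · intro z hz
    obtain ⟨z', hz', rfl⟩ := (PMF.mem_support_map_iff _ _ _).1 hz
    exact h3 z' hz'

theorem Det.of_runs {p : Stmt} {t : ℕ} {s' : Store} (h : Runs w p s (PMF.pure (t, s')))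
    {Q : ℕ → Store → Prop} (hQ : Q t s') : Det w p s Q := by
  refine ⟨PMF.pure ((), t, s'), ?_, ?_, ?_⟩
  · rwa [PMF.pure_map]
  · rw [PMF.pure_map]
  · intro z hz
    rw [PMF.mem_support_pure_iff] at hz
    subst hz
    exact hQ

theorem runs_of_step {p : Stmt} {s' : Store}
    (h : ∀ (P : Stmt) (n : ℕ) k (us : List (Update n)),
      step P w ⟨p :: k, s, us⟩ = PMF.pure ⟨k, s', us⟩) : Runs w p s (PMF.pure (1, s')) := by
  intro P n γ F hF k us
  rw [hF _ (by simp [Config.Done]), h, expect_pure, expect_pure]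
  simp

theorem Det.skip {Q : ℕ → Store → Prop} (h : Q 1 s) : Det w .skip s Q :=
  Det.of_runs (runs_of_step fun _ _ _ _ => rfl) h

theorem Det.assign {x : ℕ} {e : Expr} {Q : ℕ → Store → Prop} (h : Q 1 (s.setVar x (e.eval w s))) :
    Det w (.assign x e) s Q :=
  Det.of_runs (runs_of_step fun _ _ _ _ => rfl) h

theorem Det.store {a : ℕ} {i e : Expr} {Q : ℕ → Store → Prop}
    (h : Q 1 (s.setArr a (i.eval w s) (e.eval w s))) : Det w (.store a i e) s Q :=
  Det.of_runs (runs_of_step fun _ _ _ _ => rfl) h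

theorem runs_rand (x : ℕ) (e : Expr) :
    Runs w (.rand x e) s ((uniformBelow (e.eval w s)).map fun r => (1, s.setVar x r)) := by
  intro P n γ F hF k us
  rw [hF _ (by simp [Config.Done])]
  have : step P w ⟨.rand x e :: k, s, us⟩ =
      (uniformBelow (e.eval w s)).map fun r => (⟨k, s.setVar x r, us⟩ : Config n) := rfl
  rw [this, expect_map, expect_map]
  simp only [Function.comp_def, Nat.cast_one, mul_one, expect_add, expect_const]

/-- The composition of two couplings, for a statement that first behaves like `p` and then like `q`,
with `d` additional steps. -/
theorem Spec.chain {p q r : Stmt} (d : ℕ) {ν : PMF α} {ν' : α → PMF β}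
    {Q' : α → ℕ → Store → Prop} {Q : β → ℕ → Store → Prop}
    (hr : ∀ (P : Stmt) (n : ℕ) (γ : ℝ≥0∞) (F : Config n → ℝ≥0∞), Harmonic P w γ F →
      ∀ k us, F ⟨r :: k, s, us⟩ = γ * d + F ⟨p :: q :: k, s, us⟩)
    (hp : Spec w p s ν Q')
    (hq : ∀ a t s', Q' a t s' → Spec w q s' (ν' a) fun b t' s'' => Q b (t + t' + d) s'') :
    Spec w r s (ν.bind ν') Q := by
  classical
  obtain ⟨ξ, h1, h2, h3⟩ := hp
  -- The coupling for `q` depends on the outcome `z` of `p`. Off the support of `ξ` an arbitrary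
  -- coupling is supplied; it carries no weight.
  have hz : ∀ z : α × ℕ × Store, ∃ η : PMF (β × ℕ × Store), z ∈ ξ.support →
      (Runs w q z.2.2 (η.map Prod.snd) ∧ η.map Prod.fst = ν' z.1 ∧
        ∀ y ∈ η.support, Q y.1 (z.2.1 + y.2.1 + d) y.2.2) := by
    intro z
    by_cases h : z ∈ ξ.support
    · obtain ⟨η, hη⟩ := hq _ _ _ (h3 z h)
      exact ⟨η, fun _ => hη⟩
    · exact ⟨(ν' z.1).map fun b => (b, 0, s), fun h' => absurd h' h⟩
  choose η hη using hz
  refine ⟨ξ.bind fun z => (η z).map fun y => (y.1, z.2.1 + y.2.1 + d, y.2.2), ?_, ?_, ?_⟩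
  · intro P n γ F hF k us
    rw [hr P n γ F hF, h1 P n γ F hF, PMF.map_bind, expect_bind, expect_map]
    rw [← expect_const ξ (γ * d), ← expect_add]
    refine expect_congr fun z hz => ?_
    simp only [Function.comp_def]
    rw [(hη z hz).1 P n γ F hF, PMF.map_comp, expect_map, expect_map]
    rw [← expect_const (η z) (γ * z.2.1), ← expect_add, ← expect_const (η z) (γ * d), ← expect_add]
    refine expect_congr fun y _ => ?_
    simp only [Function.comp_def]
    push_cast
    ring
  · rw [PMF.map_bind, ← h2, PMF.bind_map]
    ext b
    simp only [PMF.bind_apply]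
    refine tsum_congr fun z => ?_
    by_cases hz : z ∈ ξ.support
    · rw [PMF.map_comp]
      have : (η z).map Prod.fst = ν' z.1 := (hη z hz).2.1
      simp only [Function.comp_def]
      rw [← this]
    · rw [PMF.mem_support_iff, not_not] at hz
      simp [hz]
  · intro y hy
    obtain ⟨z, hz, hy⟩ := (PMF.mem_support_bind_iff _ _ _).1 hy
    obtain ⟨y', hy', rfl⟩ := (PMF.mem_support_map_iff _ _ _).1 hy
    exact (hη z hz).2.2 y' hy'

theorem Spec.seq {p q : Stmt} {ν : PMF α} {ν' : α → PMF β}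
    {Q' : α → ℕ → Store → Prop} {Q : β → ℕ → Store → Prop} (hp : Spec w p s ν Q')
    (hq : ∀ a t s', Q' a t s' → Spec w q s' (ν' a) fun b t' s'' => Q b (t + t' + 1) s'') :
    Spec w (.seq p q) s (ν.bind ν') Q := by
  refine Spec.chain 1 ?_ hp hq
  intro P n γ F hF k us
  rw [hF _ (by simp [Config.Done])]
  have : step P w ⟨.seq p q :: k, s, us⟩ = PMF.pure ⟨p :: q :: k, s, us⟩ := rfl
  rw [this, expect_pure]
  simp

theorem Spec.while_true {p : Stmt} {e : Expr} {ν : PMF α} {ν' : α → PMF β}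
    {Q' : α → ℕ → Store → Prop} {Q : β → ℕ → Store → Prop} (he : e.eval w s ≠ 0)
    (hp : Spec w p s ν Q')
    (hq : ∀ a t s', Q' a t s' →
      Spec w (.while e p) s' (ν' a) fun b t' s'' => Q b (t + t' + 1) s'') :
    Spec w (.while e p) s (ν.bind ν') Q := by
  refine Spec.chain 1 ?_ hp hq
  intro P n γ F hF k us
  rw [hF _ (by simp [Config.Done])]
  have : step P w ⟨.while e p :: k, s, us⟩ = PMF.pure ⟨p :: .while e p :: k, s, us⟩ := by
    simp [step, he]
  rw [this, expect_pure]
  simp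

theorem Det.seq {p q : Stmt} {Q : ℕ → Store → Prop}
    (hp : Det w p s fun t s' => Det w q s' fun t' s'' => Q (t + t' + 1) s'') :
    Det w (.seq p q) s Q := by
  have := Spec.seq (ν' := fun _ => PMF.pure ()) (Q := fun _ => Q) hp fun _ _ _ h => h
  rwa [PMF.pure_bind] at this

theorem Det.seq_spec {p q : Stmt} {ν : PMF α} {Q : α → ℕ → Store → Prop}
    (hp : Det w p s fun t s' => Spec w q s' ν fun a t' s'' => Q a (t + t' + 1) s'') :
    Spec w (.seq p q) s ν Q := by
  have := Spec.seq (ν' := fun _ => ν) (Q := Q) hp fun _ _ _ h => h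
  rwa [PMF.pure_bind] at this

theorem Spec.seq_det {p q : Stmt} {ν : PMF α} {Q : α → ℕ → Store → Prop}
    (hp : Spec w p s ν fun a t s' => Det w q s' fun t' s'' => Q a (t + t' + 1) s'') :
    Spec w (.seq p q) s ν Q := by
  have := Spec.seq (ν' := PMF.pure) (Q := Q) hp fun a t s' h => by
    have h' := Spec.map (fun _ => a) (Q := fun a t' s'' => Q a (t + t' + 1) s'') h
    rwa [PMF.pure_map] at h'
  rwa [PMF.bind_pure] at this

theorem Det.while_true {p : Stmt} {e : Expr} {Q : ℕ → Store → Prop} (he : e.eval w s ≠ 0)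
    (hp : Det w p s fun t s' => Det w (.while e p) s' fun t' s'' => Q (t + t' + 1) s'') :
    Det w (.while e p) s Q := by
  have := Spec.while_true (ν' := fun _ => PMF.pure ()) (Q := fun _ => Q) he hp fun _ _ _ h => h
  rwa [PMF.pure_bind] at this

theorem Det.while_false {p : Stmt} {e : Expr} {Q : ℕ → Store → Prop} (he : e.eval w s = 0)
    (h : Q 1 s) : Det w (.while e p) s Q := by
  refine Det.of_runs (runs_of_step (s' := s) fun _ _ _ _ => ?_) h
  simp [step, he]

theorem Spec.ite {p q : Stmt} {e : Expr} {ν : PMF α} {Q : α → ℕ → Store → Prop}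
    (h : Spec w (if e.eval w s ≠ 0 then p else q) s ν fun a t s' => Q a (t + 1) s') :
    Spec w (.ite e p q) s ν Q := by
  obtain ⟨ξ, h1, h2, h3⟩ := h
  refine ⟨ξ.map fun z => (z.1, z.2.1 + 1, z.2.2), ?_, ?_, ?_⟩
  · intro P n γ F hF k us
    rw [hF _ (by simp [Config.Done])]
    have : step P w ⟨.ite e p q :: k, s, us⟩ =
        PMF.pure ⟨(if e.eval w s ≠ 0 then p else q) :: k, s, us⟩ := rfl
    have h : ∀ X : α × ℕ × Store → ℝ≥0∞, γ + expect ξ X = expect ξ fun z => γ + X z := fun X => by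
      rw [expect_add, expect_const]
    rw [this, expect_pure, h1 P n γ F hF, PMF.map_comp, expect_map, expect_map, h]
    refine expect_congr fun z _ => ?_
    simp only [Function.comp_def]
    push_cast
    ring
  · rw [← h2, PMF.map_comp]
    rfl
  · intro z hz
    obtain ⟨z', hz', rfl⟩ := (PMF.mem_support_map_iff _ _ _).1 hz
    exact h3 z' hz'

theorem Det.ite {p q : Stmt} {e : Expr} {Q : ℕ → Store → Prop}
    (h1 : e.eval w s ≠ 0 → Det w p s fun t s' => Q (t + 1) s')
    (h2 : e.eval w s = 0 → Det w q s fun t s' => Q (t + 1) s') :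
    Det w (.ite e p q) s Q := by
  refine Spec.ite ?_
  split_ifs with h
  · exact h1 h
  · exact h2 (not_not.1 h)

/-- The effect of a specified statement on a functional that satisfies the one-step equation. -/
theorem Spec.exists_expect_eq {p : Stmt} {ν : PMF α} {Q : α → ℕ → Store → Prop}
    (h : Spec w p s ν Q) : ∃ ξ : PMF (α × ℕ × Store), ξ.map Prod.fst = ν ∧
      (∀ z ∈ ξ.support, Q z.1 z.2.1 z.2.2) ∧
      ∀ (P : Stmt) (n : ℕ) (γ : ℝ≥0∞) (F : Config n → ℝ≥0∞), Harmonic P w γ F →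
        ∀ k us, F ⟨p :: k, s, us⟩ = expect ξ fun z => γ * z.2.1 + F ⟨k, z.2.2, us⟩ := by
  obtain ⟨ξ, h1, h2, h3⟩ := h
  refine ⟨ξ, h2, h3, fun P n γ F hF k us => ?_⟩
  rw [h1 P n γ F hF, expect_map]
  rfl

end Rules

/-! ## Stores -/

section StoreLemmas
variable (s : Store) (x y a b i c : ℕ)

@[simp] theorem Store.setVar_var : (s.setVar x a).var y = if y = x then a else s.var y := by
  simp [Store.setVar, Function.update_apply]

@[simp] theorem Store.setVar_arr : (s.setVar x a).arr = s.arr := rfl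

@[simp] theorem Store.setArr_var : (s.setArr a i b).var = s.var := rfl

theorem Store.setArr_arr : (s.setArr a i b).arr c =
    if c = a then Function.update (s.arr a) i b else s.arr c := by
  simp only [Store.setArr, Function.update_apply]

@[simp] theorem Store.setArr_arr_apply : (s.setArr a i b).arr c x =
    if c = a ∧ x = i then b else s.arr c x := by
  rw [Store.setArr_arr]
  by_cases h : c = a
  · subst h; simp [Function.update_apply]
  · simp [h]

end StoreLemmas

/-- Only the variables in `vs` and the arrays in `as` may have changed. -/
def Frame (vs as : List ℕ) (s s' : Store) : Prop :=
  (∀ x, x ∉ vs → s'.var x = s.var x) ∧ ∀ a, a ∉ as → s'.arr a = s.arr a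

theorem Frame.refl (vs as : List ℕ) (s : Store) : Frame vs as s s :=
  ⟨fun _ _ => rfl, fun _ _ => rfl⟩

theorem Frame.trans {vs as : List ℕ} {s s' s'' : Store} (h : Frame vs as s s')
    (h' : Frame vs as s' s'') : Frame vs as s s'' :=
  ⟨fun x hx => (h'.1 x hx).trans (h.1 x hx), fun a ha => (h'.2 a ha).trans (h.2 a ha)⟩

theorem Frame.mono {vs as vs' as' : List ℕ} {s s' : Store} (h : Frame vs as s s')
    (hv : vs ⊆ vs') (ha : as ⊆ as') : Frame vs' as' s s' :=
  ⟨fun x hx => h.1 x fun hx' => hx (hv hx'), fun a hx => h.2 a fun hx' => hx (ha hx')⟩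

theorem Frame.setVar {vs as : List ℕ} {s s' : Store} (h : Frame vs as s s') {x : ℕ} (hx : x ∈ vs)
    (a : ℕ) : Frame vs as s (s'.setVar x a) := by
  refine ⟨fun y hy => ?_, h.2⟩
  rw [Store.setVar_var, if_neg (by rintro rfl; exact hy hx), h.1 y hy]

theorem Frame.setArr {vs as : List ℕ} {s s' : Store} (h : Frame vs as s s') {x : ℕ} (hx : x ∈ as)
    (i a : ℕ) : Frame vs as s (s'.setArr x i a) := by
  refine ⟨h.1, fun y hy => ?_⟩
  rw [Store.setArr_arr, if_neg (by rintro rfl; exact hy hx), h.2 y hy]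

/-! ## Expressions that depend on variables only -/

/-- The value of `e` is `a` in every store with the variables of `s`. -/
def Ev (w : ℕ) (s : Store) (e : Expr) (a : ℕ) : Prop :=
  ∀ s' : Store, s'.var = s.var → e.eval w s' = a

section EvRules
variable {w : ℕ} {s : Store} {e f : Expr} {a b : ℕ}

theorem Ev.eq (h : Ev w s e a) : e.eval w s = a := h s rfl

theorem Ev.congr {s' : Store} (h : Ev w s e a) (hs : s'.var = s.var) : Ev w s' e a :=
  fun s'' h' => h s'' (h'.trans hs)

theorem Ev.var {x : ℕ} (h : s.var x = a) : Ev w s (.var x) a :=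
  fun s' h' => by rw [Expr.eval, h', h]

theorem Ev.lit (h : a < 2 ^ w) : Ev w s (.lit a) a :=
  fun _ _ => by rw [Expr.eval, Nat.mod_eq_of_lt h]

theorem Ev.add (he : Ev w s e a) (hf : Ev w s f b) (h : a + b < 2 ^ w) :
    Ev w s (.add e f) (a + b) :=
  fun s' h' => by rw [Expr.eval, he s' h', hf s' h', Nat.mod_eq_of_lt h]

theorem eval_add (he : e.eval w s = a) (hf : f.eval w s = b) (h : a + b < 2 ^ w) :
    (Expr.add e f).eval w s = a + b := by
  rw [Expr.eval, he, hf, Nat.mod_eq_of_lt h]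

theorem eval_mul (he : e.eval w s = a) (hf : f.eval w s = b) (h : a * b < 2 ^ w) :
    (Expr.mul e f).eval w s = a * b := by
  rw [Expr.eval, he, hf, Nat.mod_eq_of_lt h]

theorem eval_lit (h : a < 2 ^ w) : (Expr.lit a).eval w s = a := by
  rw [Expr.eval, Nat.mod_eq_of_lt h]

theorem eval_lt_ne_zero (hw : 1 < 2 ^ w) (he : e.eval w s = a) (hf : f.eval w s = b) :
    (Expr.lt e f).eval w s ≠ 0 ↔ a < b := by
  rw [Expr.eval, he, hf, Nat.mod_eq_of_lt hw]
  split_ifs with h <;> simp [h]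

theorem eval_eq_ne_zero (hw : 1 < 2 ^ w) (he : e.eval w s = a) (hf : f.eval w s = b) :
    (Expr.eq e f).eval w s ≠ 0 ↔ a = b := by
  rw [Expr.eval, he, hf, Nat.mod_eq_of_lt hw]
  split_ifs with h <;> simp [h]

end EvRules

/-! ## Loops -/

/-- `for i = 0, …, N - 1 do body` -/
def forLoop (i : ℕ) (N : Expr) (body : Stmt) : Stmt :=
  .seq (.assign i (.lit 0))
    (.while (.lt (.var i) N) (.seq body (.assign i (.add (.var i) (.lit 1)))))

/-- The invariant `I j t s` records the elapsed time `t`. Two steps lead to the first test, each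
round adds three to the time of the body (guard, sequencing, increment), and the last, failing test
adds one. -/
theorem det_forLoop {w : ℕ} (hw : 1 < 2 ^ w) {s : Store} {i b : ℕ} {N : Expr} {body : Stmt}
    {Q : ℕ → Store → Prop} (I : ℕ → ℕ → Store → Prop) (hb : b < 2 ^ w)
    (hI : ∀ j t s, j ≤ b → I j t s → N.eval w s = b ∧ s.var i = j)
    (h0 : I 0 2 (s.setVar i 0))
    (hs : ∀ j, j < b → ∀ t s, I j t s → Det w body s fun t' s' =>
      s'.var i = j ∧ I (j + 1) (t + t' + 3) (s'.setVar i (j + 1)))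
    (hQ : ∀ t s, I b t s → Q (t + 1) s) : Det w (forLoop i N body) s Q := by
  have key : ∀ d j, j + d = b → ∀ t s, I j t s →
      Det w (.while (.lt (.var i) N) (.seq body (.assign i (.add (.var i) (.lit 1))))) s
        fun t' s' => Q (t + t') s' := by
    intro d
    induction d with
    | zero =>
      intro j hj t s h
      obtain rfl : j = b := by omega
      obtain ⟨h1, h2⟩ := hI _ t s le_rfl h
      refine Det.while_false ?_ (hQ _ _ h)
      have := (eval_lt_ne_zero hw (e := .var i) (s := s) h2 h1).not
      simpa using this
    | succ d ih =>
      intro j hj t s h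
      obtain ⟨h1, h2⟩ := hI j t s (by omega) h
      refine Det.while_true
        ((eval_lt_ne_zero hw (e := .var i) (s := s) h2 h1).2 (by omega)) ?_
      refine Det.seq ((hs j (by omega) t s h).mono fun t' s' h' => Det.assign ?_)
      have e1 : (Expr.add (.var i) (.lit 1)).eval w s' = j + 1 :=
        eval_add h'.1 (eval_lit hw) (by omega)
      rw [e1]
      refine (ih (j + 1) (by omega) _ _ h'.2).mono fun t'' s'' h'' => ?_
      convert h'' using 1
      omega
  refine Det.seq (Det.assign ?_)
  rw [eval_lit (by omega : 0 < 2 ^ w)]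
  refine (key b 0 (by omega) 2 _ h0).mono fun t s h => ?_
  convert h using 1
  omega

/-! ## Rows: dynamic sets of vertices with constant time operations -/

/-- Row `ρ` of the arrays `2`, `3`, `4` (length, entries, positions) holds the list `l`. -/
def HasRow (n : ℕ) (s : Store) (ρ : ℕ) (l : List (Fin n)) : Prop :=
  l.Nodup ∧ s.arr 2 ρ = l.length ∧ ∀ i (h : i < l.length),
    s.arr 3 (ρ * n + i) = l[i] ∧ s.arr 4 (ρ * n + l[i]) = i

/-- The rows `0, …, 2 n` hold the lists `R 0, …, R (2 n)`. -/
def Rows (n : ℕ) (s : Store) (R : ℕ → List (Fin n)) : Prop :=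
  ∀ ρ, ρ ≤ 2 * n → HasRow n s ρ (R ρ)

/-- The word length suffices for addressing all rows. -/
def WordOK (n w : ℕ) : Prop := 16 * ((n + 1) * (n + 1)) ≤ 2 ^ w

theorem WordOK.one_lt {n w : ℕ} (h : WordOK n w) : 1 < 2 ^ w := by
  unfold WordOK at h
  have : 1 ≤ (n + 1) * (n + 1) := Nat.one_le_iff_ne_zero.2 (by positivity)
  omega

theorem WordOK.cell_lt {n w : ℕ} (h : WordOK n w) {ρ i : ℕ} (hρ : ρ ≤ 2 * n) (hi : i ≤ n) :
    ρ * n + i < 2 ^ w := by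
  unfold WordOK at h
  nlinarith

theorem WordOK.lt {n w : ℕ} (h : WordOK n w) {i : ℕ} (hi : i ≤ 8 * (n + 1)) : i < 2 ^ w := by
  unfold WordOK at h
  nlinarith

/-- Quotient and remainder modulo `n` recover row and index, so different rows never share a cell.
-/
theorem cell_inj {n ρ ρ' i i' : ℕ} (hi : i < n) (hi' : i' < n) :
    ρ * n + i = ρ' * n + i' ↔ ρ = ρ' ∧ i = i' := by
  refine ⟨fun h => ?_, fun h => by rw [h.1, h.2]⟩
  have hn : 0 < n := by omega
  have h1 := congrArg (· / n) h
  have h2 := congrArg (· % n) h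
  simp only [Nat.mul_comm _ n, Nat.mul_add_div hn, Nat.div_eq_of_lt hi, Nat.div_eq_of_lt hi',
    Nat.mul_add_mod, Nat.mod_eq_of_lt hi, Nat.mod_eq_of_lt hi'] at h1 h2
  exact ⟨by omega, h2⟩

theorem List.Nodup.length_le_fin {n : ℕ} {l : List (Fin n)} (h : l.Nodup) : l.length ≤ n := by
  simpa using h.length_le_card

theorem List.Nodup.length_lt_fin {n : ℕ} {l : List (Fin n)} (h : l.Nodup) {x : Fin n} (hx : x ∉ l) :
    l.length < n := by
  have := (List.nodup_cons.2 ⟨hx, h⟩).length_le_card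
  simpa using this

section Rows
variable {n w : ℕ} {s s' : Store} {R : ℕ → List (Fin n)} {ρ : ℕ}

theorem HasRow.congr {l : List (Fin n)} (h : HasRow n s ρ l) (h2 : s'.arr 2 ρ = s.arr 2 ρ)
    (h3 : ∀ i < n, s'.arr 3 (ρ * n + i) = s.arr 3 (ρ * n + i))
    (h4 : ∀ i < n, s'.arr 4 (ρ * n + i) = s.arr 4 (ρ * n + i)) : HasRow n s' ρ l := by
  refine ⟨h.1, h2.trans h.2.1, fun i hi => ?_⟩
  have := List.Nodup.length_le_fin h.1
  rw [h3 i (by omega), h4 _ (l[i]).2]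
  exact h.2.2 i hi

theorem Rows.congr (h : Rows n s R) (h2 : s'.arr 2 = s.arr 2) (h3 : s'.arr 3 = s.arr 3)
    (h4 : s'.arr 4 = s.arr 4) : Rows n s' R :=
  fun ρ hρ => (h ρ hρ).congr (by rw [h2]) (by simp [h3]) (by simp [h4])

theorem Rows.frame {vs as : List ℕ} (h : Rows n s R) (hf : Frame vs as s s')
    (has : 2 ∉ as ∧ 3 ∉ as ∧ 4 ∉ as) : Rows n s' R :=
  h.congr (hf.2 2 has.1) (hf.2 3 has.2.1) (hf.2 4 has.2.2)

theorem Rows.update_of (h : Rows n s R) {l : List (Fin n)} (hl : HasRow n s' ρ l)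
    (h2 : ∀ ρ', ρ' ≠ ρ → s'.arr 2 ρ' = s.arr 2 ρ')
    (h3 : ∀ ρ', ρ' ≠ ρ → ∀ i < n, s'.arr 3 (ρ' * n + i) = s.arr 3 (ρ' * n + i))
    (h4 : ∀ ρ', ρ' ≠ ρ → ∀ i < n, s'.arr 4 (ρ' * n + i) = s.arr 4 (ρ' * n + i)) :
    Rows n s' (Function.update R ρ l) := by
  intro ρ' hρ'
  by_cases hr : ρ' = ρ
  · subst hr
    simpa using hl
  · rw [Function.update_of_ne hr]
    exact (h ρ' hρ').congr (h2 ρ' hr) (h3 ρ' hr) (h4 ρ' hr)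

/-- A row holds a set as soon as its length is right and the positions point to the entries. -/
theorem exists_hasRow_of_pos {S : Finset (Fin n)} (h2 : s.arr 2 ρ = S.card)
    (h : ∀ v ∈ S, s.arr 4 (ρ * n + v) < S.card ∧ s.arr 3 (ρ * n + s.arr 4 (ρ * n + v)) = v) :
    ∃ l : List (Fin n), HasRow n s ρ l ∧ ∀ v, v ∈ l ↔ v ∈ S := by
  classical
  have hinj : Set.InjOn (fun v : Fin n => s.arr 4 (ρ * n + v)) S := by
    intro v hv v' hv' hvv
    have h1 := (h v hv).2
    have h2 := (h v' hv').2
    simp only at hvv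
    rw [hvv, h2] at h1
    exact (Fin.ext h1).symm
  -- Positions determine entries, so they are injective on `S`. By counting they fill `0, …, |S| -
  -- 1`, and the list is the inverse map.
  have himg : S.image (fun v : Fin n => s.arr 4 (ρ * n + v)) = Finset.range S.card := by
    refine Finset.eq_of_subset_of_card_le ?_ ?_
    · intro i hi
      obtain ⟨v, hv, rfl⟩ := Finset.mem_image.1 hi
      exact Finset.mem_range.2 (h v hv).1
    · rw [Finset.card_image_of_injOn hinj, Finset.card_range]
  have hex : ∀ i : Fin S.card, ∃ v ∈ S, s.arr 4 (ρ * n + v) = i := by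
    intro i
    have : (i : ℕ) ∈ S.image (fun v : Fin n => s.arr 4 (ρ * n + v)) := by
      rw [himg]; exact Finset.mem_range.2 i.2
    simpa using this
  choose g hg hg' using hex
  refine ⟨List.ofFn g, ⟨?_, ?_, ?_⟩, ?_⟩
  · rw [List.nodup_ofFn]
    intro i j hij
    have h1 := hg' i
    rw [hij, hg' j] at h1
    exact (Fin.ext h1).symm
  · simp [h2]
  · intro i hi
    rw [List.length_ofFn] at hi
    have h1 := (h _ (hg ⟨i, hi⟩)).2
    rw [hg' ⟨i, hi⟩] at h1
    simp only [List.getElem_ofFn]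
    exact ⟨h1, hg' ⟨i, hi⟩⟩
  · intro v
    rw [List.mem_ofFn]
    constructor
    · rintro ⟨i, rfl⟩
      exact hg i
    · intro hv
      refine ⟨⟨_, (h v hv).1⟩, hinj (hg _) hv ?_⟩
      simp only [hg']

theorem HasRow.pos_of_mem {l : List (Fin n)} (h : HasRow n s ρ l) {v : Fin n} (hv : v ∈ l) :
    s.arr 4 (ρ * n + v) < l.length ∧ s.arr 3 (ρ * n + s.arr 4 (ρ * n + v)) = v := by
  obtain ⟨i, hi, rfl⟩ := List.getElem_of_mem hv
  obtain ⟨h3, h4⟩ := h.2.2 i hi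
  rw [h4]
  exact ⟨hi, h3⟩

/-- The address of entry `i` of row `ρ`. -/
def cell (ρ i : Expr) : Expr := .add (.mul ρ (.var 0)) i

theorem eval_cell (hw : WordOK n w) {e f : Expr} {i : ℕ} (hn : s.var 0 = n) (he : e.eval w s = ρ)
    (hf : f.eval w s = i) (hρ : ρ ≤ 2 * n) (hi : i ≤ n) : (cell e f).eval w s = ρ * n + i :=
  eval_add (eval_mul he hn (by have := hw.cell_lt hρ (Nat.zero_le n); omega)) hf (hw.cell_lt hρ hi)

/-- Append the vertex `x` to row `ρ`. -/
def rowInsert (ρ x : Expr) : Stmt :=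
  .seq (.store 3 (cell ρ (.get 2 ρ)) x)
    (.seq (.store 4 (cell ρ x) (.get 2 ρ)) (.store 2 ρ (.add (.get 2 ρ) (.lit 1))))

/-- Remove the vertex `x` from row `ρ`. -/
def rowErase (ρ x : Expr) : Stmt :=
  .seq (.store 2 ρ (.sub (.get 2 ρ) (.lit 1)))
    (.seq (.store 3 (cell ρ (.get 4 (cell ρ x))) (.get 3 (cell ρ (.get 2 ρ))))
      (.store 4 (cell ρ (.get 3 (cell ρ (.get 2 ρ)))) (.get 4 (cell ρ x))))

theorem det_rowInsert (hw : WordOK n w) (hn : s.var 0 = n) (hR : Rows n s R) {e f : Expr}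
    {x : Fin n} (he : Ev w s e ρ) (hf : Ev w s f x) (hρ : ρ ≤ 2 * n) (hx : x ∉ R ρ) :
    Det w (rowInsert e f) s fun t s' => t = 5 ∧ Frame [] [2, 3, 4] s s' ∧
      Rows n s' (Function.update R ρ (R ρ ++ [x])) := by
  have hl := (hR ρ hρ).2.1
  have hlt := List.Nodup.length_lt_fin (hR ρ hρ).1 hx
  refine Det.seq (Det.store ?_)
  rw [eval_cell hw hn he.eq (f := .get 2 e) (by rw [Expr.eval, he.eq, hl]) hρ hlt.le, hf.eq]
  set s1 := s.setArr 3 (ρ * n + (R ρ).length) x with hs1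
  have he1 : Ev w s1 e ρ := he.congr rfl
  have hf1 : Ev w s1 f x := hf.congr rfl
  refine Det.seq (Det.store ?_)
  rw [eval_cell (s := s1) hw hn he1.eq hf1.eq hρ x.2.le,
    show (Expr.get 2 e).eval w s1 = (R ρ).length by
      rw [Expr.eval, he1.eq, hs1, Store.setArr_arr_apply, if_neg (by simp), hl]]
  set s2 := s1.setArr 4 (ρ * n + x) (R ρ).length with hs2
  refine Det.store ?_
  rw [(he.congr (s' := s2) rfl).eq, eval_add (a := (R ρ).length) (b := 1) _ (eval_lit hw.one_lt)
    (hw.lt (by omega))]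
  swap
  · rw [Expr.eval, (he.congr (s' := s2) rfl).eq]
    simp [hs2, hs1, hl]
  refine ⟨by omega, ?_, ?_⟩
  · exact ((((Frame.refl _ _ s).setArr (by simp) _ _)).setArr (by simp) _ _).setArr (by simp) _ _
  · refine hR.update_of ⟨?_, ?_, ?_⟩ ?_ ?_ ?_
    · rw [List.nodup_append]
      refine ⟨(hR ρ hρ).1, by simp, ?_⟩
      rintro a ha b hb rfl
      rw [List.mem_singleton] at hb
      exact hx (hb ▸ ha)
    · simp
    · intro i hi
      rw [List.length_append, List.length_singleton] at hi
      simp only [Store.setArr_arr_apply, hs2, hs1]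
      have hin : i < n := by omega
      by_cases hil : i = (R ρ).length
      · subst hil
        simp
      · have hi' : i < (R ρ).length := by omega
        have hne : ((R ρ)[i] : ℕ) ≠ x := by
          intro h
          exact hx (Fin.ext h ▸ List.getElem_mem hi')
        rw [List.getElem_append_left hi']
        simp [hil, hne, (hR ρ hρ).2.2 i hi']
    · intro ρ' h
      simp [hs2, hs1, h]
    · intro ρ' h i hi
      simp [hs2, hs1, cell_inj hi hlt, h]
    · intro ρ' h i hi
      simp [hs2, hs1, cell_inj hi x.2, h]

/-- The last entry moves into the slot of `x`. The order of the row is lost, so only membership in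
the new list is stated. If `x` is itself the last entry, the two later writes change nothing within
the new length. -/
theorem det_rowErase (hw : WordOK n w) (hn : s.var 0 = n) (hR : Rows n s R) {e f : Expr}
    {x : Fin n} (he : Ev w s e ρ) (hf : Ev w s f x) (hρ : ρ ≤ 2 * n) (hx : x ∈ R ρ) :
    Det w (rowErase e f) s fun t s' => t = 5 ∧ Frame [] [2, 3, 4] s s' ∧
      ∃ l, (∀ v, v ∈ l ↔ v ∈ R ρ ∧ v ≠ x) ∧ Rows n s' (Function.update R ρ l) := by
  classical
  obtain ⟨hnd, hl, hrow⟩ := hR ρ hρ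
  set d := (R ρ).length - 1 with hd
  have hpos : 0 < (R ρ).length := List.length_pos_of_mem hx
  have hlen := List.Nodup.length_le_fin hnd
  obtain ⟨hp, hp'⟩ := (hR ρ hρ).pos_of_mem hx
  set p := s.arr 4 (ρ * n + x) with hpdef
  have hdl : d < (R ρ).length := by omega
  set y := (R ρ)[d] with hy
  obtain ⟨hy3, hy4⟩ := hrow d hdl
  refine Det.seq (Det.store ?_)
  rw [he.eq, show (Expr.sub (.get 2 e) (.lit 1)).eval w s = d by
    rw [Expr.eval, eval_lit hw.one_lt, Expr.eval, he.eq, hl]]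
  set s1 := s.setArr 2 ρ d with hs1
  have he1 : Ev w s1 e ρ := he.congr rfl
  have hf1 : Ev w s1 f x := hf.congr rfl
  have hg1 : (Expr.get 2 e).eval w s1 = d := by rw [Expr.eval, he1.eq]; simp [hs1]
  have hx1 : (Expr.get 4 (cell e f)).eval w s1 = p := by
    rw [Expr.eval, eval_cell (s := s1) hw hn he1.eq hf1.eq hρ x.2.le]
    simp [hs1, hpdef]
  refine Det.seq (Det.store ?_)
  rw [eval_cell hw (s := s1) hn he1.eq hx1 hρ (by omega),
    show (Expr.get 3 (cell e (.get 2 e))).eval w s1 = y by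
      rw [Expr.eval, eval_cell (s := s1) hw hn he1.eq hg1 hρ (by omega)]
      simpa [hs1] using hy3]
  set s2 := s1.setArr 3 (ρ * n + p) y with hs2
  have he2 : Ev w s2 e ρ := he.congr rfl
  have hf2 : Ev w s2 f x := hf.congr rfl
  have hg2 : (Expr.get 2 e).eval w s2 = d := by rw [Expr.eval, he2.eq]; simp [hs2, hs1]
  have hy2 : (Expr.get 3 (cell e (.get 2 e))).eval w s2 = y := by
    rw [Expr.eval, eval_cell (s := s2) hw hn he2.eq hg2 hρ (by omega)]
    -- The last entry is read again after slot `p` was overwritten; it is still `y`, because slot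
    -- `p` now also holds `y`.
    by_cases h : d = p
    · simp [hs2, h]
    · simpa [hs2, h, hs1] using hy3
  have hx2 : (Expr.get 4 (cell e f)).eval w s2 = p := by
    rw [Expr.eval, eval_cell (s := s2) hw hn he2.eq hf2.eq hρ x.2.le]
    simp [hs2, hs1, hpdef]
  refine Det.store ?_
  rw [eval_cell hw (s := s2) hn he2.eq hy2 hρ y.2.le, hx2]
  set s3 := s2.setArr 4 (ρ * n + y) p with hs3
  refine ⟨by omega, ?_, ?_⟩
  · exact ((((Frame.refl _ _ s).setArr (by simp) _ _)).setArr (by simp) _ _).setArr (by simp) _ _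
  have hcard : ((R ρ).toFinset.erase x).card = d := by
    rw [Finset.card_erase_of_mem (by simpa using hx), List.toFinset_card_of_nodup hnd]
  obtain ⟨l, hl, hlS⟩ := exists_hasRow_of_pos (s := s3) (ρ := ρ) (S := (R ρ).toFinset.erase x)
    (by rw [hcard]; simp [hs3, hs2, hs1]) (by
      intro v hv
      rw [hcard]
      simp only [Finset.mem_erase, List.mem_toFinset] at hv
      obtain ⟨hvx, hv⟩ := hv
      obtain ⟨hq, hq'⟩ := (hR ρ hρ).pos_of_mem hv
      -- A remaining vertex cannot sit in the slot of `x`; this covers every vertex other than `y`,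
      -- and shows that `y` really moves when it differs from `x`.
      have hqp : s.arr 4 (ρ * n + v) ≠ p := by
        intro h
        rw [h, hp'] at hq'
        exact hvx (Fin.ext hq'.symm)
      have hyx : v = y → p ≠ d := by
        rintro hvy h
        apply hqp
        rw [hvy, hy4, h]
      by_cases hvy : v = y
      · have h4 : s3.arr 4 (ρ * n + v) = p := by simp [hs3, hvy]
        have := hyx hvy
        rw [h4]
        refine ⟨by omega, ?_⟩
        simp [hs3, hs2, hvy]
      · have hvy' : (v : ℕ) ≠ y := fun h => hvy (Fin.ext h)
        have h4 : s3.arr 4 (ρ * n + v) = s.arr 4 (ρ * n + v) := by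
          simp [hs3, hs2, hs1, hvy']
        have hqd : s.arr 4 (ρ * n + v) ≠ d := by
          intro h
          rw [h, hy3] at hq'
          exact hvy' hq'.symm
        rw [h4]
        refine ⟨by omega, ?_⟩
        simp [hs3, hs2, hs1, hqp, hq'])
  refine ⟨l, fun v => by rw [hlS]; simp [and_comm], hR.update_of hl ?_ ?_ ?_⟩
  · intro ρ' h
    simp [hs3, hs2, hs1, h]
  · intro ρ' h i hi
    simp [hs3, hs2, hs1, cell_inj hi (show p < n by omega), h]
  · intro ρ' h i hi
    simp [hs3, hs2, hs1, cell_inj hi y.2, h]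

/-- Entries beyond the stored length are ignored, so a row is emptied in constant time. -/
theorem Rows.clear (hR : Rows n s R) (ρ : ℕ) :
    Rows n (s.setArr 2 ρ 0) (Function.update R ρ []) := by
  refine hR.update_of ⟨by simp, by simp, by simp⟩ ?_ ?_ ?_
  · intro ρ' h
    simp [h]
  · simp
  · simp

/-- `for y in row ρ do body`, with the loop counter `j` -/
def forRow (j y : ℕ) (ρ : Expr) (body : Stmt) : Stmt :=
  forLoop j (.get 2 ρ) (.seq (.assign y (.get 3 (cell ρ (.var j)))) body)

/-- The invariant is indexed by the part of the row already visited and keeps the row equal to the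
fixed list `l`. Fetching the entry adds two steps to the three of `det_forLoop`. -/
theorem det_forRow (hw : WordOK n w) {j y : ℕ} {e : Expr} {body : Stmt} {l : List (Fin n)}
    {Q : ℕ → Store → Prop} (I : List (Fin n) → ℕ → Store → Prop) (hρ : ρ ≤ 2 * n)
    (hl : l.length ≤ n)
    (hI : ∀ pre t s, I pre t s →
      s.var 0 = n ∧ e.eval w s = ρ ∧ HasRow n s ρ l ∧ s.var j = pre.length)
    (h0 : I [] 2 (s.setVar j 0))
    (hs : ∀ pre (v : Fin n) post, l = pre ++ v :: post → ∀ t s, I pre t s →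
      Det w body (s.setVar y v) fun t' s' => s'.var j = pre.length ∧
        I (pre ++ [v]) (t + t' + 5) (s'.setVar j (pre.length + 1)))
    (hQ : ∀ t s, I l t s → Q (t + 1) s) : Det w (forRow j y e body) s Q := by
  refine det_forLoop hw.one_lt (fun i t s => I (l.take i) t s ∧ i ≤ l.length) (b := l.length)
    (hw.lt (by omega)) ?_ ?_ ?_ ?_
  · rintro i t s hi ⟨h, -⟩
    obtain ⟨h1, h2, h3, h4⟩ := hI _ _ _ h
    refine ⟨by rw [Expr.eval, h2, h3.2.1], ?_⟩
    rw [h4, List.length_take, min_eq_left hi]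
  · simpa using h0
  · rintro i hi t s ⟨h, -⟩
    obtain ⟨h1, h2, h3, h4⟩ := hI _ _ _ h
    have hlen : (l.take i).length = i := by rw [List.length_take, min_eq_left hi.le]
    refine Det.seq (Det.assign ?_)
    have hv : (Expr.get 3 (cell e (.var j))).eval w s = l[i] := by
      rw [Expr.eval, eval_cell hw h1 h2 (show (Expr.var j).eval w s = i by rw [Expr.eval, h4, hlen])
        hρ (by omega)]
      exact (h3.2.2 i hi).1
    rw [hv]
    refine (hs (l.take i) l[i] (l.drop (i + 1)) ?_ t s h).mono fun t' s' h' => ?_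
    · rw [List.cons_getElem_drop_succ, List.take_append_drop]
    · rw [hlen] at h'
      refine ⟨h'.1, ?_, by omega⟩
      convert h'.2 using 1
      · rw [List.take_succ_eq_append_getElem hi]
      · omega
  · rintro t s ⟨h, -⟩
    rw [List.take_length] at h
    exact hQ t s h

end Rows

/-! ## Uniformly random orders -/

section RandomOrder
variable {V : Type}

theorem uniformOfFinset_bind_apply {β : Type} {R : Finset V} (h : R.Nonempty) (f : V → PMF β)
    (b : β) : (PMF.uniformOfFinset R h).bind f b = (R.card : ℝ≥0∞)⁻¹ * ∑ x ∈ R, f x b := by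
  rw [PMF.bind_apply, tsum_eq_sum (s := R), Finset.mul_sum]
  · exact Finset.sum_congr rfl fun x hx => by rw [PMF.uniformOfFinset_apply_of_mem h hx]
  · intro x hx
    rw [PMF.uniformOfFinset_apply_of_notMem h hx, zero_mul]

theorem expect_uniformOfFinset {R : Finset V} (h : R.Nonempty) (F : V → ℝ≥0∞) :
    expect (PMF.uniformOfFinset R h) F = (R.card : ℝ≥0∞)⁻¹ * ∑ x ∈ R, F x := by
  rw [expect, tsum_eq_sum (s := R), Finset.mul_sum]
  · exact Finset.sum_congr rfl fun x hx => by rw [PMF.uniformOfFinset_apply_of_mem h hx]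
  · intro x hx
    rw [PMF.uniformOfFinset_apply_of_notMem h hx, zero_mul]

variable [DecidableEq V]

/-- A uniformly random order of `R`, drawn element by element; `k` is the number of elements. -/
noncomputable def randomOrderAux : ℕ → Finset V → PMF (List V)
  | 0, _ => PMF.pure []
  | k + 1, R => if h : R.Nonempty then
      (PMF.uniformOfFinset R h).bind fun x => (randomOrderAux k (R.erase x)).map (List.cons x)
    else PMF.pure []

/-- A uniformly random order of `R`. -/
noncomputable def randomOrder (R : Finset V) : PMF (List V) := randomOrderAux R.card R

theorem randomOrder_empty : randomOrder (∅ : Finset V) = PMF.pure [] := rfl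

/-- The recursion without the auxiliary counter: a uniform first element, then a random order of the
rest. The greedy loop of the program has exactly this shape. -/
theorem randomOrder_of_nonempty {R : Finset V} (h : R.Nonempty) :
    randomOrder R = (PMF.uniformOfFinset R h).bind fun x =>
      (randomOrder (R.erase x)).map (List.cons x) := by
  obtain ⟨k, hk⟩ := Nat.exists_eq_succ_of_ne_zero h.card_ne_zero
  rw [randomOrder, hk, randomOrderAux, dif_pos h]
  ext l
  rw [PMF.bind_apply, PMF.bind_apply]
  refine tsum_congr fun x => ?_
  by_cases hx : x ∈ R
  · rw [randomOrder, Finset.card_erase_of_mem hx, hk, Nat.succ_sub_one]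
  · rw [PMF.uniformOfFinset_apply_of_notMem h hx, zero_mul, zero_mul]

theorem map_cons_apply_cons (ν : PMF (List V)) (x y : V) (l : List V) :
    ν.map (List.cons x) (y :: l) = if y = x then ν l else 0 := by
  rw [PMF.map_apply]
  split_ifs with h
  · rw [tsum_eq_single l]
    · simp [h]
    · intro l' hl'
      simp [h, hl'.symm]
  · simp [h]

/-- Each enumeration arises from one sequence of draws, with probability `1 / |R| * 1 / (|R| - 1)! =
1 / |R|!`. -/
theorem randomOrder_apply (R : Finset V) (l : List V) :
    randomOrder R l = if l.Nodup ∧ l.toFinset = R then ((R.card.factorial : ℕ) : ℝ≥0∞)⁻¹ else 0 := by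
  induction l generalizing R with
  | nil =>
    rcases R.eq_empty_or_nonempty with rfl | h
    · simp [randomOrder_empty]
    · rw [randomOrder_of_nonempty h, uniformOfFinset_bind_apply]
      simp [h.ne_empty.symm]
  | cons y l ih =>
    rcases R.eq_empty_or_nonempty with rfl | h
    · simp [randomOrder_empty]
    · rw [randomOrder_of_nonempty h, uniformOfFinset_bind_apply]
      simp only [map_cons_apply_cons, Finset.sum_ite_eq, ih]
      by_cases hy : y ∈ R
      · have hiff : ((y :: l).Nodup ∧ (y :: l).toFinset = R) ↔
            (l.Nodup ∧ l.toFinset = R.erase y) := by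
          rw [List.nodup_cons, List.toFinset_cons]
          constructor
          · rintro ⟨⟨h1, h2⟩, rfl⟩
            exact ⟨h2, by rw [Finset.erase_insert (by simpa using h1)]⟩
          · rintro ⟨h1, h2⟩
            refine ⟨⟨?_, h1⟩, by rw [h2, Finset.insert_erase hy]⟩
            intro hyl
            rw [← List.mem_toFinset, h2] at hyl
            simp at hyl
        rw [if_pos hy]
        simp only [hiff]
        split_ifs
        · rw [Finset.card_erase_of_mem hy, ← ENNReal.mul_inv (by simp) (by simp),
            ← Nat.cast_mul, Nat.mul_factorial_pred h.card_ne_zero]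
        · simp
      · rw [if_neg hy, if_neg, mul_zero]
        rintro ⟨-, rfl⟩
        simp at hy

theorem nodup_of_mem_support_randomOrder {R : Finset V} {l : List V}
    (h : l ∈ (randomOrder R).support) : l.Nodup ∧ l.toFinset = R := by
  rw [PMF.mem_support_iff, randomOrder_apply] at h
  by_contra h'
  exact h (if_neg h')

theorem card_mul_expect_randomOrder {R : Finset V} (h : R.Nonempty) (F : List V → ℝ≥0∞) :
    (R.card : ℝ≥0∞) * expect (randomOrder R) F =
      ∑ x ∈ R, expect (randomOrder (R.erase x)) fun l => F (x :: l) := by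
  rw [randomOrder_of_nonempty h, expect_bind, expect_uniformOfFinset, ← mul_assoc,
    ENNReal.mul_inv_cancel (by simp [h.ne_empty]) (by simp), one_mul]
  exact Finset.sum_congr rfl fun x _ => by rw [expect_map]; rfl

/-- The first `k` elements of a random order contain a given element with probability at most
`k / |R|`. -/
theorem card_mul_expect_mem_take (k : ℕ) (R : Finset V) (a : V) :
    (R.card : ℝ≥0∞) * expect (randomOrder R) (fun l => if a ∈ l.take k then 1 else 0) ≤ k := by
  induction k generalizing R with
  | zero => simp
  | succ k ih =>
    rcases R.eq_empty_or_nonempty with rfl | h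
    · simp
    by_cases ha : a ∈ R
    · rw [card_mul_expect_randomOrder h, ← Finset.add_sum_erase _ _ ha, Nat.cast_succ, add_comm]
      refine add_le_add ?_ ?_
      -- If the first element is some `x ≠ a`, induction gives `k / (|R| - 1)`; there are `|R| - 1`
      -- such `x`, so together they contribute at most `k`. The case `x = a` contributes at most
      -- `1`.
      · have : ∀ x ∈ R.erase a, (expect (randomOrder (R.erase x)) fun l =>
            if a ∈ (x :: l).take (k + 1) then (1 : ℝ≥0∞) else 0) ≤ k / ((R.erase a).card : ℕ) := by
          intro x hx
          obtain ⟨hxa, hxR⟩ := Finset.mem_erase.1 hx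
          have h0 : (R.erase a).card ≠ 0 := Finset.card_ne_zero_of_mem hx
          rw [ENNReal.le_div_iff_mul_le (by simp [-Finset.card_eq_zero, h0]) (by simp), mul_comm]
          have := ih (R.erase x)
          rw [Finset.card_erase_of_mem hxR, ← Finset.card_erase_of_mem ha] at this
          simpa [hxa.symm] using this
        refine (Finset.sum_le_sum this).trans ?_
        rw [Finset.sum_const, nsmul_eq_mul]
        exact ENNReal.mul_div_le
      · refine (expect_mono (F' := fun _ => 1) fun l _ => ?_).trans (expect_const _ _).le
        split_ifs <;> simp
    · have : (expect (randomOrder R) fun l => if a ∈ l.take (k + 1) then (1 : ℝ≥0∞) else 0) = 0 := by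
        rw [expect_eq_zero]
        intro l hl
        rw [if_neg]
        intro hal
        have := (nodup_of_mem_support_randomOrder hl).2
        exact ha (this ▸ List.mem_toFinset.2 (List.mem_of_mem_take hal))
      rw [this, mul_zero]
      simp

/-- Discarding the elements outside `R` leaves a random order of the elements in `R`. -/
theorem randomOrder_map_filter (U R : Finset V) :
    (randomOrder U).map (List.filter (· ∈ R)) = randomOrder (U ∩ R) := by
  induction hc : U.card generalizing U with
  | zero =>
    rw [Finset.card_eq_zero] at hc
    subst hc
    simp [randomOrder_empty, PMF.pure_map]
  | succ c ih =>
    have hU : U.Nonempty := Finset.card_pos.1 (by omega)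
    -- A first element in `R` becomes the first element of the filtered order; one outside `R`
    -- disappears and leaves a random order of the same set `U ∩ R`.
    have hx : ∀ x ∈ U, ((randomOrder (U.erase x)).map (List.cons x)).map (List.filter (· ∈ R)) =
        if x ∈ R then (randomOrder ((U ∩ R).erase x)).map (List.cons x)
        else randomOrder (U ∩ R) := by
      intro x hxU
      have ih' := ih (U.erase x) (by rw [Finset.card_erase_of_mem hxU, hc]; rfl)
      rw [PMF.map_comp]
      split_ifs with hxR
      · have : (List.filter (fun y => decide (y ∈ R))) ∘ List.cons x =
            List.cons x ∘ List.filter (fun y => decide (y ∈ R)) := by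
          ext1 l
          simp [hxR]
        rw [this, ← PMF.map_comp, ih', Finset.erase_inter]
      · have : (List.filter (fun y => decide (y ∈ R))) ∘ List.cons x =
            List.filter (fun y => decide (y ∈ R)) := by
          ext1 l
          simp [hxR]
        rw [this, ih', Finset.erase_inter, Finset.erase_eq_of_notMem]
        simp [hxR]
    rw [randomOrder_of_nonempty hU, PMF.map_bind]
    ext l
    rw [uniformOfFinset_bind_apply, Finset.sum_congr rfl fun x hxU => by rw [hx x hxU]]
    have hsum : ∑ x ∈ U, (if x ∈ R then (randomOrder ((U ∩ R).erase x)).map (List.cons x)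
          else randomOrder (U ∩ R)) l =
        ∑ x ∈ U ∩ R, (randomOrder ((U ∩ R).erase x)).map (List.cons x) l +
          (U \ R).card * randomOrder (U ∩ R) l := by
      rw [← Finset.sum_inter_add_sum_sdiff U R]
      congr 1
      · refine Finset.sum_congr rfl fun x hx => ?_
        rw [if_pos (Finset.mem_inter.1 hx).2]
      · rw [Finset.sum_congr rfl fun x hx => by rw [if_neg (Finset.mem_sdiff.1 hx).2],
          Finset.sum_const, nsmul_eq_mul]
    rw [hsum]
    have hUR : ((U ∩ R).card : ℝ≥0∞) + (U \ R).card = U.card := by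
      rw [← Nat.cast_add, Finset.card_inter_add_card_sdiff]
    -- The draws inside `R` also average to a random order of `U ∩ R`, so all `|U|` draws lead to
    -- the same law.
    have hmul : ∑ x ∈ U ∩ R, (randomOrder ((U ∩ R).erase x)).map (List.cons x) l =
        (U ∩ R).card * randomOrder (U ∩ R) l := by
      rcases (U ∩ R).eq_empty_or_nonempty with h | h
      · rw [h]
        simp
      · conv_rhs => rw [randomOrder_of_nonempty h, uniformOfFinset_bind_apply]
        rw [← mul_assoc, ENNReal.mul_inv_cancel (by simp [h.ne_empty]) (by simp), one_mul]
    rw [hmul, ← add_mul, hUR, ← mul_assoc, ENNReal.inv_mul_cancel (by simp [hU.ne_empty]) (by simp),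
      one_mul]

end RandomOrder

/-! ## Greedy independent sets -/

section Greedy
variable {n : ℕ} (G : SimpleGraph (Fin n))

open Classical in
/-- One step of the greedy algorithm. -/
noncomputable def greedyStep (S : Finset (Fin n)) (x : Fin n) : Finset (Fin n) :=
  if ∃ u ∈ S, G.Adj x u then S else insert x S

/-- The greedy algorithm for the order `l`, starting with the independent set `S`. -/
noncomputable def greedyFrom (S : Finset (Fin n)) (l : List (Fin n)) : Finset (Fin n) :=
  l.foldl (greedyStep G) S

theorem greedy_eq_greedyFrom (σ : Equiv.Perm (Fin n)) :
    greedy G σ = greedyFrom G ∅ ((List.finRange n).map σ) := by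
  rw [greedyFrom, List.foldl_map]
  rfl

/-- Every repetition-free enumeration of `Fin n` comes from exactly one permutation, so both sides
give it mass `1 / n!`. -/
theorem map_perm_eq_randomOrder :
    (PMF.uniformOfFintype (Equiv.Perm (Fin n))).map
        (fun σ : Equiv.Perm (Fin n) => (List.finRange n).map σ) =
      randomOrder Finset.univ := by
  ext l
  rw [randomOrder_apply, PMF.map_apply]
  simp only [PMF.uniformOfFintype_apply, Fintype.card_perm, Fintype.card_fin, Finset.card_univ]
  split_ifs with h
  · obtain ⟨h1, h2⟩ := h
    have hlen : l.length = n := by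
      rw [← List.toFinset_card_of_nodup h1, h2, Finset.card_univ, Fintype.card_fin]
    let f : Fin n → Fin n := fun i => l.get (Fin.cast hlen.symm i)
    have hf : Function.Injective f := fun i j hij => by
      have := (List.nodup_iff_injective_get.1 h1) hij
      simpa using this
    let σ : Equiv.Perm (Fin n) := Equiv.ofBijective f (Finite.injective_iff_bijective.1 hf)
    have hσ : (List.finRange n).map σ = l := by
      refine List.ext_getElem (by simp [hlen]) fun i h h' => ?_
      simp [σ, f]
    rw [tsum_eq_single σ, if_pos hσ.symm]
    intro τ hτ
    rw [if_neg]
    rintro rfl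
    apply hτ
    ext1 i
    have := List.map_inj_left.1 hσ i (List.mem_finRange i)
    exact this.symm
  · refine ENNReal.tsum_eq_zero.2 fun σ => if_neg ?_
    rintro rfl
    refine h ⟨(List.nodup_finRange n).map σ.injective, ?_⟩
    ext v
    simp only [List.mem_toFinset, List.mem_map, List.mem_finRange, true_and, Finset.mem_univ,
      iff_true]
    exact ⟨σ.symm v, by simp⟩

theorem greedyFrom_append (S : Finset (Fin n)) (l l' : List (Fin n)) :
    greedyFrom G S (l ++ l') = greedyFrom G (greedyFrom G S l) l' := List.foldl_append ..

theorem greedyFrom_concat (S : Finset (Fin n)) (l : List (Fin n)) (x : Fin n) :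
    greedyFrom G S (l ++ [x]) = greedyStep G (greedyFrom G S l) x := by
  rw [greedyFrom_append]
  rfl

variable {G}

theorem subset_greedyStep (S : Finset (Fin n)) (x : Fin n) : S ⊆ greedyStep G S x := by
  unfold greedyStep
  split_ifs
  · rfl
  · exact Finset.subset_insert _ _

theorem greedyStep_subset (S : Finset (Fin n)) (x : Fin n) : greedyStep G S x ⊆ insert x S := by
  unfold greedyStep
  split_ifs
  · exact Finset.subset_insert _ _
  · rfl

theorem subset_greedyFrom (S : Finset (Fin n)) (l : List (Fin n)) : S ⊆ greedyFrom G S l := by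
  induction l generalizing S with
  | nil => exact subset_rfl
  | cons x l ih => exact (subset_greedyStep S x).trans (ih _)

theorem greedyFrom_subset (S : Finset (Fin n)) (l : List (Fin n)) :
    greedyFrom G S l ⊆ S ∪ l.toFinset := by
  induction l generalizing S with
  | nil => simp [greedyFrom]
  | cons x l ih =>
    refine (ih _).trans ?_
    rw [List.toFinset_cons, Finset.union_insert, ← Finset.insert_union]
    exact Finset.union_subset_union_left (greedyStep_subset S x)

theorem greedyFrom_isIndepSet (l : List (Fin n)) {S : Finset (Fin n)}
    (hS : ∀ u ∈ S, ∀ v ∈ S, ¬ G.Adj u v) :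
    ∀ u ∈ greedyFrom G S l, ∀ v ∈ greedyFrom G S l, ¬ G.Adj u v := by
  induction l generalizing S with
  | nil => exact hS
  | cons x l ih =>
    refine ih ?_
    unfold greedyStep
    split_ifs with h
    · exact hS
    · push Not at h
      simp only [Finset.mem_insert]
      rintro u (rfl | hu) v (rfl | hv)
      · exact G.loopless.irrefl _
      · exact h v hv
      · exact fun h' => h u hu h'.symm
      · exact hS u hu v hv

/-- Isolated vertices do not matter for the greedy algorithm, except that they are taken. -/
theorem greedyFrom_filter (l : List (Fin n)) (R : Finset (Fin n))
    (hR : ∀ u v, G.Adj u v → u ∈ R) :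
    greedyFrom G ∅ l = greedyFrom G ∅ (l.filter (· ∈ R)) ∪ (l.toFinset \ R) := by
  induction l using List.reverseRecOn with
  | nil => simp [greedyFrom]
  | append_singleton l x ih =>
    have hiff : (∃ u ∈ greedyFrom G ∅ l, G.Adj x u) ↔
        ∃ u ∈ greedyFrom G ∅ (l.filter (· ∈ R)), G.Adj x u := by
      rw [ih]
      constructor
      · rintro ⟨u, hu, hxu⟩
        rcases Finset.mem_union.1 hu with hu | hu
        · exact ⟨u, hu, hxu⟩
        · exact absurd (hR _ _ hxu.symm) (Finset.mem_sdiff.1 hu).2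
      · rintro ⟨u, hu, hxu⟩
        exact ⟨u, Finset.mem_union_left _ hu, hxu⟩
    rw [greedyFrom_concat, List.filter_append]
    by_cases hx : x ∈ R
    · have h1 : [x].filter (· ∈ R) = [x] := by simp [hx]
      have h2 : (l ++ [x]).toFinset \ R = l.toFinset \ R := by
        ext y
        simp only [List.toFinset_append, Finset.mem_sdiff, Finset.mem_union, List.mem_toFinset,
          List.mem_singleton]
        constructor
        · rintro ⟨h | rfl, h'⟩
          · exact ⟨h, h'⟩
          · exact absurd hx h'
        · exact fun h => ⟨Or.inl h.1, h.2⟩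
      rw [h1, greedyFrom_concat, h2]
      by_cases h : ∃ u ∈ greedyFrom G ∅ l, G.Adj x u
      · rw [greedyStep, if_pos h, greedyStep, if_pos (hiff.1 h)]
        exact ih
      · rw [greedyStep, if_neg h, greedyStep, if_neg (hiff.not.1 h), ih, Finset.insert_union]
    · have h1 : [x].filter (· ∈ R) = [] := by simp [hx]
      rw [h1, List.append_nil]
      unfold greedyStep
      rw [if_neg, ih, List.toFinset_append, Finset.union_sdiff_distrib]
      · ext y
        simp only [Finset.mem_insert, Finset.mem_union, Finset.mem_sdiff, List.mem_toFinset,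
          List.mem_singleton]
        constructor
        · rintro (rfl | h | h)
          · exact Or.inr (Or.inr ⟨rfl, hx⟩)
          · exact Or.inl h
          · exact Or.inr (Or.inl h)
        · rintro (h | h | h)
          · exact Or.inr (Or.inl h)
          · exact Or.inr (Or.inr h)
          · exact Or.inl h.1
      · rintro ⟨u, -, hxu⟩
        exact hx (hR _ _ hxu)

/-- Greedy takes all vertices outside `R`, since they are isolated, and they block nothing. Their
removal turns a uniform order into a uniform order of `R`, so the work can be confined to the
non-isolated vertices. -/
theorem randomGreedy_eq (R : Finset (Fin n)) (hR : ∀ u v, G.Adj u v → u ∈ R) :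
    randomGreedy G = (randomOrder R).map fun l => greedyFrom G ∅ l ∪ Rᶜ := by
  have h1 : greedy G = greedyFrom G ∅ ∘ fun σ : Equiv.Perm (Fin n) => (List.finRange n).map σ := by
    ext1 σ
    exact greedy_eq_greedyFrom G σ
  have h2 : randomOrder R = (randomOrder Finset.univ).map (List.filter (· ∈ R)) := by
    rw [randomOrder_map_filter, Finset.univ_inter]
  rw [randomGreedy, h1, ← PMF.map_comp, map_perm_eq_randomOrder, h2, PMF.map_comp]
  ext S
  simp only [PMF.map_apply]
  refine tsum_congr fun l => ?_
  by_cases hl : randomOrder Finset.univ l = 0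
  · simp [hl]
  · have := nodup_of_mem_support_randomOrder ((PMF.mem_support_iff _ _).2 hl)
    rw [greedyFrom_filter l R hR, this.2]
    rfl

/-! ## The residual graph -/

open Classical in
/-- The vertices that are neither taken nor dominated. -/
noncomputable def residual (G : SimpleGraph (Fin n)) (S : Finset (Fin n)) : Finset (Fin n) :=
  Finset.univ.filter fun v => v ∉ S ∧ ∀ u ∈ S, ¬ G.Adj v u

open Classical in
/-- The neighbours of `a` in `H`, if `a` itself is in `H`. -/
noncomputable def nbrsIn (G : SimpleGraph (Fin n)) (H : Finset (Fin n)) (a : Fin n) :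
    Finset (Fin n) :=
  if a ∈ H then H.filter (G.Adj a) else ∅

theorem mem_residual {S : Finset (Fin n)} {v : Fin n} :
    v ∈ residual G S ↔ v ∉ S ∧ ∀ u ∈ S, ¬ G.Adj v u := by simp [residual]

theorem mem_nbrsIn {H : Finset (Fin n)} {a v : Fin n} :
    v ∈ nbrsIn G H a ↔ a ∈ H ∧ v ∈ H ∧ G.Adj a v := by
  unfold nbrsIn
  split_ifs with h <;> simp [h]

theorem residual_anti {S S' : Finset (Fin n)} (h : S ⊆ S') : residual G S' ⊆ residual G S := by
  intro v hv
  rw [mem_residual] at hv ⊢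
  exact ⟨fun h' => hv.1 (h h'), fun u hu => hv.2 u (h hu)⟩

theorem nbrsIn_mono {H H' : Finset (Fin n)} (h : H ⊆ H') (a : Fin n) :
    nbrsIn G H a ⊆ nbrsIn G H' a := by
  intro v hv
  rw [mem_nbrsIn] at hv ⊢
  exact ⟨h hv.1, h hv.2.1, hv.2.2⟩

/-- A processed vertex is taken or has a taken neighbour. Hence residual neighbours always lie among
the vertices not yet drawn. -/
theorem notMem_residual_greedyStep (S : Finset (Fin n)) (x : Fin n) :
    x ∉ residual G (greedyStep G S x) := by
  rw [mem_residual]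
  unfold greedyStep
  split_ifs with h
  · rintro ⟨-, h'⟩
    obtain ⟨u, hu, hxu⟩ := h
    exact h' u hu hxu
  · rintro ⟨h', -⟩
    exact h' (Finset.mem_insert_self _ _)

/-- After `k` random choices the expected residual degree of a vertex is at most `|R| / k`. -/
theorem mul_expect_card_nbrsIn_le (a : Fin n) (k : ℕ) (R S : Finset (Fin n))
    (hR : nbrsIn G (residual G S) a ⊆ R) :
    (k : ℝ≥0∞) * expect (randomOrder R) (fun l =>
      ((nbrsIn G (residual G (greedyFrom G S (l.take k))) a).card : ℝ≥0∞)) ≤ R.card := by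
  induction k generalizing R S with
  | zero => simp
  | succ k ih =>
    rcases R.eq_empty_or_nonempty with rfl | h
    · rw [randomOrder_empty, expect_pure]
      rw [Finset.subset_empty] at hR
      simp [greedyFrom, hR]
    have hN : (R.card : ℝ≥0∞) ≠ 0 := by simp [h.ne_empty]
    rw [← ENNReal.mul_le_mul_iff_right hN (by simp), mul_left_comm, card_mul_expect_randomOrder h]
    set D := nbrsIn G (residual G S) a with hD
    simp only [List.take_succ_cons]
    set E : Fin n → ℝ≥0∞ := fun x => expect (randomOrder (R.erase x)) fun l =>
      ((nbrsIn G (residual G (greedyFrom G S (x :: l.take k))) a).card : ℝ≥0∞) with hE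
    -- If the drawn `x` is a residual neighbour of `a`, greedy takes it; then `a` is dominated and
    -- its residual degree is `0` from now on.
    have hE0 : ∀ x ∈ D, E x = 0 := by
      intro x hx
      rw [hE, expect_eq_zero]
      intro l _
      rw [hD, mem_nbrsIn, mem_residual, mem_residual] at hx
      rw [Nat.cast_eq_zero, Finset.card_eq_zero, nbrsIn, if_neg]
      intro ha
      have hstep : greedyStep G S x = insert x S := by
        unfold greedyStep
        rw [if_neg]
        rintro ⟨u, hu, hxu⟩
        exact hx.2.1.2 u hu hxu
      have := residual_anti (subset_greedyFrom (greedyStep G S x) (l.take k)) ha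
      rw [hstep, mem_residual] at this
      exact this.2 x (Finset.mem_insert_self _ _) hx.2.2
    -- The residual graph only shrinks. This covers the extra `1` in `k + 1`; the induction
    -- hypothesis covers `k`.
    have hEd : ∀ x, E x ≤ D.card := by
      intro x
      refine (expect_mono (F' := fun _ => (D.card : ℝ≥0∞)) fun l _ => ?_).trans (expect_const _ _).le
      exact_mod_cast Finset.card_le_card (nbrsIn_mono (residual_anti (subset_greedyFrom _ _)) a)
    have hEk : ∀ x ∈ R, (k : ℝ≥0∞) * E x ≤ (R.card - 1 : ℕ) := by
      intro x hx
      rw [← Finset.card_erase_of_mem hx]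
      refine ih (R.erase x) (greedyStep G S x) fun v hv => ?_
      refine Finset.mem_erase.2 ⟨?_, hR (nbrsIn_mono (residual_anti (subset_greedyStep S x)) a hv)⟩
      rintro rfl
      exact notMem_residual_greedyStep S v (mem_nbrsIn.1 hv).2.1
    -- With `N = |R|` and `d = |D|`, only `N - d` draws contribute, each at most `N - 1 + d`, and
    -- `(N - d) * (N - 1 + d) ≤ N ^ 2`.
    calc ((k + 1 : ℕ) : ℝ≥0∞) * ∑ x ∈ R, E x
        = ∑ x ∈ R \ D, ((k + 1 : ℕ) : ℝ≥0∞) * E x := by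
          rw [Finset.mul_sum, ← Finset.sum_sdiff hR,
            Finset.sum_eq_zero (s := D) fun x hx => by rw [hE0 x hx, mul_zero], add_zero]
      _ ≤ ∑ x ∈ R \ D, ((R.card - 1 + D.card : ℕ) : ℝ≥0∞) := by
          refine Finset.sum_le_sum fun x hx => ?_
          push_cast
          rw [add_mul, one_mul]
          refine add_le_add ?_ (hEd x)
          exact_mod_cast hEk x (Finset.mem_sdiff.1 hx).1
      _ ≤ (R.card : ℝ≥0∞) * R.card := by
          rw [Finset.sum_const, nsmul_eq_mul, Finset.card_sdiff_of_subset hR]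
          have h1 := Finset.card_le_card hR
          have h2 := h.card_pos
          rw [← Nat.cast_mul, ← Nat.cast_mul, Nat.cast_le]
          obtain ⟨e, he⟩ := Nat.exists_eq_add_of_le h1
          rw [he, Nat.add_sub_cancel_left]
          rw [he] at h2
          generalize D.card = d at *
          have : d + e - 1 + d ≤ e + 2 * d := by omega
          calc e * (d + e - 1 + d) ≤ e * (e + 2 * d) := Nat.mul_le_mul_left _ this
            _ ≤ (d + e) * (d + e) := by nlinarith [Nat.zero_le (d * d)]

end Greedy

/-! ## Uniformly random elements of finite sets -/

/-- An injection of `R` into `{0, …, |R| - 1}` is a bijection, and bijections preserve uniformity.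
-/
theorem uniformOfFinset_map_eq_uniformBelow {V : Type} {R : Finset V} (h : R.Nonempty) {q : V → ℕ}
    (hq : Set.InjOn q R) (hlt : ∀ x ∈ R, q x < R.card) :
    (PMF.uniformOfFinset R h).map q = uniformBelow R.card := by
  classical
  have himg : R.image q = Finset.range R.card := by
    refine Finset.eq_of_subset_of_card_le ?_ ?_
    · intro i hi
      obtain ⟨v, hv, rfl⟩ := Finset.mem_image.1 hi
      exact Finset.mem_range.2 (hlt v hv)
    · rw [Finset.card_image_of_injOn hq, Finset.card_range]
  have hu : uniformBelow R.card = PMF.uniformOfFinset (Finset.range R.card)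
      (Finset.nonempty_range_iff.2 h.card_ne_zero) := dif_pos h.card_pos
  ext r
  rw [hu, PMF.map_apply, PMF.uniformOfFinset_apply]
  by_cases hr : r < R.card
  · have : r ∈ R.image q := by rw [himg]; exact Finset.mem_range.2 hr
    obtain ⟨x, hx, rfl⟩ := Finset.mem_image.1 this
    rw [tsum_eq_single x, if_pos rfl, PMF.uniformOfFinset_apply_of_mem h hx,
      if_pos (Finset.mem_range.2 hr), Finset.card_range]
    intro y hy
    split_ifs with hxy
    · refine PMF.uniformOfFinset_apply_of_notMem h fun hyR => hy (hq hyR hx hxy.symm)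
    · rfl
  · rw [if_neg (by simpa using hr)]
    refine ENNReal.tsum_eq_zero.2 fun y => ?_
    split_ifs with hy
    · refine PMF.uniformOfFinset_apply_of_notMem h fun hyR => hr (hy ▸ hlt y hyR)
    · rfl

/-- The machine draws an index; reading it as the element with that index couples the draw with a
uniform element of `R`. -/
theorem Spec.rand_finset {w : ℕ} {s : Store} {V : Type} {R : Finset V} (h : R.Nonempty) {q : V → ℕ}
    (hq : Set.InjOn q R) (hlt : ∀ x ∈ R, q x < R.card) {y : ℕ} {e : Expr}
    (he : e.eval w s = R.card) {Q : V → ℕ → Store → Prop}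
    (hQ : ∀ x ∈ R, Q x 1 (s.setVar y (q x))) :
    Spec w (.rand y e) s (PMF.uniformOfFinset R h) Q := by
  refine ⟨(PMF.uniformOfFinset R h).map fun x => (x, 1, s.setVar y (q x)), ?_, ?_, ?_⟩
  · have := runs_rand (w := w) (s := s) y e
    rw [he, ← uniformOfFinset_map_eq_uniformBelow h hq hlt, PMF.map_comp] at this
    rwa [PMF.map_comp]
  · rw [PMF.map_comp]
    exact PMF.map_id _
  · intro z hz
    obtain ⟨x, hx, rfl⟩ := (PMF.mem_support_map_iff _ _ _).1 hz
    exact hQ x ((PMF.mem_support_uniformOfFinset_iff h x).1 hx)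

/-! ## The program -/

/-- The row of the residual neighbours of a vertex. -/
def hrow (e : Expr) : Expr := .add (.add (.var 0) (.lit 1)) e

/-- Forget what is stored about a vertex, except for its neighbours. -/
def resetVertex (e : Expr) : Stmt :=
  .seq (.store 0 e (.lit 0)) (.seq (.store 1 e (.lit 0)) (.store 2 (hrow e) (.lit 0)))

/-- Reset the end points of the update and all vertices with neighbours, and copy the latter to the
array `5`. -/
def resetAll : Stmt :=
  .seq (resetVertex (.var 2)) (.seq (resetVertex (.var 3))
    (forRow 7 9 (.var 0) (.seq (resetVertex (.var 9)) (.store 5 (.var 7) (.var 9)))))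

/-- Take the vertex `x` into the independent set. -/
def takeVertex : Stmt :=
  .seq (.ite (.lt (.var 7) (.var 11)) (.store 1 (.var 9) (.lit 1)) .skip)
    (forRow 8 10 (.var 9) (.seq (.store 0 (.var 10) (.add (.get 0 (.var 10)) (.lit 1)))
      (.ite (.lt (.var 7) (.var 11)) (.store 1 (.var 10) (.lit 2)) .skip)))

/-- Draw the next vertex of the random order, and take it unless it has a neighbour that has been
taken. -/
def greedyBody : Stmt :=
  .seq (.rand 10 (.sub (.get 2 (.var 0)) (.var 7)))
    (.seq (.assign 10 (.add (.var 10) (.var 7)))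
      (.seq (.assign 9 (.get 5 (.var 10)))
        (.seq (.store 5 (.var 10) (.get 5 (.var 7)))
          (.ite (.get 0 (.var 9)) .skip takeVertex))))

/-- Fill the rows of the residual graph. -/
def buildRows : Stmt :=
  forRow 7 9 (.var 0) (.ite (.get 1 (.var 9)) .skip
    (forRow 8 10 (.var 9) (.ite (.get 1 (.var 10)) .skip (rowInsert (hrow (.var 9)) (.var 10)))))

/-- Random-order greedy on the vertices with neighbours. -/
def rebuild : Stmt :=
  .seq resetAll (.seq (.assign 11 (.div (.get 2 (.var 0)) (.mul (.lit 8) (.var 5))))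
    (.seq (forLoop 7 (.get 2 (.var 0)) greedyBody) buildRows))

/-! ## The invariant -/

open Classical in
/-- The vertices with neighbours. -/
noncomputable def nonisolated {n : ℕ} (G : SimpleGraph (Fin n)) : Finset (Fin n) :=
  Finset.univ.filter fun v => ∃ u, G.Adj v u

theorem mem_nonisolated {n : ℕ} {G : SimpleGraph (Fin n)} {v : Fin n} :
    v ∈ nonisolated G ↔ ∃ u, G.Adj v u := by simp [nonisolated]

/-- The rows `0, …, n` describe the graph `G`. -/
def GraphRows {n : ℕ} (G : SimpleGraph (Fin n)) (R : ℕ → List (Fin n)) : Prop :=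
  (∀ v x : Fin n, x ∈ R v ↔ G.Adj v x) ∧ ∀ x, x ∈ R n ↔ x ∈ nonisolated G

theorem GraphRows.congr {n : ℕ} {G : SimpleGraph (Fin n)} {R R' : ℕ → List (Fin n)}
    (h : GraphRows G R) (hR : ∀ ρ ≤ n, R' ρ = R ρ) : GraphRows G R' :=
  ⟨fun v x => by rw [hR v v.2.le, h.1], fun x => by rw [hR n le_rfl, h.2]⟩

open Classical in
/-- The store represents the graph `G`, a set `T` of vertices that have been taken, the residual set
`H`, and a maximal independent set of the graph induced by `H`. -/
structure Inv {n : ℕ} (s : Store) (G : SimpleGraph (Fin n)) (T H : Finset (Fin n)) : Prop where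
  rows : ∃ R, Rows n s R ∧ GraphRows G R ∧ ∀ v x : Fin n, x ∈ R (n + 1 + v) ↔ x ∈ nbrsIn G H v
  status : ∀ v : Fin n, s.arr 1 v = if v ∈ T then 1 else if v ∈ H then 0 else 2
  disj : ∀ v ∈ T, v ∉ H
  sub : T ⊆ nonisolated G
  indep : ∀ u ∈ T, ∀ v, v ∈ T ∨ v ∈ H → ¬ G.Adj u v
  dom : ∀ v, v ∉ T → v ∉ H → ∃ u ∈ T, G.Adj v u
  out_top : ∀ v ∈ T, s.arr 0 v = 0
  out_dom : ∀ v : Fin n, v ∉ T → v ∉ H → s.arr 0 v ≠ 0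
  out_res : ∀ v ∈ H, s.arr 0 v = ((nbrsIn G H v).filter fun w : Fin n => s.arr 0 w = 0).card

/-! ### Resetting the memory before a greedy run. -/

section Rebuild
variable {n w : ℕ} {s : Store} {R : ℕ → List (Fin n)} {G : SimpleGraph (Fin n)}

theorem Ev.hrow (hw : WordOK n w) (hn : s.var 0 = n) {e : Expr} {x : Fin n} (he : Ev w s e x) :
    Ev w s (hrow e) (n + 1 + x) := by
  have := x.2
  exact ((Ev.var hn).add (Ev.lit hw.one_lt) (hw.lt (by omega))).add he (hw.lt (by omega))

theorem det_resetVertex (hw : WordOK n w) (hn : s.var 0 = n) {e : Expr} {x : Fin n}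
    (he : Ev w s e x) {Q : ℕ → Store → Prop}
    (h : Q 5 (((s.setArr 0 x 0).setArr 1 x 0).setArr 2 (n + 1 + x) 0)) :
    Det w (resetVertex e) s Q := by
  have h0 : 0 < 2 ^ w := hw.lt (by omega)
  refine Det.seq (Det.store ?_)
  rw [he.eq, eval_lit h0]
  refine Det.seq (Det.store ?_)
  rw [(he.congr (s' := s.setArr 0 x 0) rfl).eq, eval_lit h0]
  refine Det.store ?_
  rw [((he.hrow hw hn).congr (s' := (s.setArr 0 x 0).setArr 1 x 0) rfl).eq, eval_lit h0]
  exact h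

/-- The vertices in `Z` have been reset. -/
def Cleared (s : Store) (R : ℕ → List (Fin n)) (Z : Fin n → Prop) : Prop :=
  ∃ R', Rows n s R' ∧ (∀ ρ ≤ n, R' ρ = R ρ) ∧
    ∀ v : Fin n, Z v → s.arr 0 v = 0 ∧ s.arr 1 v = 0 ∧ R' (n + 1 + v) = []

theorem Cleared.reset {Z Z' : Fin n → Prop} (h : Cleared s R Z) (x : Fin n)
    (hZ : ∀ v, Z' v → v ≠ x → Z v) :
    Cleared (((s.setArr 0 x 0).setArr 1 x 0).setArr 2 (n + 1 + x) 0) R Z' := by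
  obtain ⟨R', h1, h2, h3⟩ := h
  refine ⟨_, (h1.congr (s' := (s.setArr 0 x 0).setArr 1 x 0) ?_ ?_ ?_).clear _, ?_, ?_⟩
  · simp [Store.setArr_arr]
  · simp [Store.setArr_arr]
  · simp [Store.setArr_arr]
  · intro ρ hρ
    rw [Function.update_of_ne (by omega), h2 ρ hρ]
  · intro v hv
    by_cases hvx : v = x
    · subst hvx
      simp
    · have := h3 v (hZ v hv hvx)
      have hvx' : (v : ℕ) ≠ x := fun h => hvx (Fin.ext h)
      simp [hvx', this.1, this.2.1, this.2.2]

theorem Cleared.congr {Z : Fin n → Prop} {s' : Store} {vs as : List ℕ} (h : Cleared s R Z)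
    (hf : Frame vs as s s') (has : ∀ a ≤ 4, a ∉ as) : Cleared s' R Z := by
  obtain ⟨R', h1, h2, h3⟩ := h
  refine ⟨R', h1.frame hf ⟨has 2 (by simp), has 3 (by simp), has 4 (by simp)⟩, h2, fun v hv => ?_⟩
  rw [hf.2 0 (has 0 (by simp)), hf.2 1 (has 1 (by simp))]
  exact h3 v hv

/-- Besides the non-isolated vertices only the end points `a`, `b` can be dirty, since a deletion
may just have isolated them. So the time is proportional to the number of non-isolated vertices
rather than to `n`. -/
theorem det_resetAll (hw : WordOK n w) (hn : s.var 0 = n) {a b : Fin n} (ha : s.var 2 = a)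
    (hb : s.var 3 = b) (hG : GraphRows G R)
    (hc : Cleared s R fun v => v ∉ nonisolated G ∧ v ≠ a ∧ v ≠ b) :
    Det w resetAll s fun t s' => t ≤ 20 + 15 * (R n).length ∧ Frame [7, 9] [0, 1, 2, 5] s s' ∧
      Cleared s' R (fun _ => True) ∧ ∀ i (h : i < (R n).length), s'.arr 5 i = (R n)[i] := by
  refine Det.seq (det_resetVertex hw hn (Ev.var ha) ?_)
  have hc1 := hc.reset (Z' := fun v => v ∉ nonisolated G ∧ v ≠ b) a fun v h h' => ⟨h.1, h', h.2⟩
  have hf1 : Frame [7, 9] [0, 1, 2, 5] s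
      (((s.setArr 0 a 0).setArr 1 a 0).setArr 2 (n + 1 + a) 0) :=
    ((((Frame.refl _ _ s).setArr (by simp) _ _)).setArr (by simp) _ _).setArr (by simp) _ _
  generalize ((s.setArr 0 a 0).setArr 1 a 0).setArr 2 (n + 1 + a) 0 = s1 at hc1 hf1
  have hn1 : s1.var 0 = n := (hf1.1 0 (by simp)).trans hn
  have hb1 : s1.var 3 = b := (hf1.1 3 (by simp)).trans hb
  refine Det.seq (det_resetVertex hw hn1 (Ev.var hb1) ?_)
  have hc2 := hc1.reset (Z' := fun v => v ∉ nonisolated G) b fun v h h' => ⟨h, h'⟩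
  have hf2 : Frame [7, 9] [0, 1, 2, 5] s
      (((s1.setArr 0 b 0).setArr 1 b 0).setArr 2 (n + 1 + b) 0) :=
    (((hf1.setArr (by simp) _ _)).setArr (by simp) _ _).setArr (by simp) _ _
  generalize ((s1.setArr 0 b 0).setArr 1 b 0).setArr 2 (n + 1 + b) 0 = s2 at hc2 hf2
  have hnd : (R n).Nodup := by
    obtain ⟨R', h1, h2, -⟩ := hc2
    rw [← h2 n le_rfl]
    exact (h1 n (by omega)).1
  have hlen := List.Nodup.length_le_fin hnd
  refine det_forRow hw (ρ := n) (l := R n) (fun pre t s' => t ≤ 2 + 15 * pre.length ∧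
    Frame [7, 9] [0, 1, 2, 5] s s' ∧ Cleared s' R (fun v => v ∉ nonisolated G ∨ v ∈ pre) ∧
    s'.var 7 = pre.length ∧ ∀ i (h : i < pre.length), s'.arr 5 i = pre[i]) (by omega) hlen
    ?_ ?_ ?_ ?_
  · rintro pre t s' ⟨-, hf, ⟨R', h1, h2, -⟩, h7, -⟩
    have h0 : s'.var 0 = n := (hf.1 0 (by simp)).trans hn
    exact ⟨h0, h0, h2 n le_rfl ▸ h1 n (by omega), h7⟩
  · refine ⟨by simp, hf2.setVar (by simp) _, ?_, by simp, by simp⟩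
    simpa using hc2.congr ((Frame.refl [7] [] s2).setVar (x := 7) (by simp) 0) (by simp)
  · rintro pre v post hl t s' ⟨ht, hf, hcl, h7, h5⟩
    have hpre : pre.length < n := by
      have := congrArg List.length hl
      simp at this
      omega
    have hn' : (s'.setVar 9 v).var 0 = n := by simp [hf.1 0 (by simp), hn]
    have hcl' : Cleared (s'.setVar 9 v) R (fun v => v ∉ nonisolated G ∨ v ∈ pre) :=
      hcl.congr ((Frame.refl [9] [] s').setVar (by simp) _) (by simp)
    refine Det.seq (det_resetVertex hw hn' (x := v) (Ev.var (by simp)) ?_)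
    refine Det.store ?_
    have hc3 := hcl'.reset (Z' := fun u => u ∉ nonisolated G ∨ u ∈ pre ++ [v]) v
      fun u h h' => by simpa [h'] using h
    have hf3 : Frame [7, 9] [0, 1, 2, 5] s
        ((((s'.setVar 9 v).setArr 0 v 0).setArr 1 v 0).setArr 2 (n + 1 + v) 0) :=
      ((((hf.setVar (by simp) _).setArr (by simp) _ _)).setArr (by simp) _ _).setArr (by simp) _ _
    have h73 : ((((s'.setVar 9 v).setArr 0 v 0).setArr 1 v 0).setArr 2 (n + 1 + v) 0).var 7 =
      pre.length := by simp [h7]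
    have h93 : ((((s'.setVar 9 v).setArr 0 v 0).setArr 1 v 0).setArr 2 (n + 1 + v) 0).var 9 =
      v := by simp
    have h53 : ((((s'.setVar 9 v).setArr 0 v 0).setArr 1 v 0).setArr 2 (n + 1 + v) 0).arr 5 =
      s'.arr 5 := by simp [Store.setArr_arr]
    generalize (((s'.setVar 9 v).setArr 0 v 0).setArr 1 v 0).setArr 2 (n + 1 + v) 0 = s3 at *
    simp only [Expr.eval, h73, h93]
    refine ⟨by simp [h73], ?_, ?_, ?_, by simp, ?_⟩
    · simp only [List.length_append, List.length_singleton]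
      omega
    · exact (hf3.setArr (by simp) _ _).setVar (by simp) _
    · exact hc3.congr (((Frame.refl [7] [5] s3).setArr (by simp) _ _).setVar (by simp) _) (by simp; omega)
    · intro i hi
      simp only [Store.setVar_arr, Store.setArr_arr_apply, true_and]
      by_cases h : i = pre.length
      · subst h
        simp
      · rw [if_neg h, h53]
        have : i < pre.length := by simp at hi; omega
        rw [h5 i this, List.getElem_append_left this]
  · rintro t s' ⟨ht, hf, hcl, h7, h5⟩
    refine ⟨by omega, hf, ?_, h5⟩
    obtain ⟨R', h1, h2, h3⟩ := hcl
    refine ⟨R', h1, h2, fun v _ => h3 v ?_⟩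
    show v ∉ nonisolated G ∨ v ∈ R n
    rw [hG.2]
    exact (em _).symm

end Rebuild

/-! ### The greedy loop on a freshly drawn order. -/

section GreedyLoop
variable {n w : ℕ} {s : Store} {R : ℕ → List (Fin n)} {G : SimpleGraph (Fin n)}

open Classical in
/-- The state of the greedy algorithm after the vertices in `pre` have been processed. -/
structure GreedyState (s : Store) (G : SimpleGraph (Fin n)) (k : ℕ) (pre : List (Fin n)) :
    Prop where
  nodup : pre.Nodup
  sub : ∀ v ∈ pre, v ∈ nonisolated G
  rest : ∀ v ∈ nonisolated G \ pre.toFinset,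
    ∃ p, pre.length ≤ p ∧ p < (nonisolated G).card ∧ s.arr 5 p = v
  out : ∀ v : Fin n, s.arr 0 v = ((greedyFrom G ∅ pre).filter (G.Adj v)).card
  status : ∀ v : Fin n, s.arr 1 v = if v ∈ greedyFrom G ∅ (pre.take k) then 1 else
    if ∃ u ∈ greedyFrom G ∅ (pre.take k), G.Adj v u then 2 else 0

theorem GreedyState.congr {k : ℕ} {pre : List (Fin n)} {s' : Store} (h : GreedyState s G k pre)
    (h0 : s'.arr 0 = s.arr 0) (h1 : s'.arr 1 = s.arr 1) (h5 : s'.arr 5 = s.arr 5) :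
    GreedyState s' G k pre :=
  ⟨h.nodup, h.sub, by rw [h5]; exact h.rest, by rw [h0]; exact h.out, by rw [h1]; exact h.status⟩

theorem GreedyState.card_sdiff {k : ℕ} {pre : List (Fin n)} (h : GreedyState s G k pre) :
    (nonisolated G \ pre.toFinset).card = (nonisolated G).card - pre.length := by
  rw [Finset.card_sdiff_of_subset, List.toFinset_card_of_nodup h.nodup]
  intro v hv
  exact h.sub v (List.mem_toFinset.1 hv)

theorem GreedyState.out_eq_zero {k : ℕ} {pre : List (Fin n)} (h : GreedyState s G k pre)
    (v : Fin n) : s.arr 0 v = 0 ↔ ¬ ∃ u ∈ greedyFrom G ∅ pre, G.Adj v u := by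
  classical
  rw [h.out, Finset.card_eq_zero, Finset.filter_eq_empty_iff]
  push Not
  rfl

theorem GreedyState.out_lt {k : ℕ} {pre : List (Fin n)} (h : GreedyState s G k pre)
    (v : Fin n) : s.arr 0 v ≤ n := by
  classical
  rw [h.out]
  exact (Finset.card_le_univ _).trans (by simp)

-- The counters are raised for every vertex taken, but statuses are written only while the loop
-- counter (variable `7`) is below the threshold (variable `11`), that is, for the vertices that
-- form `T`.
open Classical in
theorem det_takeVertex (hw : WordOK n w) (hn : s.var 0 = n) (hR : Rows n s R)
    (hG : GraphRows G R) {x : Fin n} (hx : s.var 9 = x) (hout : ∀ v : Fin n, s.arr 0 v ≤ n) :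
    Det w takeVertex s fun t s' => t ≤ 10 + 15 * (R x).length ∧ Frame [8, 10] [0, 1] s s' ∧
      (∀ v : Fin n, s'.arr 0 v = s.arr 0 v + if G.Adj x v then 1 else 0) ∧
      ∀ v : Fin n, s'.arr 1 v = if s.var 7 < s.var 11 ∧ G.Adj x v then 2 else
        if s.var 7 < s.var 11 ∧ v = x then 1 else s.arr 1 v := by
  have h1 := hw.one_lt
  have key : ∀ s1 : Store, Frame [8, 10] [0, 1] s s1 → s1.arr 0 = s.arr 0 →
      (∀ v : Fin n, s1.arr 1 v = if s.var 7 < s.var 11 ∧ v = x then 1 else s.arr 1 v) →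
      Det w (forRow 8 10 (.var 9) (.seq (.store 0 (.var 10) (.add (.get 0 (.var 10)) (.lit 1)))
        (.ite (.lt (.var 7) (.var 11)) (.store 1 (.var 10) (.lit 2)) .skip))) s1
        fun t s' => t ≤ 3 + 15 * (R x).length ∧ Frame [8, 10] [0, 1] s s' ∧
          (∀ v : Fin n, s'.arr 0 v = s.arr 0 v + if G.Adj x v then 1 else 0) ∧
          ∀ v : Fin n, s'.arr 1 v = if s.var 7 < s.var 11 ∧ G.Adj x v then 2 else
            if s.var 7 < s.var 11 ∧ v = x then 1 else s.arr 1 v := by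
    intro s1 hf1 h01 h11
    have hnd := (hR x (by omega)).1
    refine det_forRow hw (ρ := x) (l := R x) (fun pre t s' => t ≤ 2 + 15 * pre.length ∧
      Frame [8, 10] [0, 1] s s' ∧ s'.var 8 = pre.length ∧
      (∀ v : Fin n, s'.arr 0 v = s.arr 0 v + if v ∈ pre then 1 else 0) ∧
      ∀ v : Fin n, s'.arr 1 v = if s.var 7 < s.var 11 ∧ v ∈ pre then 2 else
            if s.var 7 < s.var 11 ∧ v = x then 1 else s.arr 1 v) (by omega)
      (List.Nodup.length_le_fin hnd) ?_ ?_ ?_ ?_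
    · rintro pre t s' ⟨-, hf, h8, -⟩
      refine ⟨(hf.1 0 (by simp)).trans hn, (hf.1 9 (by simp)).trans hx, ?_, h8⟩
      exact (hR.frame hf (by simp)) x (by omega)
    · refine ⟨by simp, hf1.setVar (by simp) _, by simp, by simp [h01], by simpa using h11⟩
    · rintro pre v post hl t s' ⟨ht, hf, h8, ho, hst⟩
      have hv : v ∉ pre := by
        rw [hl, List.nodup_append] at hnd
        intro h
        exact hnd.2.2 v h v (by simp) rfl
      refine Det.seq (Det.store ?_)
      have e1 : (Expr.var 10).eval w (s'.setVar 10 v) = v := by simp [Expr.eval]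
      have e2 : (Expr.add (.get 0 (.var 10)) (.lit 1)).eval w (s'.setVar 10 v) = s.arr 0 v + 1 := by
        refine eval_add ?_ (eval_lit h1) (hw.lt (by have := hout v; omega))
        rw [Expr.eval, e1, Store.setVar_arr, ho, if_neg hv, add_zero]
      rw [e1, e2]
      have hf2 : Frame [8, 10] [0, 1] s ((s'.setVar 10 v).setArr 0 v (s.arr 0 v + 1)) :=
        (hf.setVar (by simp) _).setArr (by simp) _ _
      have ho2 : ∀ u : Fin n, ((s'.setVar 10 v).setArr 0 v (s.arr 0 v + 1)).arr 0 u =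
          s.arr 0 u + if u ∈ pre ++ [v] then 1 else 0 := by
        intro u
        by_cases huv : u = v
        · subst huv
          simp
        · have : (u : ℕ) ≠ v := fun h => huv (Fin.ext h)
          simp [huv, this, ho]
      have h82 : ((s'.setVar 10 v).setArr 0 v (s.arr 0 v + 1)).var 8 = pre.length := by simp [h8]
      have h102 : ((s'.setVar 10 v).setArr 0 v (s.arr 0 v + 1)).var 10 = v := by simp
      have h12 : ((s'.setVar 10 v).setArr 0 v (s.arr 0 v + 1)).arr 1 = s'.arr 1 := by
        simp [Store.setArr_arr]
      generalize (s'.setVar 10 v).setArr 0 v (s.arr 0 v + 1) = s2 at *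
      have hlt : (Expr.lt (.var 7) (.var 11)).eval w s2 ≠ 0 ↔ s.var 7 < s.var 11 :=
        eval_lt_ne_zero h1 (hf2.1 7 (by simp)) (hf2.1 11 (by simp))
      refine Det.ite ?_ ?_
      · intro h
        rw [hlt] at h
        refine Det.store ?_
        rw [show (Expr.var 10).eval w s2 = v from h102, eval_lit (hw.lt (by omega))]
        refine ⟨h82, ?_, (hf2.setArr (by simp) _ _).setVar (by simp) _, by simp, ?_, ?_⟩
        · simp only [List.length_append, List.length_singleton]
          omega
        · simpa using ho2
        · intro u
          by_cases huv : u = v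
          · subst huv
            simp [h]
          · have : (u : ℕ) ≠ v := fun h => huv (Fin.ext h)
            simp [huv, this, h12, hst]
      · intro h
        have h' : ¬ s.var 7 < s.var 11 := fun h' => hlt.2 h' h
        refine Det.skip ⟨h82, ?_, hf2.setVar (by simp) _, by simp, ?_, ?_⟩
        · simp only [List.length_append, List.length_singleton]
          omega
        · simpa using ho2
        · intro u
          simp [h12, hst, h']
    · rintro t s' ⟨ht, hf, h8, ho, hst⟩
      refine ⟨by omega, hf, ?_, ?_⟩
      · simpa only [hG.1] using ho
      · simpa only [hG.1] using hst
  have hlt : (Expr.lt (.var 7) (.var 11)).eval w s ≠ 0 ↔ s.var 7 < s.var 11 :=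
    eval_lt_ne_zero h1 rfl rfl
  refine Det.seq (Det.ite ?_ ?_)
  · intro h
    rw [hlt] at h
    refine Det.store ?_
    rw [show (Expr.var 9).eval w s = x from hx, eval_lit h1]
    refine (key _ ((Frame.refl _ _ s).setArr (by simp) _ _) (by simp [Store.setArr_arr]) ?_).mono
      fun t s' h' => ⟨by omega, h'.2⟩
    intro v
    by_cases hvx : v = x
    · subst hvx
      simp [h]
    · have : (v : ℕ) ≠ x := fun h => hvx (Fin.ext h)
      simp [hvx, this]
  · intro h
    have h' : ¬ s.var 7 < s.var 11 := fun h' => hlt.2 h' h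
    refine Det.skip ((key _ (Frame.refl _ _ s) rfl ?_).mono fun t s' h' => ⟨by omega, h'.2⟩)
    intro v
    simp [h']

/-- The greedy algorithm processes one more vertex. -/
theorem GreedyState.take {k : ℕ} {pre : List (Fin n)} (h : GreedyState s G k pre) {x : Fin n}
    {s' : Store} (hx : x ∈ nonisolated G \ pre.toFinset) (hx0 : s.arr 0 x = 0)
    (hrest : ∀ v ∈ (nonisolated G \ pre.toFinset).erase x,
      ∃ p, pre.length + 1 ≤ p ∧ p < (nonisolated G).card ∧ s'.arr 5 p = v)
    (hout : ∀ v : Fin n, G.Adj x v → s'.arr 0 v = s.arr 0 v + 1)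
    (hout' : ∀ v : Fin n, ¬ G.Adj x v → s'.arr 0 v = s.arr 0 v)
    (hst : ∀ v : Fin n, pre.length < k → G.Adj x v → s'.arr 1 v = 2)
    (hst' : pre.length < k → s'.arr 1 x = 1)
    (hst'' : ∀ v : Fin n, (¬ pre.length < k ∨ (¬ G.Adj x v ∧ v ≠ x)) → s'.arr 1 v = s.arr 1 v) :
    GreedyState s' G k (pre ++ [x]) := by
  classical
  rw [Finset.mem_sdiff, List.mem_toFinset] at hx
  rw [h.out_eq_zero] at hx0
  have hstep : greedyFrom G ∅ (pre ++ [x]) = insert x (greedyFrom G ∅ pre) := by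
    rw [greedyFrom_concat, greedyStep, if_neg hx0]
  have hxS : x ∉ greedyFrom G ∅ pre := fun hxS => by
    have := greedyFrom_subset ∅ pre hxS
    rw [Finset.empty_union, List.mem_toFinset] at this
    exact hx.2 this
  refine ⟨?_, ?_, ?_, ?_, ?_⟩
  · rw [List.nodup_append]
    refine ⟨h.nodup, by simp, ?_⟩
    rintro a ha b hb rfl
    rw [List.mem_singleton] at hb
    exact hx.2 (hb ▸ ha)
  · intro v hv
    rw [List.mem_append, List.mem_singleton] at hv
    rcases hv with hv | rfl
    · exact h.sub v hv
    · exact hx.1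
  · intro v hv
    rw [List.length_append, List.length_singleton]
    refine hrest v ?_
    simp only [Finset.mem_sdiff, List.mem_toFinset, List.mem_append, List.mem_singleton, not_or,
      Finset.mem_erase] at hv ⊢
    exact ⟨hv.2.2, hv.1, hv.2.1⟩
  · intro v
    rw [hstep, Finset.filter_insert]
    by_cases hv : G.Adj v x
    · rw [if_pos hv, Finset.card_insert_of_notMem (by simp [hxS]), hout v hv.symm, h.out]
    · rw [if_neg hv, hout' v fun h => hv h.symm, h.out]
  · intro v
    -- Below the threshold the top set is the whole current greedy set; from then on `take k` no
    -- longer changes.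
    by_cases hk : pre.length < k
    · rw [List.take_of_length_le (by simpa using hk), hstep]
      have hs := h.status v
      rw [List.take_of_length_le hk.le] at hs
      by_cases hvx : v = x
      · subst hvx
        simp [hst' hk]
      by_cases hv : G.Adj x v
      · rw [hst v hk hv, if_neg, if_pos ⟨x, Finset.mem_insert_self _ _, hv.symm⟩]
        rw [Finset.mem_insert, not_or]
        exact ⟨hvx, fun hvS => hx0 ⟨v, hvS, hv⟩⟩
      · rw [hst'' v (Or.inr ⟨hv, hvx⟩), hs]
        have hv' : ¬ G.Adj v x := fun h => hv h.symm
        simp [hvx, hv']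
    · rw [List.take_append_of_le_length (by omega), hst'' v (Or.inl hk)]
      exact h.status v

/-- The greedy algorithm skips a vertex. -/
theorem GreedyState.pass {k : ℕ} {pre : List (Fin n)} (h : GreedyState s G k pre) {x : Fin n}
    {s' : Store} (hx : x ∈ nonisolated G \ pre.toFinset) (hx0 : s.arr 0 x ≠ 0)
    (hrest : ∀ v ∈ (nonisolated G \ pre.toFinset).erase x,
      ∃ p, pre.length + 1 ≤ p ∧ p < (nonisolated G).card ∧ s'.arr 5 p = v)
    (h0 : s'.arr 0 = s.arr 0) (h1 : s'.arr 1 = s.arr 1) :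
    GreedyState s' G k (pre ++ [x]) := by
  classical
  rw [Finset.mem_sdiff, List.mem_toFinset] at hx
  rw [ne_eq, h.out_eq_zero, not_not] at hx0
  have hstep : greedyFrom G ∅ (pre ++ [x]) = greedyFrom G ∅ pre := by
    rw [greedyFrom_concat, greedyStep, if_pos hx0]
  refine ⟨?_, ?_, ?_, ?_, ?_⟩
  · rw [List.nodup_append]
    refine ⟨h.nodup, by simp, ?_⟩
    rintro a ha b hb rfl
    rw [List.mem_singleton] at hb
    exact hx.2 (hb ▸ ha)
  · intro v hv
    rw [List.mem_append, List.mem_singleton] at hv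
    rcases hv with hv | rfl
    · exact h.sub v hv
    · exact hx.1
  · intro v hv
    rw [List.length_append, List.length_singleton]
    refine hrest v ?_
    simp only [Finset.mem_sdiff, List.mem_toFinset, List.mem_append, List.mem_singleton, not_or,
      Finset.mem_erase] at hv ⊢
    exact ⟨hv.2.2, hv.1, hv.2.1⟩
  · rw [hstep, h0]
    exact h.out
  · rw [h1]
    by_cases hk : pre.length < k
    · have hs := h.status
      rw [List.take_of_length_le hk.le] at hs
      rw [List.take_of_length_le (by simpa using hk), hstep]
      exact hs
    · rw [List.take_append_of_le_length (by omega)]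
      exact h.status

/-- One round of a Fisher–Yates shuffle. Each unprocessed vertex has a cell of array `5` between
`pre.length` and `N - 1`; there are as many cells as vertices, so a uniform cell is a uniform
unprocessed vertex. -/
theorem spec_greedyBody (hw : WordOK n w) (hn : s.var 0 = n) (hR : Rows n s R)
    (hG : GraphRows G R) {k : ℕ} (hk : s.var 11 = k) {pre : List (Fin n)}
    (hpre : s.var 7 = pre.length) (h : GreedyState s G k pre)
    (hne : (nonisolated G \ pre.toFinset).Nonempty) :
    Spec w greedyBody s (PMF.uniformOfFinset _ hne) fun x t s' =>
      t ≤ 20 + 15 * (R x).length ∧ Frame [8, 9, 10] [0, 1, 5] s s' ∧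
        GreedyState s' G k (pre ++ [x]) := by
  classical
  have h1 := hw.one_lt
  set N := (nonisolated G).card with hN
  have hlen : s.arr 2 n = N := by
    rw [(hR n (by omega)).2.1, hN, ← List.toFinset_card_of_nodup (hR n (by omega)).1]
    congr 1
    ext v
    rw [List.mem_toFinset, hG.2]
  have hNn : N ≤ n := (Finset.card_le_univ _).trans (by simp)
  have hp : ∀ v, ∃ p, v ∈ nonisolated G \ pre.toFinset → pre.length ≤ p ∧ p < N ∧ s.arr 5 p = v := by
    intro v
    by_cases hv : v ∈ nonisolated G \ pre.toFinset
    · obtain ⟨p, hp⟩ := h.rest v hv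
      exact ⟨p, fun _ => hp⟩
    · exact ⟨0, fun h => absurd h hv⟩
  choose p hp using hp
  have hcard := h.card_sdiff
  have hpinj : Set.InjOn p (nonisolated G \ pre.toFinset : Finset (Fin n)) := by
    intro v hv v' hv' hvv
    have e1 := (hp v hv).2.2
    rw [hvv, (hp v' hv').2.2] at e1
    exact (Fin.ext e1).symm
  refine Spec.seq_det (Spec.rand_finset hne (q := fun v => p v - pre.length) ?_ ?_ ?_ ?_)
  · intro v hv v' hv' hvv
    have e1 := (hp v hv).1
    have e2 := (hp v' hv').1
    simp only at hvv
    exact hpinj hv hv' (by omega)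
  · intro v hv
    have e1 := (hp v hv).1
    have e2 := (hp v hv).2.1
    omega
  · rw [hcard, Expr.eval, show (Expr.var 7).eval w s = pre.length from hpre, Expr.eval,
      show (Expr.var 0).eval w s = n from hn, hlen]
  intro x hx
  obtain ⟨hx1, hx2, hx3⟩ := hp x hx
  refine Det.seq (Det.assign ?_)
  rw [eval_add (a := p x - pre.length) (b := pre.length) (by simp [Expr.eval])
    (by simp [Expr.eval, hpre]) (hw.lt (by omega)), Nat.sub_add_cancel hx1]
  refine Det.seq (Det.assign ?_)
  rw [show (Expr.get 5 (.var 10)).eval w ((s.setVar 10 (p x - pre.length)).setVar 10 (p x)) = x by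
    simp [Expr.eval, hx3]]
  refine Det.seq (Det.store ?_)
  simp only [Expr.eval, Store.setVar_var, Store.setVar_arr]
  norm_num only [if_true, if_false]
  rw [hpre]
  have hf : Frame [8, 9, 10] [0, 1, 5] s
      ((((s.setVar 10 (p x - pre.length)).setVar 10 (p x)).setVar 9 x).setArr 5 (p x)
        (s.arr 5 pre.length)) :=
    ((((Frame.refl _ _ s).setVar (by simp) _).setVar (by simp) _).setVar (by simp) _).setArr
      (by simp) _ _
  have h9 : ((((s.setVar 10 (p x - pre.length)).setVar 10 (p x)).setVar 9 x).setArr 5 (p x)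
        (s.arr 5 pre.length)).var 9 = x := by simp
  have h0 : ((((s.setVar 10 (p x - pre.length)).setVar 10 (p x)).setVar 9 x).setArr 5 (p x)
        (s.arr 5 pre.length)).arr 0 = s.arr 0 := by simp [Store.setArr_arr]
  have h1' : ((((s.setVar 10 (p x - pre.length)).setVar 10 (p x)).setVar 9 x).setArr 5 (p x)
        (s.arr 5 pre.length)).arr 1 = s.arr 1 := by simp [Store.setArr_arr]
  have h5 : ∀ i, ((((s.setVar 10 (p x - pre.length)).setVar 10 (p x)).setVar 9 x).setArr 5 (p x)
        (s.arr 5 pre.length)).arr 5 i = if i = p x then s.arr 5 pre.length else s.arr 5 i := by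
    simp
  generalize ((((s.setVar 10 (p x - pre.length)).setVar 10 (p x)).setVar 9 x).setArr 5 (p x)
        (s.arr 5 pre.length)) = s1 at *
  have hR1 : Rows n s1 R := hR.frame hf (by simp)
  have hrest : ∀ v ∈ (nonisolated G \ pre.toFinset).erase x,
      ∃ q, pre.length + 1 ≤ q ∧ q < N ∧ s1.arr 5 q = v := by
    intro v hv
    obtain ⟨hvx, hv⟩ := Finset.mem_erase.1 hv
    obtain ⟨e1, e2, e3⟩ := hp v hv
    have hpp : p v ≠ p x := fun h => hvx (hpinj hv hx h)
    -- The vertex in the first of these cells has been copied to the cell of `x`; all others stay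
    -- where they were.
    by_cases hpv : p v = pre.length
    · refine ⟨p x, by omega, hx2, ?_⟩
      rw [h5, if_pos rfl, ← hpv, e3]
    · refine ⟨p v, by omega, e2, ?_⟩
      rw [h5, if_neg hpp, e3]
  have hget : (Expr.get 0 (.var 9)).eval w s1 = s.arr 0 x := by
    rw [Expr.eval, show (Expr.var 9).eval w s1 = x from h9, h0]
  refine Det.ite ?_ ?_
  · intro hx0
    rw [hget] at hx0
    exact Det.skip ⟨by omega, hf, h.pass hx hx0 hrest h0 h1'⟩
  · intro hx0
    rw [hget] at hx0
    refine (det_takeVertex hw ((hf.1 0 (by simp)).trans hn) hR1 hG h9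
      (by rw [h0]; exact h.out_lt)).mono ?_
    rintro t s' ⟨ht, hf', ho, hs⟩
    rw [hf.1 7 (by simp), hf.1 11 (by simp), hpre, hk, h1'] at hs
    rw [h0] at ho
    refine ⟨by omega, hf.trans (hf'.mono (by simp) (by simp)), h.take hx hx0 ?_ ?_ ?_ ?_ ?_ ?_⟩
    · rw [hf'.2 5 (by simp)]
      exact hrest
    · intro v hv
      rw [ho, if_pos hv]
    · intro v hv
      rw [ho, if_neg hv, add_zero]
    · intro v hv hv'
      rw [hs, if_pos ⟨hv, hv'⟩]
    · intro hv
      rw [hs, if_neg (by simp), if_pos ⟨hv, rfl⟩]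
    · intro v hv
      rw [hs, if_neg (by tauto), if_neg (by tauto)]

/-- The whole greedy loop; the order in which the vertices are processed is uniformly random. -/
theorem spec_greedyLoop (hw : WordOK n w) (hn : s.var 0 = n) (hR : Rows n s R)
    (hG : GraphRows G R) {k : ℕ} (hk : s.var 11 = k) (h : GreedyState (s.setVar 7 0) G k []) :
    Spec w (forLoop 7 (.get 2 (.var 0)) greedyBody) s (randomOrder (nonisolated G)) fun l t s' =>
      t ≤ 3 + (l.map fun x : Fin n => 25 + 15 * (R x).length).sum ∧
        Frame [7, 8, 9, 10] [0, 1, 5] s s' ∧ GreedyState s' G k l := by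
  classical
  have h1 := hw.one_lt
  set N := (nonisolated G).card with hN
  have hNn : N ≤ n := (Finset.card_le_univ _).trans (by simp)
  have hlen : s.arr 2 n = N := by
    rw [(hR n (by omega)).2.1, hN, ← List.toFinset_card_of_nodup (hR n (by omega)).1]
    congr 1
    ext v
    rw [List.mem_toFinset, hG.2]
  -- Induction on the number of unprocessed vertices; each round matches `randomOrder_of_nonempty`.
  have key : ∀ d : ℕ, ∀ pre : List (Fin n), (nonisolated G \ pre.toFinset).card = d → ∀ s1,
      Frame [7, 8, 9, 10] [0, 1, 5] s s1 → s1.var 7 = pre.length → GreedyState s1 G k pre →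
      Spec w (.while (.lt (.var 7) (.get 2 (.var 0)))
          (.seq greedyBody (.assign 7 (.add (.var 7) (.lit 1))))) s1
        (randomOrder (nonisolated G \ pre.toFinset)) fun l t s' =>
          t ≤ 1 + (l.map fun x : Fin n => 25 + 15 * (R x).length).sum ∧
            Frame [7, 8, 9, 10] [0, 1, 5] s s' ∧ GreedyState s' G k (pre ++ l) := by
    intro d
    induction d with
    | zero =>
      intro pre hd s1 hf h7 hs
      have hc := hs.card_sdiff
      rw [Finset.card_eq_zero.1 hd, randomOrder_empty]
      have hlt : ¬ (Expr.lt (.var 7) (.get 2 (.var 0))).eval w s1 ≠ 0 := by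
        rw [eval_lt_ne_zero h1 (a := pre.length) (b := N) (e := .var 7) h7]
        · omega
        · rw [Expr.eval, show (Expr.var 0).eval w s1 = n from (hf.1 0 (by simp)).trans hn,
            hf.2 2 (by simp), hlen]
      have := Spec.map (fun _ => []) (Q := fun (l : List (Fin n)) t s' =>
          t ≤ 1 + (l.map fun x : Fin n => 25 + 15 * (R x).length).sum ∧
            Frame [7, 8, 9, 10] [0, 1, 5] s s' ∧ GreedyState s' G k (pre ++ l))
        (Det.while_false (p := .seq greedyBody (.assign 7 (.add (.var 7) (.lit 1))))
          (not_not.1 hlt) (Q := fun t s' => t ≤ 1 ∧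
            Frame [7, 8, 9, 10] [0, 1, 5] s s' ∧ GreedyState s' G k (pre ++ []))
          ⟨le_rfl, hf, by simpa using hs⟩)
      rwa [PMF.pure_map] at this
    | succ d ih =>
      intro pre hd s1 hf h7 hs
      have hc := hs.card_sdiff
      have hne : (nonisolated G \ pre.toFinset).Nonempty := Finset.card_pos.1 (by omega)
      rw [randomOrder_of_nonempty hne]
      have hn1 : s1.var 0 = n := (hf.1 0 (by simp)).trans hn
      have hlt : (Expr.lt (.var 7) (.get 2 (.var 0))).eval w s1 ≠ 0 := by
        rw [eval_lt_ne_zero h1 (a := pre.length) (b := N) (e := .var 7) h7]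
        · omega
        · rw [Expr.eval, show (Expr.var 0).eval w s1 = n from hn1, hf.2 2 (by simp), hlen]
      refine Spec.while_true (Q' := fun x t s' => x ∈ nonisolated G \ pre.toFinset ∧
          t ≤ 22 + 15 * (R x).length ∧ Frame [7, 8, 9, 10] [0, 1, 5] s s' ∧
          s'.var 7 = pre.length + 1 ∧ GreedyState s' G k (pre ++ [x])) hlt ?_ ?_
      · refine Spec.seq_det ((spec_greedyBody hw hn1 (hR.frame hf (by simp)) hG
          ((hf.1 11 (by simp)).trans hk) h7 hs hne).mono_support ?_)
        rintro x hx t s' ⟨ht, hf', hs'⟩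
        have h7' : s'.var 7 = pre.length := (hf'.1 7 (by simp)).trans h7
        refine Det.assign ?_
        rw [eval_add (a := pre.length) (b := 1) (e := .var 7) h7' (eval_lit h1) (hw.lt (by omega))]
        refine ⟨(PMF.mem_support_uniformOfFinset_iff hne x).1 hx, by omega,
          (hf.trans (hf'.mono (by simp) (by simp))).setVar (by simp) _, by simp, ?_⟩
        exact hs'.congr rfl rfl rfl
      · rintro x t s' ⟨hx, ht, hf', h7', hs'⟩
        have herase : nonisolated G \ (pre ++ [x]).toFinset =
            (nonisolated G \ pre.toFinset).erase x := by
          ext v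
          simp only [Finset.mem_sdiff, List.mem_toFinset, List.mem_append, List.mem_singleton,
            Finset.mem_erase]
          tauto
        have := ih (pre ++ [x]) (by rw [herase, Finset.card_erase_of_mem hx, hd]; rfl) s' hf'
          (by simpa using h7') hs'
        rw [herase] at this
        refine Spec.map (List.cons x) (this.mono ?_)
        rintro l t' s'' ⟨ht', hf'', hs''⟩
        refine ⟨?_, hf'', by simpa using hs''⟩
        rw [List.map_cons, List.sum_cons]
        omega
  refine Det.seq_spec (Det.assign ?_)
  rw [eval_lit (hw.lt (by omega))]
  have := key _ [] rfl _ ((Frame.refl _ _ s).setVar (by simp) 0) (by simp) h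
  rw [List.toFinset_nil, Finset.sdiff_empty] at this
  refine this.mono ?_
  rintro l t s' ⟨ht, hf, hs⟩
  exact ⟨by omega, hf, hs⟩

end GreedyLoop

/-! ### The residual rows and the complete reconstruction. -/

section Rebuild
variable {n w : ℕ} {s : Store} {R : ℕ → List (Fin n)} {G : SimpleGraph (Fin n)}

theorem det_buildRow (hw : WordOK n w) (hn : s.var 0 = n) {R1 : ℕ → List (Fin n)}
    (hR : Rows n s R1) {H : Finset (Fin n)} (hst : ∀ v : Fin n, s.arr 1 v = 0 ↔ v ∈ H)
    {x : Fin n} (hx : s.var 9 = x) (hempty : R1 (n + 1 + x) = []) :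
    Det w (forRow 8 10 (.var 9) (.ite (.get 1 (.var 10)) .skip
        (rowInsert (hrow (.var 9)) (.var 10)))) s fun t s' =>
      t ≤ 3 + 15 * (R1 x).length ∧ Frame [8, 10] [2, 3, 4] s s' ∧
        Rows n s' (Function.update R1 (n + 1 + x) ((R1 x).filter (· ∈ H))) := by
  have hx2 := x.2
  have hnd := (hR x (by omega)).1
  refine det_forRow hw (ρ := x) (l := R1 x) (fun pre t s' => t ≤ 2 + 15 * pre.length ∧
    Frame [8, 10] [2, 3, 4] s s' ∧ s'.var 8 = pre.length ∧
    Rows n s' (Function.update R1 (n + 1 + x) (pre.filter (· ∈ H)))) (by omega)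
    (List.Nodup.length_le_fin hnd) ?_ ?_ ?_ ?_
  · rintro pre t s' ⟨-, hf, h8, hR'⟩
    refine ⟨(hf.1 0 (by simp)).trans hn, (hf.1 9 (by simp)).trans hx, ?_, h8⟩
    have := hR' x (by omega)
    rwa [Function.update_of_ne (by omega)] at this
  · refine ⟨by simp, (Frame.refl _ _ s).setVar (by simp) _, by simp, ?_⟩
    rw [List.filter_nil, ← hempty, Function.update_eq_self]
    exact hR.congr rfl rfl rfl
  · rintro pre v post hl t s' ⟨ht, hf, h8, hR'⟩
    have hv : v ∉ pre := by
      rw [hl, List.nodup_append] at hnd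
      intro h
      exact hnd.2.2 v h v (by simp) rfl
    have hf2 : Frame [8, 10] [2, 3, 4] s (s'.setVar 10 v) := hf.setVar (by simp) _
    have hget : (Expr.get 1 (.var 10)).eval w (s'.setVar 10 v) = s.arr 1 v := by
      simp [Expr.eval, hf.2 1 (by simp)]
    refine Det.ite ?_ ?_
    · intro h
      rw [hget, ne_eq, hst] at h
      refine Det.skip ⟨by simp [h8], ?_, hf2.setVar (by simp) _, by simp, ?_⟩
      · simp only [List.length_append, List.length_singleton]
        omega
      · have : (pre ++ [v]).filter (· ∈ H) = pre.filter (· ∈ H) := by simp [h]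
        rw [this]
        exact hR'.congr rfl rfl rfl
    · intro h
      rw [hget, hst] at h
      have hn2 : (s'.setVar 10 v).var 0 = n := (hf2.1 0 (by simp)).trans hn
      have h92 : (s'.setVar 10 v).var 9 = x := (hf2.1 9 (by simp)).trans hx
      refine (det_rowInsert hw hn2 (hR'.congr rfl rfl rfl) (Ev.hrow hw hn2 (Ev.var h92))
        (Ev.var (by simp)) (x := v) (by omega) ?_).mono ?_
      · rw [Function.update_self]
        simp [hv]
      · rintro t' s'' ⟨rfl, hf3, hR3⟩
        refine ⟨by rw [hf3.1 8 (by simp)]; simp [h8], ?_,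
          (hf2.trans (hf3.mono (by simp) (by simp))).setVar (by simp) _, by simp, ?_⟩
        · simp only [List.length_append, List.length_singleton]
          omega
        · rw [Function.update_self, Function.update_idem] at hR3
          have : (pre ++ [v]).filter (· ∈ H) = pre.filter (· ∈ H) ++ [v] := by simp [h]
          rw [this]
          exact hR3.congr rfl rfl rfl
  · rintro t s' ⟨ht, hf, h8, hR'⟩
    exact ⟨by omega, hf, hR'⟩

/-- Rows of isolated or non-residual vertices are not visited or not filled. This is right because
they start empty and `nbrsIn` is empty there. -/
theorem det_buildRows (hw : WordOK n w) (hn : s.var 0 = n) (hR : Rows n s R)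
    (hG : GraphRows G R) (hempty : ∀ v : Fin n, R (n + 1 + v) = []) {H : Finset (Fin n)}
    (hst : ∀ v : Fin n, s.arr 1 v = 0 ↔ v ∈ H) :
    Det w buildRows s fun t s' =>
      t ≤ 3 + ((R n).map fun x : Fin n => 25 + 15 * (R x).length).sum ∧
        Frame [7, 8, 9, 10] [2, 3, 4] s s' ∧ ∃ R', Rows n s' R' ∧ (∀ ρ ≤ n, R' ρ = R ρ) ∧
          ∀ v x : Fin n, x ∈ R' (n + 1 + v) ↔ x ∈ nbrsIn G H v := by
  have hnd := (hR n (by omega)).1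
  refine det_forRow hw (ρ := n) (l := R n) (fun pre t s' =>
    t ≤ 2 + (pre.map fun x : Fin n => 25 + 15 * (R x).length).sum ∧
    Frame [7, 8, 9, 10] [2, 3, 4] s s' ∧ s'.var 7 = pre.length ∧
    ∃ R', Rows n s' R' ∧ (∀ ρ ≤ n, R' ρ = R ρ) ∧
          ∀ v : Fin n, (v ∉ pre → R' (n + 1 + v) = []) ∧
            (v ∈ pre → ∀ x, x ∈ R' (n + 1 + v) ↔ x ∈ nbrsIn G H v)) (by omega)
    (List.Nodup.length_le_fin hnd) ?_ ?_ ?_ ?_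
  · rintro pre t s' ⟨-, hf, h7, R', hR', hRn, -⟩
    have h0 := (hf.1 0 (by simp)).trans hn
    exact ⟨h0, h0, hRn n le_rfl ▸ hR' n (by omega), h7⟩
  · exact ⟨by simp, (Frame.refl _ _ s).setVar (by simp) _, by simp, R, hR.congr rfl rfl rfl,
      fun _ _ => rfl, fun v => ⟨fun _ => hempty v, by simp⟩⟩
  · rintro pre v post hl t s' ⟨ht, hf, h7, R', hR', hRn, hR''⟩
    have hv : v ∉ pre := by
      rw [hl, List.nodup_append] at hnd
      intro h
      exact hnd.2.2 v h v (by simp) rfl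
    have hf2 : Frame [7, 8, 9, 10] [2, 3, 4] s (s'.setVar 9 v) := hf.setVar (by simp) _
    have hget : (Expr.get 1 (.var 9)).eval w (s'.setVar 9 v) = s.arr 1 v := by
      simp [Expr.eval, hf.2 1 (by simp)]
    refine Det.ite ?_ ?_
    · intro h
      rw [hget, ne_eq, hst] at h
      refine Det.skip ⟨by simp [h7], ?_, hf2.setVar (by simp) _, by simp, R',
        hR'.congr rfl rfl rfl, hRn, fun u => ⟨fun hu => (hR'' u).1 fun hu' => hu (by simp [hu']),
          fun hu x => ?_⟩⟩
      · simp only [List.map_append, List.map_cons, List.map_nil, List.sum_append, List.sum_cons,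
          List.sum_nil]
        omega
      · rw [List.mem_append, List.mem_singleton] at hu
        rcases hu with hu | rfl
        · exact (hR'' u).2 hu x
        · rw [(hR'' u).1 hv, mem_nbrsIn]
          simp [h]
    · intro h
      rw [hget, hst] at h
      have hn2 : (s'.setVar 9 v).var 0 = n := (hf2.1 0 (by simp)).trans hn
      refine (det_buildRow hw hn2 (hR'.congr rfl rfl rfl) (H := H) ?_ (x := v) (by simp)
        ((hR'' v).1 hv)).mono ?_
      · intro u
        rw [hf2.2 1 (by simp), hst]
      rintro t' s'' ⟨ht', hf3, hR3⟩
      refine ⟨by rw [hf3.1 7 (by simp)]; simp [h7], ?_,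
          (hf2.trans (hf3.mono (by simp) (by simp))).setVar (by simp) _, by simp, _,
          hR3.congr rfl rfl rfl, ?_, fun u => ⟨fun hu => ?_, fun hu x => ?_⟩⟩
      · simp only [List.map_append, List.map_cons, List.map_nil, List.sum_append, List.sum_cons,
          List.sum_nil]
        rw [hRn v v.2.le] at ht'
        omega
      · intro ρ hρ
        rw [Function.update_of_ne (by omega), hRn ρ hρ]
      · rw [List.mem_append, List.mem_singleton, not_or] at hu
        have : (u : ℕ) ≠ v := fun h => hu.2 (Fin.ext h)
        rw [Function.update_of_ne (by omega)]
        exact (hR'' u).1 hu.1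
      · by_cases huv : u = v
        · subst huv
          rw [Function.update_self, List.mem_filter, hRn u u.2.le, hG.1, mem_nbrsIn]
          simp [h, and_comm]
        · rw [List.mem_append, List.mem_singleton, or_iff_left huv] at hu
          have : (u : ℕ) ≠ v := fun h => huv (Fin.ext h)
          rw [Function.update_of_ne (by omega)]
          exact (hR'' u).2 hu x
  · rintro t s' ⟨ht, hf, h7, R', hR', hRn, hR''⟩
    refine ⟨by omega, hf, R', hR', hRn, fun v x => ?_⟩
    by_cases hv : v ∈ R n
    · exact (hR'' v).2 hv x
    · rw [(hR'' v).1 hv, mem_nbrsIn]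
      rw [hG.2, mem_nonisolated] at hv
      simp only [List.not_mem_nil, false_iff]
      rintro ⟨-, -, h⟩
      exact hv ⟨x, h⟩

theorem sum_length_rows (hR : Rows n s R) (hG : GraphRows G R) :
    ∑ v : Fin n, (R v).length = 2 * G.edgeSet.ncard := by
  classical
  rw [Set.ncard_eq_toFinset_card', Set.toFinset_card, ← SimpleGraph.edgeFinset_card,
    ← G.sum_degrees_eq_twice_card_edges]
  refine Finset.sum_congr rfl fun v _ => ?_
  rw [← SimpleGraph.card_neighborFinset_eq_degree,
    ← List.toFinset_card_of_nodup (hR v (by omega)).1]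
  congr 1
  ext x
  rw [List.mem_toFinset, hG.1, SimpleGraph.mem_neighborFinset]

/-- Every vertex in `l` has degree `d ≥ 1`, so `25 + 15 * d ≤ 40 * d`, and the degrees sum to at
most twice the number of edges. -/
theorem sum_map_rows_le (hR : Rows n s R) (hG : GraphRows G R) {l : List (Fin n)} (hl : l.Nodup)
    (hl' : ∀ v ∈ l, v ∈ nonisolated G) :
    (l.map fun x : Fin n => 25 + 15 * (R x).length).sum ≤ 80 * G.edgeSet.ncard := by
  have h1 : ∀ v ∈ l, 25 + 15 * (R v).length ≤ 40 * (R v).length := by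
    intro v hv
    obtain ⟨u, hu⟩ := mem_nonisolated.1 (hl' v hv)
    have := List.length_pos_of_mem ((hG.1 v u).2 hu)
    omega
  calc (l.map fun x : Fin n => 25 + 15 * (R x).length).sum
      ≤ (l.map fun x : Fin n => 40 * (R x).length).sum := List.sum_le_sum h1
    _ = ∑ v ∈ l.toFinset, 40 * (R v).length := by
        rw [List.sum_toFinset _ hl]
    _ ≤ ∑ v : Fin n, 40 * (R v).length :=
        Finset.sum_le_sum_of_subset (Finset.subset_univ _)
    _ = 80 * G.edgeSet.ncard := by
        rw [← Finset.mul_sum, sum_length_rows hR hG]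
        ring

theorem length_le_two_mul (hR : Rows n s R) (hG : GraphRows G R) :
    (R n).length ≤ 2 * G.edgeSet.ncard := by
  have h1 : ∀ v ∈ R n, 1 ≤ (R v).length := by
    intro v hv
    obtain ⟨u, hu⟩ := mem_nonisolated.1 ((hG.2 v).1 hv)
    exact List.length_pos_of_mem ((hG.1 v u).2 hu)
  calc (R n).length = ∑ v ∈ (R n).toFinset, 1 := by
        rw [Finset.sum_const, List.toFinset_card_of_nodup (hR n (by omega)).1]
        simp
    _ ≤ ∑ v ∈ (R n).toFinset, (R v).length :=
        Finset.sum_le_sum fun v hv => h1 v (List.mem_toFinset.1 hv)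
    _ ≤ ∑ v : Fin n, (R v).length := Finset.sum_le_sum_of_subset (Finset.subset_univ _)
    _ = 2 * G.edgeSet.ncard := sum_length_rows hR hG

/-- Every vertex that has been processed is taken or dominated. -/
theorem exists_of_mem_greedyFrom {l : List (Fin n)} {v : Fin n} (hv : v ∈ l) :
    v ∈ greedyFrom G ∅ l ∨ ∃ u ∈ greedyFrom G ∅ l, G.Adj v u := by
  obtain ⟨l1, l2, rfl⟩ := List.append_of_mem hv
  have h := notMem_residual_greedyStep (G := G) (greedyFrom G ∅ l1) v
  have h2 : greedyStep G (greedyFrom G ∅ l1) v ⊆ greedyFrom G ∅ (l1 ++ v :: l2) := by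
    rw [greedyFrom_append]
    exact subset_greedyFrom _ l2
  rw [mem_residual] at h
  by_contra h'
  push Not at h'
  exact h ⟨fun h3 => h'.1 (h2 h3), fun u hu => h'.2 u (h2 hu)⟩

/-- The state after the greedy algorithm and the construction of the residual graph. -/
theorem GreedyState.inv {s' : Store} {k : ℕ} {l : List (Fin n)} (h : GreedyState s G k l)
    (hl : ∀ v ∈ nonisolated G, v ∈ l) (h0 : s'.arr 0 = s.arr 0) (h1 : s'.arr 1 = s.arr 1)
    {R' : ℕ → List (Fin n)} (hR : Rows n s' R') (hG : GraphRows G R')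
    (hH : ∀ v x : Fin n, x ∈ R' (n + 1 + v) ↔
      x ∈ nbrsIn G (residual G (greedyFrom G ∅ (l.take k))) v) :
    Inv s' G (greedyFrom G ∅ (l.take k)) (residual G (greedyFrom G ∅ (l.take k))) ∧
      ∀ v : Fin n, s'.arr 0 v = 0 ↔ v ∈ greedyFrom G ∅ l ∪ (nonisolated G)ᶜ := by
  classical
  have hind := greedyFrom_isIndepSet (G := G) l (S := ∅) (by simp)
  have hTS : greedyFrom G ∅ (l.take k) ⊆ greedyFrom G ∅ l := by
    conv_rhs => rw [← List.take_append_drop k l, greedyFrom_append]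
    exact subset_greedyFrom _ _
  have hSl : greedyFrom G ∅ l ⊆ nonisolated G := by
    intro v hv
    have := greedyFrom_subset ∅ l hv
    rw [Finset.empty_union, List.mem_toFinset] at this
    exact h.sub v this
  have hout : ∀ v : Fin n, s'.arr 0 v = 0 ↔ v ∈ greedyFrom G ∅ l ∪ (nonisolated G)ᶜ := by
    intro v
    rw [h0, h.out_eq_zero, Finset.mem_union, Finset.mem_compl]
    constructor
    · intro hv
      by_cases hvN : v ∈ nonisolated G
      · exact Or.inl ((exists_of_mem_greedyFrom (hl v hvN)).resolve_right hv)
      · exact Or.inr hvN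
    · rintro (hv | hv) ⟨u, hu, hvu⟩
      · exact hind v hv u hu hvu
      · exact hv (mem_nonisolated.2 ⟨u, hvu⟩)
  refine ⟨⟨⟨R', hR, hG, hH⟩, ?_, ?_, ?_, ?_, ?_, ?_, ?_, ?_⟩, hout⟩
  · intro v
    rw [h1, h.status]
    by_cases hvT : v ∈ greedyFrom G ∅ (l.take k)
    · rw [if_pos hvT, if_pos hvT]
    · rw [if_neg hvT, if_neg hvT]
      by_cases hv : ∃ u ∈ greedyFrom G ∅ (l.take k), G.Adj v u
      · rw [if_pos hv, if_neg]
        rw [mem_residual]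
        push Not
        exact fun _ => hv
      · rw [if_neg hv, if_pos]
        rw [mem_residual]
        push Not at hv
        exact ⟨hvT, hv⟩
  · intro v hv hv'
    exact (mem_residual.1 hv').1 hv
  · exact hTS.trans hSl
  · rintro u hu v (hv | hv) huv
    · exact hind u (hTS hu) v (hTS hv) huv
    · exact (mem_residual.1 hv).2 u hu huv.symm
  · intro v hvT hvH
    rw [mem_residual] at hvH
    push Not at hvH
    exact hvH hvT
  · intro v hv
    rw [hout]
    exact Finset.mem_union_left _ (hTS hv)
  · intro v hvT hvH
    rw [h0, ne_eq, h.out_eq_zero, not_not]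
    rw [mem_residual] at hvH
    push Not at hvH
    obtain ⟨u, hu, hvu⟩ := hvH hvT
    exact ⟨u, hTS hu, hvu⟩
  -- For `v` in the residual set, a greedy neighbour `u` of `v` is itself residual: it is not in
  -- `T`, or `v` would be dominated, and it is not dominated by `T`, since the greedy set is
  -- independent. So the counter over all neighbours equals the residual counter.
  · intro v hv
    conv_lhs => rw [h0]
    rw [h.out]
    congr 1
    ext u
    rw [Finset.mem_filter, Finset.mem_filter, hout, mem_nbrsIn, Finset.mem_union, Finset.mem_compl]
    constructor
    · rintro ⟨hu, hvu⟩
      refine ⟨⟨hv, mem_residual.2 ⟨fun huT => (mem_residual.1 hv).2 u huT hvu, fun x hx =>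
        hind u hu x (hTS hx)⟩, hvu⟩, Or.inl hu⟩
    · rintro ⟨⟨-, -, hvu⟩, hu | hu⟩
      · exact ⟨hu, hvu⟩
      · exact absurd (mem_nonisolated.2 ⟨v, hvu.symm⟩) hu

/-- Random-order greedy restores the invariant, and stores the greedy independent set. -/
theorem spec_rebuild (hw : WordOK n w) (hn : s.var 0 = n) {a b : Fin n} (ha : s.var 2 = a)
    (hb : s.var 3 = b) (hG : GraphRows G R) {r : ℕ} (hr : s.var 5 = r) (hr' : r ≤ n + 1)
    (hc : Cleared s R fun v => v ∉ nonisolated G ∧ v ≠ a ∧ v ≠ b) :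
    Spec w rebuild s (randomOrder (nonisolated G)) fun l t s' =>
      t ≤ 40 + 200 * G.edgeSet.ncard ∧ Frame [7, 8, 9, 10, 11] [0, 1, 2, 3, 4, 5] s s' ∧
        Inv s' G (greedyFrom G ∅ (l.take ((nonisolated G).card / (8 * r))))
          (residual G (greedyFrom G ∅ (l.take ((nonisolated G).card / (8 * r))))) ∧
        ∀ v : Fin n, s'.arr 0 v = 0 ↔ v ∈ greedyFrom G ∅ l ∪ (nonisolated G)ᶜ := by
  have h1 := hw.one_lt
  refine Det.seq_spec ((det_resetAll hw hn ha hb hG hc).mono ?_)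
  rintro t1 s1 ⟨ht1, hf1, ⟨R1, hR1, hRn1, hcl1⟩, h51⟩
  have hn1 : s1.var 0 = n := (hf1.1 0 (by simp)).trans hn
  have hG1 := hG.congr hRn1
  have hRn : R n = R1 n := (hRn1 n le_rfl).symm
  rw [hRn] at h51 ht1
  set N := (nonisolated G).card with hN
  have hlen : (R1 n).length = N := by
    rw [hN, ← List.toFinset_card_of_nodup (hR1 n (by omega)).1]
    congr 1
    ext v
    rw [List.mem_toFinset, hG1.2]
  refine Det.seq_spec (Det.assign ?_)
  have hk : (Expr.div (.get 2 (.var 0)) (.mul (.lit 8) (.var 5))).eval w s1 = N / (8 * r) := by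
    rw [Expr.eval, eval_mul (a := 8) (b := r) (f := .var 5) (eval_lit (hw.lt (by omega)))
      ((hf1.1 5 (by simp)).trans hr) (hw.lt (by omega)), Expr.eval,
      show (Expr.var 0).eval w s1 = n from hn1, (hR1 n (by omega)).2.1, hlen]
  rw [hk]
  set k := N / (8 * r) with hkdef
  set s2 := s1.setVar 11 k with hs2
  have hf2 : Frame [7, 8, 9, 10, 11] [0, 1, 2, 3, 4, 5] s s2 :=
    (hf1.mono (by simp) (by simp)).setVar (by simp) _
  have hn2 : s2.var 0 = n := (hf2.1 0 (by simp)).trans hn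
  have hR2 : Rows n s2 R1 := hR1.congr rfl rfl rfl
  refine Spec.seq_det ((spec_greedyLoop hw hn2 hR2 hG1 (k := k) (by simp [hs2]) ?_).mono_support ?_)
  · refine ⟨by simp, by simp, ?_, ?_, ?_⟩
    · intro v hv
      rw [List.toFinset_nil, Finset.sdiff_empty, ← hG1.2] at hv
      obtain ⟨i, hi, rfl⟩ := List.getElem_of_mem hv
      exact ⟨i, by simp, by omega, h51 i hi⟩
    · intro v
      simp [hs2, (hcl1 v trivial).1, greedyFrom]
    · intro v
      simp [hs2, (hcl1 v trivial).2.1, greedyFrom]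
  rintro l hl t3 s3 ⟨ht3, hf3, hgs⟩
  obtain ⟨hlnd, hlN⟩ := nodup_of_mem_support_randomOrder hl
  have hn3 : s3.var 0 = n := (hf3.1 0 (by simp)).trans hn2
  have hR3 : Rows n s3 R1 := hR2.frame hf3 (by simp)
  refine (det_buildRows hw hn3 hR3 hG1 (fun v => (hcl1 v trivial).2.2)
    (H := residual G (greedyFrom G ∅ (l.take k))) ?_).mono ?_
  · intro v
    rw [hgs.status, mem_residual]
    split_ifs with h h'
    · simp [h]
    · simpa [h] using h'
    · push Not at h'
      simpa [h] using h'
  rintro t4 s4 ⟨ht4, hf4, R4, hR4, hRn4, hH4⟩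
  have hinv := hgs.inv (s' := s4) (fun v hv => List.mem_toFinset.1 (hlN ▸ hv)) (hf4.2 0 (by simp))
    (hf4.2 1 (by simp)) hR4 (hG1.congr hRn4) hH4
  refine ⟨?_, hf2.trans ((hf3.mono (by simp) (by simp)).trans (hf4.mono (by simp) (by simp))),
    hinv⟩
  -- With `m` edges: `80 * m` for the greedy loop, `80 * m` for the residual rows and `15 * (2 * m)`
  -- for the reset, plus constants.
  have e1 := sum_map_rows_le hR1 hG1 hlnd fun v hv => hlN ▸ List.mem_toFinset.2 hv
  have e2 := sum_map_rows_le hR1 hG1 (hR1 n (by omega)).1 fun v hv => (hG1.2 v).1 hv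
  have e3 := length_le_two_mul hR1 hG1
  omega

end Rebuild

/-! ## Updates inside the residual graph -/

/-- Add one to the counter of a vertex. -/
def incr (e : Expr) : Stmt := .store 0 e (.add (.get 0 e) (.lit 1))

/-- Subtract one from the counter of a vertex. -/
def decr (e : Expr) : Stmt := .store 0 e (.sub (.get 0 e) (.lit 1))

/-- The vertex in variable `9` joins the independent set. -/
def joinVertex : Stmt := forRow 8 10 (hrow (.var 9)) (incr (.var 10))

/-- The vertex in variable `3` leaves the independent set. -/
def leaveVertex : Stmt :=
  forRow 7 9 (hrow (.var 3)) (.seq (decr (.var 9)) (.ite (.get 0 (.var 9)) .skip joinVertex))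

/-- Insertion of an edge of the residual graph. -/
def localInsert : Stmt :=
  .seq (.ite (.get 0 (.var 2)) (.ite (.get 0 (.var 3)) .skip (incr (.var 2)))
      (.seq (.ite (.get 0 (.var 3)) .skip leaveVertex) (incr (.var 3))))
    (.seq (rowInsert (hrow (.var 2)) (.var 3)) (rowInsert (hrow (.var 3)) (.var 2)))

/-- A neighbour of the vertex `e` in the independent set is gone. -/
def release (e : Expr) : Stmt :=
  .seq (decr e) (.ite (.get 0 e) .skip (.seq (.assign 9 e) joinVertex))

/-- Deletion of an edge of the residual graph. -/
def localDelete : Stmt :=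
  .seq (rowErase (hrow (.var 2)) (.var 3)) (.seq (rowErase (hrow (.var 3)) (.var 2))
    (.ite (.get 0 (.var 2)) (.ite (.get 0 (.var 3)) .skip (release (.var 2)))
      (release (.var 3))))

section Local
variable {n w : ℕ} {s : Store} {R : ℕ → List (Fin n)}

/-- The counters belong to the independent set `M` of the graph on `H` with neighbourhoods `nb`. -/
structure Counts (s : Store) (nb : Fin n → Finset (Fin n)) (H M : Finset (Fin n)) : Prop where
  sub : M ⊆ H
  out : ∀ x ∈ H, s.arr 0 x = (nb x ∩ M).card
  mem_iff : ∀ x ∈ H, x ∈ M ↔ s.arr 0 x = 0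

/-- The sum of the degrees of the vertices outside `M`. -/
def outDeg (nb : Fin n → Finset (Fin n)) (H M : Finset (Fin n)) : ℕ := ∑ x ∈ H \ M, (nb x).card

/-- A joining vertex releases exactly its degree from the potential, which pays for informing its
neighbours. -/
theorem outDeg_insert (nb : Fin n → Finset (Fin n)) {H M : Finset (Fin n)} {y : Fin n} (hy : y ∈ H)
    (hyM : y ∉ M) : outDeg nb H (insert y M) + (nb y).card = outDeg nb H M := by
  unfold outDeg
  rw [Finset.sdiff_insert, Finset.sum_erase_add _ _ (Finset.mem_sdiff.2 ⟨hy, hyM⟩)]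

theorem det_joinVertex (hw : WordOK n w) (hn : s.var 0 = n) (hR : Rows n s R) {x : Fin n}
    (hx : s.var 9 = x) (hout : ∀ v ∈ R (n + 1 + x), s.arr 0 v ≤ 2 * n) :
    Det w joinVertex s fun t s' => t ≤ 3 + 10 * (R (n + 1 + x)).length ∧
      Frame [8, 10] [0] s s' ∧
      ∀ v : Fin n, s'.arr 0 v = s.arr 0 v + if v ∈ R (n + 1 + x) then 1 else 0 := by
  have hx2 := x.2
  have hnd := (hR (n + 1 + x) (by omega)).1
  refine det_forRow hw (ρ := n + 1 + x) (l := R (n + 1 + x)) (fun pre t s' =>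
    t ≤ 2 + 10 * pre.length ∧ Frame [8, 10] [0] s s' ∧ s'.var 8 = pre.length ∧
    ∀ v : Fin n, s'.arr 0 v = s.arr 0 v + if v ∈ pre then 1 else 0) (by omega)
    (List.Nodup.length_le_fin hnd) ?_ ?_ ?_ ?_
  · rintro pre t s' ⟨-, hf, h8, -⟩
    have hn' := (hf.1 0 (by simp)).trans hn
    refine ⟨hn', (Ev.hrow hw hn' (Ev.var ((hf.1 9 (by simp)).trans hx))).eq, ?_, h8⟩
    exact (hR.frame hf (by simp)) _ (by omega)
  · exact ⟨by simp, (Frame.refl _ _ s).setVar (by simp) _, by simp, by simp⟩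
  · rintro pre v post hl t s' ⟨ht, hf, h8, ho⟩
    have hv : v ∉ pre := by
      rw [hl, List.nodup_append] at hnd
      intro h
      exact hnd.2.2 v h v (by simp) rfl
    refine Det.store ?_
    have e1 : (Expr.var 10).eval w (s'.setVar 10 v) = v := by simp [Expr.eval]
    rw [eval_add (a := s.arr 0 v) (b := 1) _ (eval_lit hw.one_lt)
      (hw.lt (by have := hout v (by simp [hl]); omega)), e1]
    · refine ⟨by simp [h8], ?_, ((hf.setVar (by simp) _).setArr (by simp) _ _).setVar (by simp) _,
        by simp, ?_⟩
      · simp only [List.length_append, List.length_singleton]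
        omega
      · intro u
        by_cases huv : u = v
        · subst huv
          simp
        · have : (u : ℕ) ≠ v := fun h => huv (Fin.ext h)
          simp [huv, this, ho]
    · rw [Expr.eval, e1, Store.setVar_arr, ho, if_neg hv, add_zero]
  · rintro t s' ⟨ht, hf, h8, ho⟩
    exact ⟨by omega, hf, ho⟩

/-- `v` is about to leave the independent set; the neighbours of `v` in `pre` have been told so. -/
structure Leaving (s : Store) (nb : Fin n → Finset (Fin n)) (H : Finset (Fin n)) (v : Fin n)
    (pre : List (Fin n)) (M : Finset (Fin n)) : Prop where
  sub : M ⊆ H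
  notMem : v ∉ M
  out : ∀ x ∈ H, s.arr 0 x = (nb x ∩ M).card + if x ∈ nb v ∧ x ∉ pre then 1 else 0
  indep : ∀ x ∈ M, nb x ∩ M = ∅
  rest : ∀ x ∈ nb v, x ∉ pre → x ∉ M
  mem : ∀ x ∈ H, x ≠ v → (x ∈ nb v → x ∈ pre) → nb x ∩ M = ∅ → x ∈ M

/-- In `30 * (nb v).card`, ten units per neighbour cover the rise of the potential when `v` leaves
and twenty cover the loop; joining neighbours pay for themselves. The equivalence of membership and
counter `0` is stated for `x ≠ v` only: `v` must stay out even with counter `0`, because the caller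
is about to give it a neighbour in the set. -/
theorem det_leaveVertex (hw : WordOK n w) (hn : s.var 0 = n) (hR : Rows n s R) {v : Fin n}
    (hv : s.var 3 = v) {nb : Fin n → Finset (Fin n)} {H M : Finset (Fin n)}
    (hnb : ∀ x y : Fin n, y ∈ R (n + 1 + x) ↔ y ∈ nb x) (hsymm : ∀ x y, y ∈ nb x → x ∈ nb y)
    (hH : ∀ x, nb x ⊆ H) (hirr : ∀ x, x ∉ nb x) (hc : Counts s nb H M) (hvH : v ∈ H)
    (hv0 : s.arr 0 v = 0) :
    Det w leaveVertex s fun t s' => Frame [7, 8, 9, 10] [0] s s' ∧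
      (∀ x : Fin n, x ∉ H → s'.arr 0 x = s.arr 0 x) ∧ ∃ M', M.erase v ⊆ M' ∧ v ∉ M' ∧ M' ⊆ H ∧
        (∀ x ∈ H, s'.arr 0 x = (nb x ∩ M').card) ∧ (∀ x ∈ H, x ≠ v → (x ∈ M' ↔ s'.arr 0 x = 0)) ∧
        t + 10 * outDeg nb H M' ≤ 10 * outDeg nb H M + 30 * (nb v).card + 3 := by
  have hv2 := v.2
  have hnd := (hR (n + 1 + v) (by omega)).1
  have hlen : (R (n + 1 + v)).length = (nb v).card := by
    rw [← List.toFinset_card_of_nodup hnd]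
    congr 1
    ext y
    rw [List.mem_toFinset, hnb]
  have hvM : v ∈ M := (hc.mem_iff v hvH).2 hv0
  have hindM : ∀ x ∈ M, nb x ∩ M = ∅ := fun x hx => by
    rw [← Finset.card_eq_zero, ← hc.out x (hc.sub hx), ← hc.mem_iff x (hc.sub hx)]
    exact hx
  have hstart : outDeg nb H (M.erase v) = outDeg nb H M + (nb v).card := by
    rw [← outDeg_insert nb hvH (M := M.erase v) (by simp), Finset.insert_erase hvM]
  have hlv : Leaving s nb H v [] (M.erase v) := by
    refine ⟨(Finset.erase_subset _ _).trans hc.sub, by simp, ?_, ?_, ?_, ?_⟩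
    · intro x hx
      rw [hc.out x hx, Finset.inter_erase]
      by_cases h : x ∈ nb v
      · have : v ∈ nb x ∩ M := Finset.mem_inter.2 ⟨hsymm _ _ h, hvM⟩
        rw [Finset.card_erase_of_mem this]
        have := Finset.card_pos.2 ⟨v, this⟩
        simp [h]
        omega
      · rw [Finset.erase_eq_of_notMem]
        · simp [h]
        · intro h'
          exact h (hsymm _ _ (Finset.mem_inter.1 h').1)
    · intro x hx
      rw [← Finset.subset_empty, ← hindM x (Finset.mem_of_mem_erase hx)]
      exact Finset.inter_subset_inter_left (Finset.erase_subset _ _)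
    · intro x hx _ hxM
      have : x ∈ nb v ∩ M := Finset.mem_inter.2 ⟨hx, Finset.mem_of_mem_erase hxM⟩
      rw [hindM v hvM] at this
      simp at this
    · intro x hx hxv hxn hx0
      refine Finset.mem_erase.2 ⟨hxv, (hc.mem_iff x hx).2 ?_⟩
      rw [hc.out x hx, Finset.card_eq_zero]
      have hvx : v ∉ nb x := fun h => by simpa using hxn (hsymm _ _ h)
      rwa [Finset.inter_erase, Finset.erase_eq_of_notMem fun h => hvx (Finset.mem_inter.1 h).1]
        at hx0
  refine det_forRow hw (ρ := n + 1 + v) (l := R (n + 1 + v)) (fun pre t s' =>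
    Frame [7, 8, 9, 10] [0] s s' ∧ s'.var 7 = pre.length ∧
    (∀ x : Fin n, x ∉ H → s'.arr 0 x = s.arr 0 x) ∧ ∃ M', M.erase v ⊆ M' ∧
      Leaving s' nb H v pre M' ∧
      t + 10 * outDeg nb H M' ≤ 10 * outDeg nb H (M.erase v) + 20 * pre.length + 2) (by omega)
    (List.Nodup.length_le_fin hnd) ?_ ?_ ?_ ?_
  · rintro pre t s' ⟨hf, h7, -⟩
    have hn' := (hf.1 0 (by simp)).trans hn
    refine ⟨hn', (Ev.hrow hw hn' (Ev.var ((hf.1 3 (by simp)).trans hv))).eq, ?_, h7⟩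
    exact (hR.frame hf (by simp)) _ (by omega)
  · refine ⟨(Frame.refl _ _ s).setVar (by simp) _, by simp, by simp, M.erase v, subset_rfl, ?_,
      by simp; omega⟩
    exact ⟨hlv.sub, hlv.notMem, hlv.out, hlv.indep, hlv.rest, hlv.mem⟩
  · rintro pre y post hl t s' ⟨hf, h7, hoff, M', hMM', hlv', ht⟩
    have hyp : y ∉ pre := by
      rw [hl, List.nodup_append] at hnd
      intro h
      exact hnd.2.2 y h y (by simp) rfl
    have hyv : y ∈ nb v := by
      rw [← hnb, hl]
      simp
    have hyH : y ∈ H := hH v hyv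
    have hyM : y ∉ M' := hlv'.rest y hyv hyp
    have hyne : y ≠ v := fun h => hirr v (h ▸ hyv)
    -- The extra `1` is the departed `v`, of which `y` has not been told. Until then `y` cannot
    -- appear free, although another neighbour may already have joined.
    have hoy : s'.arr 0 y = (nb y ∩ M').card + 1 := by
      rw [hlv'.out y hyH, if_pos ⟨hyv, hyp⟩]
    refine Det.seq (Det.store ?_)
    have e1 : (Expr.var 9).eval w (s'.setVar 9 y) = y := by simp [Expr.eval]
    have e2 : (Expr.sub (.get 0 (.var 9)) (.lit 1)).eval w (s'.setVar 9 y) = (nb y ∩ M').card := by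
      rw [Expr.eval, eval_lit hw.one_lt, Expr.eval, e1, Store.setVar_arr, hoy]
      rfl
    rw [e1, e2]
    have hf2 : Frame [7, 8, 9, 10] [0] s ((s'.setVar 9 y).setArr 0 y (nb y ∩ M').card) :=
      (hf.setVar (by simp) _).setArr (by simp) _ _
    have ho2 : ∀ x : Fin n, ((s'.setVar 9 y).setArr 0 y (nb y ∩ M').card).arr 0 x =
        if x = y then (nb y ∩ M').card else s'.arr 0 x := by
      intro x
      simp [Fin.ext_iff]
    have h72 : ((s'.setVar 9 y).setArr 0 y (nb y ∩ M').card).var 7 = pre.length := by simp [h7]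
    have h92 : ((s'.setVar 9 y).setArr 0 y (nb y ∩ M').card).var 9 = y := by simp
    generalize (s'.setVar 9 y).setArr 0 y (nb y ∩ M').card = s2 at *
    have hoff2 : ∀ x : Fin n, x ∉ H → s2.arr 0 x = s.arr 0 x := by
      intro x hx
      rw [ho2, if_neg (by rintro rfl; exact hx hyH), hoff x hx]
    have hout2 : ∀ x ∈ H, s2.arr 0 x = (nb x ∩ M').card +
        if x ∈ nb v ∧ x ∉ pre ++ [y] then 1 else 0 := by
      intro x hx
      rw [ho2]
      by_cases hxy : x = y
      · subst hxy
        simp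
      · rw [if_neg hxy, hlv'.out x hx]
        simp [hxy]
    have hget : (Expr.get 0 (.var 9)).eval w s2 = (nb y ∩ M').card := by
      rw [Expr.eval, show (Expr.var 9).eval w s2 = y from h92, ho2, if_pos rfl]
    refine Det.ite ?_ ?_
    · intro h
      rw [hget] at h
      refine Det.skip ⟨h72, hf2.setVar (by simp) _, by simp, hoff2, M', hMM',
        ⟨hlv'.sub, hlv'.notMem, hout2, hlv'.indep, fun x hx hxp => hlv'.rest x hx fun h' =>
          hxp (by simp [h']), ?_⟩, ?_⟩
      · intro x hx hxv hxn hx0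
        refine hlv'.mem x hx hxv (fun hx' => ?_) hx0
        have := hxn hx'
        rw [List.mem_append, List.mem_singleton] at this
        rcases this with h' | rfl
        · exact h'
        · rw [hx0] at h
          simp at h
      · simp only [List.length_append, List.length_singleton]
        omega
    · intro h
      rw [hget, Finset.card_eq_zero] at h
      have hR2 : Rows n s2 R := hR.frame hf2 (by simp)
      have hn2 := (hf2.1 0 (by simp)).trans hn
      refine (det_joinVertex hw hn2 hR2 h92 ?_).mono ?_
      · intro x hx
        rw [hout2 x (hH y ((hnb y x).1 hx))]
        have : (nb x ∩ M').card ≤ n := (Finset.card_le_univ _).trans (by simp)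
        split_ifs <;> omega
      rintro t' s'' ⟨ht', hf', ho'⟩
      have hrow : (R (n + 1 + y)).length = (nb y).card := by
        rw [← List.toFinset_card_of_nodup (hR (n + 1 + y) (by omega)).1]
        congr 1
        ext z
        rw [List.mem_toFinset, hnb]
      refine ⟨by rw [hf'.1 7 (by simp), h72],
        (hf2.trans (hf'.mono (by simp) (by simp))).setVar (by simp) _, by simp, ?_,
        insert y M', hMM'.trans (Finset.subset_insert _ _), ⟨?_, ?_, ?_, ?_, ?_, ?_⟩, ?_⟩
      · intro x hx
        rw [Store.setVar_arr, ho', if_neg, add_zero, hoff2 x hx]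
        rw [hnb]
        exact fun h => hx (hH y h)
      · exact Finset.insert_subset hyH hlv'.sub
      · rw [Finset.mem_insert, not_or]
        exact ⟨hyne.symm, hlv'.notMem⟩
      · intro x hx
        rw [Store.setVar_arr, ho', hout2 x hx]
        by_cases hxy : x ∈ nb y
        · rw [Finset.inter_insert_of_mem (hsymm _ _ hxy), Finset.card_insert_of_notMem
            (by simp [hyM]), if_pos ((hnb y x).2 hxy)]
          omega
        · rw [Finset.inter_insert_of_notMem fun h => hxy (hsymm _ _ h),
            if_neg fun h => hxy ((hnb y x).1 h)]
          rfl
      · intro x hx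
        rw [Finset.mem_insert] at hx
        rcases hx with rfl | hx
        · rw [Finset.inter_insert_of_notMem (hirr x), h]
        · rw [Finset.inter_insert_of_notMem, hlv'.indep x hx]
          intro hyx
          have : x ∈ nb y ∩ M' := Finset.mem_inter.2 ⟨hsymm _ _ hyx, hx⟩
          rw [h] at this
          simp at this
      · intro x hx hxp
        rw [List.mem_append, List.mem_singleton, not_or] at hxp
        rw [Finset.mem_insert, not_or]
        exact ⟨hxp.2, hlv'.rest x hx hxp.1⟩
      · intro x hx hxv hxn hx0
        by_cases hxy : x = y
        · exact hxy ▸ Finset.mem_insert_self _ _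
        refine Finset.mem_insert_of_mem (hlv'.mem x hx hxv (fun hx' => ?_) ?_)
        · have := hxn hx'
          rw [List.mem_append, List.mem_singleton] at this
          exact this.resolve_right hxy
        · rw [← Finset.subset_empty, ← hx0]
          exact Finset.inter_subset_inter_left (Finset.subset_insert _ _)
      -- The joining loop takes at most `3 + 10 * (nb y).card` steps, and ten times the potential
      -- falls by `10 * (nb y).card`.
      · have := outDeg_insert nb hyH hyM
        rw [hrow] at ht'
        simp only [List.length_append, List.length_singleton]
        omega
  · rintro t s' ⟨hf, h7, hoff, M', hMM', hlv', ht⟩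
    have hcount : ∀ x ∈ H, s'.arr 0 x = (nb x ∩ M').card := by
      intro x hx
      rw [hlv'.out x hx, if_neg, add_zero]
      rw [hnb]
      tauto
    refine ⟨hf, hoff, M', hMM', hlv'.notMem, hlv'.sub, hcount, ?_, by omega⟩
    intro x hx hxv
    rw [hcount x hx, Finset.card_eq_zero]
    exact ⟨hlv'.indep x, hlv'.mem x hx hxv fun h => (hnb v x).2 h⟩

end Local

/-! ### Edge insertions and deletions inside the residual graph. -/

section LocalUpdate
variable {n w : ℕ} {s : Store} {R : ℕ → List (Fin n)}

/-- The rows of the residual graph hold the neighbourhoods `nb`. -/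
def ResRows (R : ℕ → List (Fin n)) (nb : Fin n → Finset (Fin n)) : Prop :=
  ∀ x y : Fin n, y ∈ R (n + 1 + x) ↔ y ∈ nb x

/-- The neighbourhoods of a graph on `H`. -/
structure IsNbhd (nb : Fin n → Finset (Fin n)) (H : Finset (Fin n)) : Prop where
  symm : ∀ x y, y ∈ nb x → x ∈ nb y
  sub : ∀ x, nb x ⊆ H
  irrefl : ∀ x, x ∉ nb x

theorem ResRows.length_eq (hR : Rows n s R) {nb : Fin n → Finset (Fin n)} (h : ResRows R nb)
    (x : Fin n) : (R (n + 1 + x)).length = (nb x).card := by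
  have := x.2
  rw [← List.toFinset_card_of_nodup (hR (n + 1 + x) (by omega)).1]
  congr 1
  ext y
  rw [List.mem_toFinset, h]

theorem Counts.card_lt {nb : Fin n → Finset (Fin n)} {H M : Finset (Fin n)} (h : Counts s nb H M)
    {x : Fin n} (hx : x ∈ H) : s.arr 0 x ≤ n := by
  rw [h.out x hx]
  exact (Finset.card_le_univ _).trans (by simp)

theorem eval_get_var {a x i : ℕ} (h : s.var x = i) : (Expr.get a (.var x)).eval w s = s.arr a i := by
  rw [Expr.eval, Expr.eval, h]

/-- Insert two arcs into the residual graph. -/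
theorem det_insertArcs (hw : WordOK n w) (hn : s.var 0 = n) (hR : Rows n s R) {u v : Fin n}
    (hu : s.var 2 = u) (hv : s.var 3 = v) {nb nb' : Fin n → Finset (Fin n)} (hnb : ResRows R nb)
    (huv : u ≠ v) (h1 : v ∉ nb u) (h2 : u ∉ nb v)
    (hnb' : ∀ x y, y ∈ nb' x ↔ y ∈ nb x ∨ (x = u ∧ y = v) ∨ (x = v ∧ y = u)) :
    Det w (.seq (rowInsert (hrow (.var 2)) (.var 3)) (rowInsert (hrow (.var 3)) (.var 2))) s
      fun t s' => t = 11 ∧ Frame [] [2, 3, 4] s s' ∧ ∃ R', Rows n s' R' ∧ (∀ ρ ≤ n, R' ρ = R ρ) ∧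
        ResRows R' nb' := by
  have hu2 := u.2
  have hv2 := v.2
  have huv' : (u : ℕ) ≠ v := fun h => huv (Fin.ext h)
  refine Det.seq ((det_rowInsert hw hn hR (Ev.hrow hw hn (Ev.var hu)) (Ev.var hv) (by omega)
    (by rwa [hnb])).mono ?_)
  rintro t s1 ⟨rfl, hf1, hR1⟩
  have hn1 := (hf1.1 0 (by simp)).trans hn
  refine (det_rowInsert hw hn1 hR1 (Ev.hrow hw hn1 (Ev.var ((hf1.1 3 (by simp)).trans hv)))
    (Ev.var ((hf1.1 2 (by simp)).trans hu)) (by omega) ?_).mono ?_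
  · rw [Function.update_of_ne (by omega), hnb]
    exact h2
  rintro t s2 ⟨rfl, hf2, hR2⟩
  refine ⟨rfl, hf1.trans hf2, _, hR2, ?_, ?_⟩
  · intro ρ hρ
    rw [Function.update_of_ne (by omega), Function.update_of_ne (by omega)]
  · intro x y
    have hx2 := x.2
    rw [hnb', ← hnb]
    by_cases hxv : x = v
    · subst hxv
      rw [Function.update_self, Function.update_of_ne (by omega)]
      simp [huv.symm]
    · have hxv' : (x : ℕ) ≠ v := fun h => hxv (Fin.ext h)
      rw [Function.update_of_ne (by omega)]
      by_cases hxu : x = u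
      · subst hxu
        rw [Function.update_self]
        simp [hxv]
      · have hxu' : (x : ℕ) ≠ u := fun h => hxu (Fin.ext h)
        rw [Function.update_of_ne (by omega)]
        simp [hxu, hxv]

/-- Remove two arcs from the residual graph. -/
theorem det_eraseArcs (hw : WordOK n w) (hn : s.var 0 = n) (hR : Rows n s R) {u v : Fin n}
    (hu : s.var 2 = u) (hv : s.var 3 = v) {nb nb' : Fin n → Finset (Fin n)} (hnb : ResRows R nb)
    (huv : u ≠ v) (h1 : v ∈ nb u) (h2 : u ∈ nb v)
    (hnb' : ∀ x y, y ∈ nb' x ↔ y ∈ nb x ∧ ¬ (x = u ∧ y = v) ∧ ¬ (x = v ∧ y = u)) {p : Stmt}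
    {Q : ℕ → Store → Prop}
    (hp : ∀ s', Frame [] [2, 3, 4] s s' → ∀ R', Rows n s' R' → (∀ ρ ≤ n, R' ρ = R ρ) →
      ResRows R' nb' → Det w p s' fun t s'' => Q (t + 12) s'') :
    Det w (.seq (rowErase (hrow (.var 2)) (.var 3)) (.seq (rowErase (hrow (.var 3)) (.var 2)) p)) s
      Q := by
  have hu2 := u.2
  have hv2 := v.2
  have huv' : (u : ℕ) ≠ v := fun h => huv (Fin.ext h)
  refine Det.seq ((det_rowErase hw hn hR (Ev.hrow hw hn (Ev.var hu)) (Ev.var hv) (by omega)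
    (by rwa [hnb])).mono ?_)
  rintro t s1 ⟨rfl, hf1, l1, hl1, hR1⟩
  have hn1 := (hf1.1 0 (by simp)).trans hn
  refine Det.seq ((det_rowErase hw hn1 hR1 (Ev.hrow hw hn1 (Ev.var ((hf1.1 3 (by simp)).trans hv)))
    (Ev.var ((hf1.1 2 (by simp)).trans hu)) (by omega) ?_).mono ?_)
  · rw [Function.update_of_ne (by omega), hnb]
    exact h2
  rintro t s2 ⟨rfl, hf2, l2, hl2, hR2⟩
  rw [Function.update_of_ne (by omega)] at hl2
  refine (hp s2 (hf1.trans hf2) _ hR2 ?_ ?_).mono fun t s' h => ?_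
  · intro ρ hρ
    rw [Function.update_of_ne (by omega), Function.update_of_ne (by omega)]
  · intro x y
    have hx2 := x.2
    rw [hnb', ← hnb]
    by_cases hxv : x = v
    · subst hxv
      rw [Function.update_self, hl2]
      simp [huv.symm]
    · have hxv' : (x : ℕ) ≠ v := fun h => hxv (Fin.ext h)
      rw [Function.update_of_ne (by omega)]
      by_cases hxu : x = u
      · subst hxu
        rw [Function.update_self, hl1]
        simp [hxv]
      · have hxu' : (x : ℕ) ≠ u := fun h => hxu (Fin.ext h)
        rw [Function.update_of_ne (by omega)]
        simp [hxu, hxv]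
  · convert h using 1
    omega

theorem outDeg_insertArcs_le {nb nb' : Fin n → Finset (Fin n)} {u v : Fin n} (huv : u ≠ v)
    (hnb' : ∀ x y, y ∈ nb' x ↔ y ∈ nb x ∨ (x = u ∧ y = v) ∨ (x = v ∧ y = u))
    (H M : Finset (Fin n)) : outDeg nb' H M ≤ outDeg nb H M + 2 := by
  have h : ∀ x, (nb' x).card ≤ (nb x).card + ((if x = u then 1 else 0) + if x = v then 1 else 0) := by
    intro x
    by_cases hxu : x = u
    · subst hxu
      have : nb' x ⊆ insert v (nb x) := by
        intro y hy
        rcases (hnb' x y).1 hy with h | ⟨-, h⟩ | ⟨h, -⟩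
        · exact Finset.mem_insert_of_mem h
        · exact h ▸ Finset.mem_insert_self _ _
        · exact absurd h huv
      have := (Finset.card_le_card this).trans (Finset.card_insert_le _ _)
      simp [huv, this]
    · by_cases hxv : x = v
      · subst hxv
        have : nb' x ⊆ insert u (nb x) := by
          intro y hy
          rcases (hnb' x y).1 hy with h | ⟨h, -⟩ | ⟨-, h⟩
          · exact Finset.mem_insert_of_mem h
          · exact absurd h hxu
          · exact h ▸ Finset.mem_insert_self _ _
        have := (Finset.card_le_card this).trans (Finset.card_insert_le _ _)
        simp [hxu, this]
      · have : nb' x ⊆ nb x := by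
          intro y hy
          rcases (hnb' x y).1 hy with h | ⟨h, -⟩ | ⟨h, -⟩
          · exact h
          · exact absurd h hxu
          · exact absurd h hxv
        simpa [hxu, hxv] using Finset.card_le_card this
  unfold outDeg
  calc ∑ x ∈ H \ M, (nb' x).card
      ≤ ∑ x ∈ H \ M, ((nb x).card + ((if x = u then 1 else 0) + if x = v then 1 else 0)) :=
        Finset.sum_le_sum fun x _ => h x
    _ ≤ ∑ x ∈ H \ M, (nb x).card + 2 := by
        rw [Finset.sum_add_distrib, Finset.sum_add_distrib, Finset.sum_ite_eq', Finset.sum_ite_eq']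
        split_ifs <;> omega

theorem outDeg_mono {nb nb' : Fin n → Finset (Fin n)} (h : ∀ x, nb' x ⊆ nb x)
    (H M : Finset (Fin n)) : outDeg nb' H M ≤ outDeg nb H M :=
  Finset.sum_le_sum fun x _ => Finset.card_le_card (h x)

/-- Only if both end points are in the set does anything leave it: `v` goes, `u` stays, and the new
edge then dominates `v`. Otherwise at most one counter changes. The degree term concerns `v` alone,
which is why `futureCost` looks at the second end point only. -/
theorem det_localInsert (hw : WordOK n w) (hn : s.var 0 = n) (hR : Rows n s R) {u v : Fin n}
    (hu : s.var 2 = u) (hv : s.var 3 = v) {nb nb' : Fin n → Finset (Fin n)} {H M : Finset (Fin n)}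
    (hrows : ResRows R nb) (hnb : IsNbhd nb H) (hc : Counts s nb H M) (huH : u ∈ H) (hvH : v ∈ H)
    (huv : u ≠ v) (h1 : v ∉ nb u)
    (hnb' : ∀ x y, y ∈ nb' x ↔ y ∈ nb x ∨ (x = u ∧ y = v) ∨ (x = v ∧ y = u)) :
    Det w localInsert s fun t s' => Frame [7, 8, 9, 10] [0, 2, 3, 4] s s' ∧
      (∀ x : Fin n, x ∉ H → s'.arr 0 x = s.arr 0 x) ∧
      (∃ R', Rows n s' R' ∧ (∀ ρ ≤ n, R' ρ = R ρ) ∧ ResRows R' nb') ∧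
      ∃ M', Counts s' nb' H M' ∧
        t + 10 * outDeg nb' H M' ≤ 10 * outDeg nb H M + 30 * (nb v).card + 60 := by
  have h2 : u ∉ nb v := fun h => h1 (hnb.symm _ _ h)
  have hu2 := u.2
  have hv2 := v.2
  -- the counters, before the arcs are inserted
  have key : ∀ t s1, Frame [7, 8, 9, 10] [0] s s1 →
      (∀ x : Fin n, x ∉ H → s1.arr 0 x = s.arr 0 x) → (∃ M', Counts s1 nb' H M' ∧
        t + 10 * outDeg nb H M' ≤ 10 * outDeg nb H M + 30 * (nb v).card + 20) →
      Det w (.seq (rowInsert (hrow (.var 2)) (.var 3)) (rowInsert (hrow (.var 3)) (.var 2))) s1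
        fun t' s' => Frame [7, 8, 9, 10] [0, 2, 3, 4] s s' ∧
      (∀ x : Fin n, x ∉ H → s'.arr 0 x = s.arr 0 x) ∧
      (∃ R', Rows n s' R' ∧ (∀ ρ ≤ n, R' ρ = R ρ) ∧ ResRows R' nb') ∧
      ∃ M', Counts s' nb' H M' ∧
        (t + t' + 1) + 10 * outDeg nb' H M' ≤ 10 * outDeg nb H M + 30 * (nb v).card + 60 := by
    rintro t s1 hf hoff ⟨M', hM', ht⟩
    refine (det_insertArcs hw ((hf.1 0 (by simp)).trans hn) (hR.frame hf (by simp))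
      ((hf.1 2 (by simp)).trans hu) ((hf.1 3 (by simp)).trans hv) hrows huv h1 h2 hnb').mono ?_
    rintro t' s' ⟨rfl, hf', hR'⟩
    have h0 := hf'.2 0 (by simp)
    refine ⟨(hf.mono (by simp) (by simp)).trans (hf'.mono (by simp) (by simp)), ?_, hR', M',
      ⟨hM'.sub, ?_, ?_⟩, ?_⟩
    · rw [h0]; exact hoff
    · rw [h0]; exact hM'.out
    · rw [h0]; exact hM'.mem_iff
    · have := outDeg_insertArcs_le huv hnb' H M'
      omega
  have hadd : ∀ a ≤ 2 * n, ∀ s1 : Store, ∀ {x : ℕ} {y : Fin n}, s1.var x = y → s1.arr 0 y = a →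
      (Expr.add (.get 0 (.var x)) (.lit 1)).eval w s1 = a + 1 := fun a ha s1 x y h h' =>
    eval_add ((eval_get_var h).trans h') (eval_lit hw.one_lt) (hw.lt (by omega))
  -- neighbourhoods after the insertion
  have hcount : ∀ (M' : Finset (Fin n)) x, (nb' x ∩ M').card = (nb x ∩ M').card +
      if (x = u ∧ v ∈ M') ∨ (x = v ∧ u ∈ M') then 1 else 0 := by
    intro M' x
    by_cases hxu : x = u
    · subst hxu
      have : nb' x = insert v (nb x) := by
        ext y
        rw [hnb', Finset.mem_insert]
        simp [huv, or_comm]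
      rw [this]
      by_cases hvM : v ∈ M'
      · rw [Finset.insert_inter_of_mem hvM, Finset.card_insert_of_notMem (by simp [h1])]
        simp [hvM]
      · rw [Finset.insert_inter_of_notMem hvM]
        simp [hvM, huv]
    · by_cases hxv : x = v
      · subst hxv
        have : nb' x = insert u (nb x) := by
          ext y
          rw [hnb', Finset.mem_insert]
          simp [hxu, or_comm]
        rw [this]
        by_cases huM : u ∈ M'
        · rw [Finset.insert_inter_of_mem huM, Finset.card_insert_of_notMem (by simp [h2])]
          simp [huM]
        · rw [Finset.insert_inter_of_notMem huM]
          simp [huM, hxu]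
      · have : nb' x = nb x := by
          ext y
          rw [hnb']
          simp [hxu, hxv]
        simp [this, hxu, hxv]
  have huM := hc.mem_iff u huH
  have hvM := hc.mem_iff v hvH
  refine Det.seq (Det.ite ?_ ?_)
  · intro h
    rw [eval_get_var hu] at h
    have huM' : u ∉ M := fun h' => h (huM.1 h')
    refine Det.ite ?_ ?_
    · intro h'
      rw [eval_get_var hv] at h'
      have hvM' : v ∉ M := fun h'' => h' (hvM.1 h'')
      refine Det.skip (key _ s (Frame.refl _ _ s) (fun _ _ => rfl) ⟨M, ⟨hc.sub, ?_, hc.mem_iff⟩, ?_⟩)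
      · intro x hx
        rw [hcount, hc.out x hx]
        simp [huM', hvM']
      · omega
    · intro h'
      rw [eval_get_var hv] at h'
      have hvM' : v ∈ M := hvM.2 h'
      refine Det.store ?_
      rw [hadd _ (by have := hc.card_lt huH; omega) s hu rfl, show (Expr.var 2).eval w s = u from hu]
      refine key _ _ ((Frame.refl _ _ s).setArr (by simp) _ _) ?_ ⟨M, ⟨hc.sub, ?_, ?_⟩, ?_⟩
      · intro x hx
        have : (x : ℕ) ≠ u := fun h => hx (Fin.ext h ▸ huH)
        simp [this]
      · intro x hx
        rw [hcount, ← hc.out x hx]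
        by_cases hxu : x = u
        · subst hxu
          simp [hvM']
        · have : (x : ℕ) ≠ u := fun h => hxu (Fin.ext h)
          simp [this, hxu, huM']
      · intro x hx
        rw [hc.mem_iff x hx]
        by_cases hxu : x = u
        · subst hxu
          simp [h]
        · have : (x : ℕ) ≠ u := fun h => hxu (Fin.ext h)
          simp [this]
      · omega
  · intro h
    rw [eval_get_var hu] at h
    have huM' : u ∈ M := huM.2 h
    -- afterwards the counter of `v` is increased
    have key2 : ∀ t s1, Frame [7, 8, 9, 10] [0] s s1 →
        (∀ x : Fin n, x ∉ H → s1.arr 0 x = s.arr 0 x) → (∃ M', u ∈ M' ∧ v ∉ M' ∧ M' ⊆ H ∧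
          (∀ x ∈ H, s1.arr 0 x = (nb x ∩ M').card) ∧
          (∀ x ∈ H, x ≠ v → (x ∈ M' ↔ s1.arr 0 x = 0)) ∧
          t + 10 * outDeg nb H M' ≤ 10 * outDeg nb H M + 30 * (nb v).card + 10) →
        Det w (incr (.var 3)) s1 fun t' s' => Det w
          (.seq (rowInsert (hrow (.var 2)) (.var 3)) (rowInsert (hrow (.var 3)) (.var 2))) s'
          fun t'' s' => Frame [7, 8, 9, 10] [0, 2, 3, 4] s s' ∧
            (∀ x : Fin n, x ∉ H → s'.arr 0 x = s.arr 0 x) ∧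
            (∃ R', Rows n s' R' ∧ (∀ ρ ≤ n, R' ρ = R ρ) ∧ ResRows R' nb') ∧
            ∃ M', Counts s' nb' H M' ∧ (t + t' + 3 + t'' + 1) + 10 * outDeg nb' H M' ≤
              10 * outDeg nb H M + 30 * (nb v).card + 60 := by
      rintro t s1 hf hoff ⟨M', hu', hv', hsub, hout, hmem, ht⟩
      have hv1 := (hf.1 3 (by simp)).trans hv
      refine Det.store ?_
      have hle : s1.arr 0 v ≤ n := by
        rw [hout v hvH]
        exact (Finset.card_le_univ _).trans (by simp)
      rw [hadd _ (by omega) s1 hv1 rfl, show (Expr.var 3).eval w s1 = v from hv1]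
      refine key (t + 1 + 3) _ (hf.setArr (by simp) _ _) ?_ ⟨M', ⟨hsub, ?_, ?_⟩, by omega⟩
      · intro x hx
        have : (x : ℕ) ≠ v := fun h => hx (Fin.ext h ▸ hvH)
        simp [this, hoff x hx]
      · intro x hx
        rw [hcount, ← hout x hx]
        by_cases hxv : x = v
        · subst hxv
          simp [hu']
        · have : (x : ℕ) ≠ v := fun h => hxv (Fin.ext h)
          simp [this, hxv, hv']
      · intro x hx
        by_cases hxv : x = v
        · subst hxv
          simp [hv']
        · have : (x : ℕ) ≠ v := fun h => hxv (Fin.ext h)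
          simp [this, hmem x hx hxv]
    refine Det.seq (Det.ite ?_ ?_)
    · intro h'
      rw [eval_get_var hv] at h'
      have hvM' : v ∉ M := fun h'' => h' (hvM.1 h'')
      refine Det.skip ((key2 1 s (Frame.refl _ _ s) (fun _ _ => rfl) ⟨M, huM', hvM', hc.sub, hc.out,
        fun x hx _ => hc.mem_iff x hx, by omega⟩).mono fun t' s' h => h.mono fun t'' s'' h => ?_)
      obtain ⟨h1, h2, h3, M', h4, h5⟩ := h
      exact ⟨h1, h2, h3, M', h4, by omega⟩
    · intro h'
      rw [eval_get_var hv] at h'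
      refine (det_leaveVertex hw hn hR hv hrows hnb.symm hnb.sub hnb.irrefl hc hvH h').mono ?_
      rintro t s1 ⟨hf, hoff, M', hMM', hvM', hsub, hout, hmem, ht⟩
      refine (key2 t s1 hf hoff ⟨M', hMM' (Finset.mem_erase.2 ⟨huv, huM'⟩), hvM', hsub, hout, hmem,
        by omega⟩).mono fun t' s' h => h.mono fun t'' s'' h => ?_
      obtain ⟨h1, h2, h3, M', h4, h5⟩ := h
      exact ⟨h1, h2, h3, M', h4, by omega⟩

/-- A neighbour of `x` in the independent set is gone. -/
theorem det_release (hw : WordOK n w) (hn : s.var 0 = n) (hR : Rows n s R) {i : ℕ} {x : Fin n}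
    (hx : s.var i = x) (hi : i ∉ [7, 8, 9, 10]) {nb : Fin n → Finset (Fin n)}
    {H M : Finset (Fin n)} (hrows : ResRows R nb) (hnb : IsNbhd nb H) (hxH : x ∈ H) (hxM : x ∉ M)
    (hsub : M ⊆ H) (hout : ∀ y ∈ H, s.arr 0 y = (nb y ∩ M).card + if y = x then 1 else 0)
    (hmem : ∀ y ∈ H, y ∈ M ↔ s.arr 0 y = 0) :
    Det w (release (.var i)) s fun t s' => Frame [7, 8, 9, 10] [0] s s' ∧
      (∀ y : Fin n, y ∉ H → s'.arr 0 y = s.arr 0 y) ∧ ∃ M', Counts s' nb H M' ∧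
        t + 10 * outDeg nb H M' ≤ 10 * outDeg nb H M + 20 := by
  refine Det.seq (Det.store ?_)
  have e1 : (Expr.var i).eval w s = x := hx
  have hox : s.arr 0 x = (nb x ∩ M).card + 1 := by rw [hout x hxH, if_pos rfl]
  have e2 : (Expr.sub (.get 0 (.var i)) (.lit 1)).eval w s = (nb x ∩ M).card := by
    rw [Expr.eval, eval_lit hw.one_lt, eval_get_var hx, hox]
    rfl
  rw [e1, e2]
  have hf1 : Frame [7, 8, 9, 10] [0] s (s.setArr 0 x (nb x ∩ M).card) :=
    (Frame.refl _ _ s).setArr (by simp) _ _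
  have ho1 : ∀ y : Fin n, (s.setArr 0 x (nb x ∩ M).card).arr 0 y =
      if y = x then (nb x ∩ M).card else s.arr 0 y := by
    intro y
    simp [Fin.ext_iff]
  generalize s.setArr 0 x (nb x ∩ M).card = s1 at *
  have hx1 : s1.var i = x := (hf1.1 i hi).trans hx
  have hout1 : ∀ y ∈ H, s1.arr 0 y = (nb y ∩ M).card := by
    intro y hy
    rw [ho1]
    by_cases hyx : y = x
    · rw [if_pos hyx, hyx]
    · rw [if_neg hyx, hout y hy, if_neg hyx, add_zero]
  have hoff1 : ∀ y : Fin n, y ∉ H → s1.arr 0 y = s.arr 0 y := fun y hy => by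
    rw [ho1, if_neg (by rintro rfl; exact hy hxH)]
  refine Det.ite ?_ ?_
  · intro h
    rw [eval_get_var hx1, ho1, if_pos rfl] at h
    refine Det.skip ⟨hf1, hoff1, M, ⟨hsub, hout1, ?_⟩, by omega⟩
    intro y hy
    by_cases hyx : y = x
    · subst hyx
      rw [hout1 y hy]
      simp [hxM, h]
    · rw [hmem y hy, ho1, if_neg hyx]
  · intro h
    rw [eval_get_var hx1, ho1, if_pos rfl] at h
    have h0 := Finset.card_eq_zero.1 h
    refine Det.seq (Det.assign ?_)
    rw [show (Expr.var i).eval w s1 = x from hx1]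
    have hn1 : (s1.setVar 9 x).var 0 = n := (hf1.1 0 (by simp)).trans hn
    have hR1 : Rows n (s1.setVar 9 x) R := hR.frame (hf1.setVar (x := 9) (by simp) _) (by simp)
    refine (det_joinVertex hw hn1 hR1 (x := x) (by simp) ?_).mono ?_
    · intro y hy
      rw [Store.setVar_arr, hout1 y (hnb.sub x ((hrows x y).1 hy))]
      have : (nb y ∩ M).card ≤ n := (Finset.card_le_univ _).trans (by simp)
      omega
    rintro t s2 ⟨ht, hf2, ho2⟩
    rw [hrows.length_eq hR1] at ht
    rw [Store.setVar_arr] at ho2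
    have hout2 : ∀ y ∈ H, s2.arr 0 y = (nb y ∩ insert x M).card := by
      intro y hy
      rw [ho2, hout1 y hy]
      by_cases hyx : y ∈ nb x
      · rw [Finset.inter_insert_of_mem (hnb.symm _ _ hyx), Finset.card_insert_of_notMem
          (by simp [hxM]), if_pos ((hrows x y).2 hyx)]
      · rw [Finset.inter_insert_of_notMem fun h => hyx (hnb.symm _ _ h),
          if_neg fun h => hyx ((hrows x y).1 h), add_zero]
    refine ⟨(hf1.setVar (x := 9) (by simp) _).trans (hf2.mono (by simp) (by simp)), ?_, insert x M,
      ⟨Finset.insert_subset hxH hsub, hout2, ?_⟩, ?_⟩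
    · intro y hy
      rw [ho2, if_neg fun h => hy (hnb.sub x ((hrows x y).1 h)), add_zero, hoff1 y hy]
    · intro y hy
      by_cases hyx : y = x
      · subst hyx
        rw [hout2 y hy, Finset.inter_insert_of_notMem (hnb.irrefl y), h0]
        simp
      · rw [Finset.mem_insert, or_iff_right hyx, hmem y hy, hout y hy, if_neg hyx, add_zero,
          hout2 y hy]
        by_cases hyn : y ∈ nb x
        · rw [Finset.inter_insert_of_mem (hnb.symm _ _ hyn), Finset.card_insert_of_notMem
            (by simp [hxM])]
          have hyM : y ∉ M := fun h => by
            have : y ∈ nb x ∩ M := Finset.mem_inter.2 ⟨hyn, h⟩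
            rw [h0] at this
            simp at this
          rw [hmem y hy, hout y hy, if_neg hyx, add_zero] at hyM
          simpa using hyM
        · rw [Finset.inter_insert_of_notMem fun h => hyn (hnb.symm _ _ h)]
    · have := outDeg_insert nb hxH hxM
      omega

/-- By independence at most one end point is in the set. The other one then loses a dominator and
may join, which the potential pays for; hence the amortized cost is constant. -/
theorem det_localDelete (hw : WordOK n w) (hn : s.var 0 = n) (hR : Rows n s R) {u v : Fin n}
    (hu : s.var 2 = u) (hv : s.var 3 = v) {nb nb' : Fin n → Finset (Fin n)} {H M : Finset (Fin n)}
    (hrows : ResRows R nb) (hnb : IsNbhd nb H) (hc : Counts s nb H M) (huH : u ∈ H) (hvH : v ∈ H)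
    (huv : u ≠ v) (h1 : v ∈ nb u)
    (hnb' : ∀ x y, y ∈ nb' x ↔ y ∈ nb x ∧ ¬ (x = u ∧ y = v) ∧ ¬ (x = v ∧ y = u)) :
    Det w localDelete s fun t s' => Frame [7, 8, 9, 10] [0, 2, 3, 4] s s' ∧
      (∀ x : Fin n, x ∉ H → s'.arr 0 x = s.arr 0 x) ∧
      (∃ R', Rows n s' R' ∧ (∀ ρ ≤ n, R' ρ = R ρ) ∧ ResRows R' nb') ∧
      ∃ M', Counts s' nb' H M' ∧ t + 10 * outDeg nb' H M' ≤ 10 * outDeg nb H M + 60 := by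
  have h2 : u ∈ nb v := hnb.symm _ _ h1
  have hsub' : ∀ x, nb' x ⊆ nb x := fun x y hy => ((hnb' x y).1 hy).1
  have hnb2 : IsNbhd nb' H := by
    refine ⟨fun x y h => ?_, fun x => (hsub' x).trans (hnb.sub x), fun x h => hnb.irrefl x (hsub' x h)⟩
    rw [hnb'] at h ⊢
    exact ⟨hnb.symm _ _ h.1, fun h' => h.2.2 h'.symm, fun h' => h.2.1 h'.symm⟩
  have hcount : ∀ x, (nb x ∩ M).card = (nb' x ∩ M).card +
      if (x = u ∧ v ∈ M) ∨ (x = v ∧ u ∈ M) then 1 else 0 := by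
    intro x
    by_cases hxu : x = u
    · subst hxu
      have : nb x = insert v (nb' x) := by
        ext y
        rw [Finset.mem_insert, hnb']
        by_cases hy : y = v
        · simp [hy, h1]
        · simp [hy, huv]
      rw [this]
      by_cases hvM : v ∈ M
      · rw [Finset.insert_inter_of_mem hvM, Finset.card_insert_of_notMem (by simp [hnb'])]
        simp [hvM]
      · rw [Finset.insert_inter_of_notMem hvM]
        simp [hvM, huv]
    · by_cases hxv : x = v
      · subst hxv
        have : nb x = insert u (nb' x) := by
          ext y
          rw [Finset.mem_insert, hnb']
          by_cases hy : y = u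
          · simp [hy, h2]
          · simp [hy, hxu]
        rw [this]
        by_cases huM : u ∈ M
        · rw [Finset.insert_inter_of_mem huM, Finset.card_insert_of_notMem (by simp [hnb'])]
          simp [huM]
        · rw [Finset.insert_inter_of_notMem huM]
          simp [huM, hxu]
      · have : nb' x = nb x := by
          ext y
          rw [hnb']
          simp [hxu, hxv]
        simp [this, hxu, hxv]
  have huM := hc.mem_iff u huH
  have hvM := hc.mem_iff v hvH
  refine det_eraseArcs hw hn hR hu hv hrows huv h1 h2 hnb' fun s1 hf1 R1 hR1 hRn1 hres1 => ?_
  have h01 := hf1.2 0 (by simp)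
  have hn1 := (hf1.1 0 (by simp)).trans hn
  have hu1 := (hf1.1 2 (by simp)).trans hu
  have hv1 := (hf1.1 3 (by simp)).trans hv
  have hmono := outDeg_mono hsub' H M
  -- the release of one of the end points
  have key : ∀ (i : ℕ) (x : Fin n), s1.var i = x → i ∉ [7, 8, 9, 10] → x ∈ H → x ∉ M →
      (∀ y, ((y = u ∧ v ∈ M) ∨ (y = v ∧ u ∈ M)) ↔ y = x) →
      Det w (release (.var i)) s1 fun t s' => Frame [7, 8, 9, 10] [0, 2, 3, 4] s s' ∧
      (∀ x : Fin n, x ∉ H → s'.arr 0 x = s.arr 0 x) ∧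
      (∃ R', Rows n s' R' ∧ (∀ ρ ≤ n, R' ρ = R ρ) ∧ ResRows R' nb') ∧
      ∃ M', Counts s' nb' H M' ∧ t + 20 + 10 * outDeg nb' H M' ≤ 10 * outDeg nb H M + 60 := by
    intro i x hx hi hxH hxM hiff
    refine (det_release hw hn1 hR1 hx hi hres1 hnb2 hxH hxM hc.sub ?_ ?_).mono ?_
    · intro y hy
      rw [h01, hc.out y hy, hcount y]
      simp only [hiff]
    · rw [h01]
      exact hc.mem_iff
    · rintro t s2 ⟨hf2, hoff2, M', hM', ht⟩
      refine ⟨(hf1.mono (by simp) (by simp)).trans (hf2.mono (by simp) (by simp)), ?_,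
        ⟨R1, hR1.frame hf2 (by simp), hRn1, hres1⟩, M', hM', by omega⟩
      rw [h01] at hoff2
      exact hoff2
  refine Det.ite ?_ ?_
  · intro h
    rw [eval_get_var hu1, h01] at h
    have huM' : u ∉ M := fun h' => h (huM.1 h')
    refine Det.ite ?_ ?_
    · intro h'
      rw [eval_get_var hv1, h01] at h'
      have hvM' : v ∉ M := fun h'' => h' (hvM.1 h'')
      refine Det.skip ⟨hf1.mono (by simp) (by simp), fun x _ => by rw [h01], ⟨R1, hR1, hRn1, hres1⟩,
        M, ⟨hc.sub, fun x hx => ?_, by rw [h01]; exact hc.mem_iff⟩, by omega⟩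
      rw [h01, hc.out x hx, hcount x]
      simp [huM', hvM']
    · intro h'
      rw [eval_get_var hv1, h01] at h'
      refine (key 2 u hu1 (by simp) huH huM' fun y => ?_).mono ?_
      · simp [huM', hvM.2 h']
      · rintro t s' ⟨e1, e2, e3, M', e4, e5⟩
        exact ⟨e1, e2, e3, M', e4, by omega⟩
  · intro h
    rw [eval_get_var hu1, h01] at h
    have huM' : u ∈ M := huM.2 h
    have hvM' : v ∉ M := by
      intro hvM'
      have : v ∈ nb u ∩ M := Finset.mem_inter.2 ⟨h1, hvM'⟩
      have h0 := hc.out u huH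
      rw [h, eq_comm, Finset.card_eq_zero] at h0
      rw [h0] at this
      simp at this
    refine (key 3 v hv1 (by simp) hvH hvM' fun y => ?_).mono ?_
    · simp [huM', hvM']
    · rintro t s' ⟨e1, e2, e3, M', e4, e5⟩
      exact ⟨e1, e2, e3, M', e4, by omega⟩

end LocalUpdate

/-! ## Updating the graph -/

/-- The first end point of the edge that is updated. -/
def Update.fst {n : ℕ} : Update n → Fin n
  | .insert u _ => u
  | .delete u _ => u

/-- The second end point of the edge that is updated. -/
def Update.snd {n : ℕ} : Update n → Fin n
  | .insert _ v => v
  | .delete _ v => v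

/-- The code of the kind of an update. -/
def Update.kind {n : ℕ} : Update n → ℕ
  | .insert _ _ => 1
  | .delete _ _ => 0

/-- Insertion of the edge between the vertices in the variables `2` and `3`. -/
def insertEdge : Stmt :=
  .seq (rowInsert (.var 2) (.var 3)) (.seq (rowInsert (.var 3) (.var 2))
    (.seq (.assign 6 (.add (.var 6) (.lit 1)))
      (.seq (.ite (.eq (.get 2 (.var 2)) (.lit 1)) (rowInsert (.var 0) (.var 2)) .skip)
        (.ite (.eq (.get 2 (.var 3)) (.lit 1)) (rowInsert (.var 0) (.var 3)) .skip))))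

/-- Deletion of the edge between the vertices in the variables `2` and `3`. -/
def deleteEdge : Stmt :=
  .seq (rowErase (.var 2) (.var 3)) (.seq (rowErase (.var 3) (.var 2))
    (.seq (.assign 6 (.sub (.var 6) (.lit 1)))
      (.seq (.ite (.get 2 (.var 2)) .skip (rowErase (.var 0) (.var 2)))
        (.ite (.get 2 (.var 3)) .skip (rowErase (.var 0) (.var 3))))))

/-- Update the graph and the number of its edges. -/
def updateGraph : Stmt := .ite (.var 1) insertEdge deleteEdge

section UpdateGraph
variable {n w : ℕ} {s : Store} {R : ℕ → List (Fin n)} {G : SimpleGraph (Fin n)}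

theorem insert_adj {u v : Fin n} (huv : u ≠ v) (x y : Fin n) :
    ((Update.insert u v).apply G).Adj x y ↔ G.Adj x y ∨ (x = u ∧ y = v) ∨ (x = v ∧ y = u) := by
  simp only [Update.apply, SimpleGraph.sup_adj, SimpleGraph.fromEdgeSet_adj, Set.mem_singleton_iff,
    Sym2.eq_iff]
  constructor
  · rintro (h | ⟨h, -⟩)
    · exact Or.inl h
    · exact Or.inr h
  · rintro (h | h)
    · exact Or.inl h
    · refine Or.inr ⟨h, ?_⟩
      rintro rfl
      rcases h with ⟨rfl, rfl⟩ | ⟨rfl, rfl⟩ <;> exact huv rfl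

theorem delete_adj (u v : Fin n) (x y : Fin n) :
    ((Update.delete u v).apply G).Adj x y ↔
      G.Adj x y ∧ ¬ (x = u ∧ y = v) ∧ ¬ (x = v ∧ y = u) := by
  simp only [Update.apply, SimpleGraph.sdiff_adj, SimpleGraph.fromEdgeSet_adj,
    Set.mem_singleton_iff, Sym2.eq_iff]
  constructor
  · rintro ⟨h, h'⟩
    exact ⟨h, fun h2 => h' ⟨Or.inl h2, h.ne⟩, fun h2 => h' ⟨Or.inr h2, h.ne⟩⟩
  · rintro ⟨h, h'⟩
    exact ⟨h, fun h2 => (not_or.2 h') h2.1⟩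

theorem ncard_insert {u v : Fin n} (h : (Update.insert u v).Valid G) :
    ((Update.insert u v).apply G).edgeSet.ncard = G.edgeSet.ncard + 1 := by
  have : ((Update.insert u v).apply G).edgeSet = insert s(u, v) G.edgeSet := by
    ext e
    induction e with
    | h x y =>
      rw [SimpleGraph.mem_edgeSet, insert_adj h.1, Set.mem_insert_iff, SimpleGraph.mem_edgeSet,
        Sym2.eq_iff, or_comm]
  rw [this, Set.ncard_insert_of_notMem (by simpa using h.2)]

theorem ncard_delete {u v : Fin n} (h : (Update.delete u v).Valid G) :
    ((Update.delete u v).apply G).edgeSet.ncard = G.edgeSet.ncard - 1 := by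
  have : ((Update.delete u v).apply G).edgeSet = G.edgeSet \ {s(u, v)} := by
    ext e
    induction e with
    | h x y =>
      rw [SimpleGraph.mem_edgeSet, delete_adj, Set.mem_sdiff, Set.mem_singleton_iff,
        SimpleGraph.mem_edgeSet, Sym2.eq_iff, not_or]
  rw [this, Set.ncard_sdiff_singleton_of_mem (show s(u, v) ∈ G.edgeSet from h)]

theorem ncard_le_mul_self (G : SimpleGraph (Fin n)) : G.edgeSet.ncard ≤ n * n := by
  classical
  rw [Set.ncard_eq_toFinset_card', Set.toFinset_card, ← SimpleGraph.edgeFinset_card]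
  have := G.sum_degrees_eq_twice_card_edges
  have h2 : ∑ v, G.degree v ≤ ∑ _v : Fin n, n :=
    Finset.sum_le_sum fun v _ => (G.degree_lt_card_verts v).le.trans (by simp)
  simp only [Finset.sum_const, Finset.card_univ, Fintype.card_fin, smul_eq_mul] at h2
  omega

/-- Run just after the row of `x` grew: degree `1` means that `x` was isolated until now. The
analogue for deletions tests for degree `0`. -/
theorem det_ite_rowInsert (hw : WordOK n w) (hn : s.var 0 = n) (hR : Rows n s R) {i : ℕ} {x : Fin n}
    (hx : s.var i = x) (h : (R x).length = 1 → x ∉ R n) :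
    Det w (.ite (.eq (.get 2 (.var i)) (.lit 1)) (rowInsert (.var 0) (.var i)) .skip) s
      fun t s' => t ≤ 6 ∧ Frame [] [2, 3, 4] s s' ∧ ∃ l,
        (∀ y, y ∈ l ↔ y ∈ R n ∨ (y = x ∧ (R x).length = 1)) ∧
          Rows n s' (Function.update R n l) := by
  have hx2 := x.2
  have heq : (Expr.eq (.get 2 (.var i)) (.lit 1)).eval w s ≠ 0 ↔ (R x).length = 1 :=
    eval_eq_ne_zero hw.one_lt ((eval_get_var hx).trans (hR x (by omega)).2.1) (eval_lit hw.one_lt)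
  refine Det.ite ?_ ?_
  · intro h1
    rw [heq] at h1
    refine (det_rowInsert hw hn hR (Ev.var hn) (Ev.var hx) (by omega) (h h1)).mono ?_
    rintro t s' ⟨rfl, hf, hR'⟩
    exact ⟨by omega, hf, _, by simp [h1], hR'⟩
  · intro h1
    have h1' : ¬ (R x).length = 1 := fun h => heq.2 h h1
    exact Det.skip ⟨by omega, Frame.refl _ _ _, R n, by simp [h1'], by
      rwa [Function.update_eq_self]⟩

theorem det_ite_rowErase (hw : WordOK n w) (hn : s.var 0 = n) (hR : Rows n s R) {i : ℕ} {x : Fin n}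
    (hx : s.var i = x) (h : x ∈ R n) :
    Det w (.ite (.get 2 (.var i)) .skip (rowErase (.var 0) (.var i))) s
      fun t s' => t ≤ 6 ∧ Frame [] [2, 3, 4] s s' ∧ ∃ l,
        (∀ y, y ∈ l ↔ y ∈ R n ∧ (y = x → R x ≠ [])) ∧
          Rows n s' (Function.update R n l) := by
  have hx2 := x.2
  have heq : (Expr.get 2 (.var i)).eval w s = (R x).length :=
    (eval_get_var hx).trans (hR x (by omega)).2.1
  refine Det.ite ?_ ?_
  · intro h1
    rw [heq] at h1
    have h1' : R x ≠ [] := fun h => h1 (by simp [h])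
    exact Det.skip ⟨by omega, Frame.refl _ _ _, R n, by simp [h1'], by
      rwa [Function.update_eq_self]⟩
  · intro h1
    rw [heq, List.length_eq_zero_iff] at h1
    refine (det_rowErase hw hn hR (Ev.var hn) (Ev.var hx) (by omega) h).mono ?_
    rintro t s' ⟨rfl, hf, l, hl, hR'⟩
    exact ⟨by omega, hf, l, fun y => by rw [hl]; simp [h1], hR'⟩

theorem det_insertEdge (hw : WordOK n w) (hn : s.var 0 = n) (hR : Rows n s R) (hG : GraphRows G R)
    {u v : Fin n} (hu : s.var 2 = u) (hv : s.var 3 = v) (hm : s.var 6 = G.edgeSet.ncard)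
    (hval : (Update.insert u v).Valid G) :
    Det w insertEdge s fun t s' => t ≤ 30 ∧ Frame [6] [2, 3, 4] s s' ∧
      s'.var 6 = ((Update.insert u v).apply G).edgeSet.ncard ∧ ∃ R', Rows n s' R' ∧
        GraphRows ((Update.insert u v).apply G) R' ∧
        ∀ x : Fin n, R' (n + 1 + x) = R (n + 1 + x) := by
  have hu2 := u.2
  have hv2 := v.2
  have huv : u ≠ v := hval.1
  have hnadj : ¬ G.Adj u v := hval.2
  have huv' : (u : ℕ) ≠ v := fun h => huv (Fin.ext h)
  refine Det.seq ((det_rowInsert hw hn hR (Ev.var hu) (Ev.var hv) (by omega)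
    (by rwa [hG.1])).mono ?_)
  rintro t s1 ⟨rfl, hf1, hR1⟩
  have hn1 := (hf1.1 0 (by simp)).trans hn
  have hu1 := (hf1.1 2 (by simp)).trans hu
  have hv1 := (hf1.1 3 (by simp)).trans hv
  refine Det.seq ((det_rowInsert hw hn1 hR1 (Ev.var hv1) (Ev.var hu1) (by omega) ?_).mono ?_)
  · rw [Function.update_of_ne (by omega), hG.1]
    exact fun h => hnadj h.symm
  rintro t s2 ⟨rfl, hf2, hR2⟩
  rw [Function.update_of_ne (show (v : ℕ) ≠ u by omega)] at hR2
  have hf12 := hf1.trans hf2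
  have hm2 := (hf12.1 6 (by simp)).trans hm
  refine Det.seq (Det.assign ?_)
  have hle := ncard_le_mul_self G
  rw [eval_add (a := G.edgeSet.ncard) (b := 1) (e := .var 6) hm2 (eval_lit hw.one_lt)
    (by unfold WordOK at hw; nlinarith)]
  set s3 := s2.setVar 6 (G.edgeSet.ncard + 1) with hs3
  have hf3 : Frame [6] [2, 3, 4] s s3 := (hf12.mono (by simp) (by simp)).setVar (by simp) _
  set R2 := Function.update (Function.update R u (R u ++ [v])) v (R v ++ [u]) with hR2def
  have hR3 : Rows n s3 R2 := hR2.congr rfl rfl rfl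
  have hR2n : R2 n = R n := by
    rw [hR2def, Function.update_of_ne (by omega), Function.update_of_ne (by omega)]
  have hR2u : R2 u = R u ++ [v] := by
    rw [hR2def, Function.update_of_ne (by omega), Function.update_self]
  have hR2v : R2 v = R v ++ [u] := by rw [hR2def, Function.update_self]
  have hn3 := (hf3.1 0 (by simp)).trans hn
  have hiso : ∀ x : Fin n, R x = [] → x ∉ R n := by
    intro x hx hx'
    rw [hG.2, mem_nonisolated] at hx'
    obtain ⟨y, hy⟩ := hx'
    rw [← hG.1, hx] at hy
    simp at hy
  refine Det.seq ((det_ite_rowInsert hw hn3 hR3 (x := u) ((hf3.1 2 (by simp)).trans hu) ?_).mono ?_)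
  · rw [hR2u, hR2n]
    intro h
    exact hiso u (by simpa using h)
  rintro t4 s4 ⟨ht4, hf4, l4, hl4, hR4⟩
  have hn4 := (hf4.1 0 (by simp)).trans hn3
  refine (det_ite_rowInsert hw hn4 hR4 (x := v)
    ((hf4.1 3 (by simp)).trans ((hf3.1 3 (by simp)).trans hv)) ?_).mono ?_
  · rw [Function.update_of_ne (by omega), Function.update_self, hR2v, hl4, hR2n]
    rintro h (h' | h')
    · exact hiso v (by simpa using h) h'
    · exact huv h'.1.symm
  rintro t5 s5 ⟨ht5, hf5, l5, hl5, hR5⟩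
  rw [Function.update_self, Function.update_of_ne (by omega), hR2v] at hl5
  refine ⟨by omega, hf3.trans ((hf4.trans hf5).mono (by simp) (by simp)), ?_, _, hR5, ⟨?_, ?_⟩, ?_⟩
  · rw [hf5.1 6 (by simp), hf4.1 6 (by simp), ncard_insert hval, hs3]
    simp
  · intro x y
    have hx2 := x.2
    rw [Function.update_of_ne (by omega), Function.update_of_ne (by omega), insert_adj huv,
      ← hG.1]
    by_cases hxv : x = v
    · subst hxv
      rw [hR2v]
      simp [huv.symm]
    · have hxv' : (x : ℕ) ≠ v := fun h => hxv (Fin.ext h)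
      rw [hR2def, Function.update_of_ne (by omega)]
      by_cases hxu : x = u
      · subst hxu
        rw [Function.update_self]
        simp [hxv]
      · have hxu' : (x : ℕ) ≠ u := fun h => hxu (Fin.ext h)
        rw [Function.update_of_ne (by omega)]
        simp [hxu, hxv]
  · intro x
    rw [Function.update_self, hl5, hl4, hR2n, hR2u, hG.2, mem_nonisolated, mem_nonisolated]
    simp only [insert_adj huv, List.length_append, List.length_singleton, Nat.add_eq_right,
      List.length_eq_zero_iff]
    have hmem : ∀ z : Fin n, R z ≠ [] → ∃ y, G.Adj z y := by
      intro z hz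
      obtain ⟨y, hy⟩ := List.exists_mem_of_ne_nil _ hz
      exact ⟨y, (hG.1 z y).1 hy⟩
    constructor
    · rintro ((⟨y, hy⟩ | ⟨rfl, -⟩) | ⟨rfl, -⟩)
      · exact ⟨y, Or.inl hy⟩
      · exact ⟨v, Or.inr (Or.inl ⟨rfl, rfl⟩)⟩
      · exact ⟨u, Or.inr (Or.inr ⟨rfl, rfl⟩)⟩
    · rintro ⟨y, h | ⟨rfl, rfl⟩ | ⟨rfl, rfl⟩⟩
      · exact Or.inl (Or.inl ⟨y, h⟩)
      · by_cases h : R x = []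
        · exact Or.inl (Or.inr ⟨rfl, h⟩)
        · exact Or.inl (Or.inl (hmem x h))
      · by_cases h : R x = []
        · exact Or.inr ⟨rfl, h⟩
        · exact Or.inl (Or.inl (hmem x h))
  · intro x
    rw [Function.update_of_ne (by omega), Function.update_of_ne (by omega), hR2def,
      Function.update_of_ne (by omega), Function.update_of_ne (by omega)]

theorem det_deleteEdge (hw : WordOK n w) (hn : s.var 0 = n) (hR : Rows n s R) (hG : GraphRows G R)
    {u v : Fin n} (hu : s.var 2 = u) (hv : s.var 3 = v) (hm : s.var 6 = G.edgeSet.ncard)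
    (hval : (Update.delete u v).Valid G) :
    Det w deleteEdge s fun t s' => t ≤ 30 ∧ Frame [6] [2, 3, 4] s s' ∧
      s'.var 6 = ((Update.delete u v).apply G).edgeSet.ncard ∧ ∃ R', Rows n s' R' ∧
        GraphRows ((Update.delete u v).apply G) R' ∧
        ∀ x : Fin n, R' (n + 1 + x) = R (n + 1 + x) := by
  have hu2 := u.2
  have hv2 := v.2
  have hadj : G.Adj u v := hval
  have huv : u ≠ v := hadj.ne
  have huv' : (u : ℕ) ≠ v := fun h => huv (Fin.ext h)
  refine Det.seq ((det_rowErase hw hn hR (Ev.var hu) (Ev.var hv) (by omega)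
    (by rwa [hG.1])).mono ?_)
  rintro t s1 ⟨rfl, hf1, l1, hl1, hR1⟩
  have hn1 := (hf1.1 0 (by simp)).trans hn
  have hu1 := (hf1.1 2 (by simp)).trans hu
  have hv1 := (hf1.1 3 (by simp)).trans hv
  refine Det.seq ((det_rowErase hw hn1 hR1 (Ev.var hv1) (Ev.var hu1) (by omega) ?_).mono ?_)
  · rw [Function.update_of_ne (by omega), hG.1]
    exact hadj.symm
  rintro t s2 ⟨rfl, hf2, l2, hl2, hR2⟩
  rw [Function.update_of_ne (show (v : ℕ) ≠ u by omega)] at hl2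
  have hf12 := hf1.trans hf2
  have hm2 := (hf12.1 6 (by simp)).trans hm
  refine Det.seq (Det.assign ?_)
  rw [show (Expr.sub (.var 6) (.lit 1)).eval w s2 = G.edgeSet.ncard - 1 by
    rw [Expr.eval, eval_lit hw.one_lt, show (Expr.var 6).eval w s2 = _ from hm2]]
  set s3 := s2.setVar 6 (G.edgeSet.ncard - 1) with hs3
  have hf3 : Frame [6] [2, 3, 4] s s3 := (hf12.mono (by simp) (by simp)).setVar (by simp) _
  set R2 := Function.update (Function.update R u l1) v l2 with hR2def
  have hR3 : Rows n s3 R2 := hR2.congr rfl rfl rfl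
  have hR2n : R2 n = R n := by
    rw [hR2def, Function.update_of_ne (by omega), Function.update_of_ne (by omega)]
  have hR2u : R2 u = l1 := by
    rw [hR2def, Function.update_of_ne (by omega), Function.update_self]
  have hR2v : R2 v = l2 := by rw [hR2def, Function.update_self]
  have hn3 := (hf3.1 0 (by simp)).trans hn
  have hrow : ∀ x y : Fin n, y ∈ R2 x ↔ ((Update.delete u v).apply G).Adj x y := by
    intro x y
    rw [delete_adj, ← hG.1]
    by_cases hxv : x = v
    · subst hxv
      rw [hR2v, hl2]
      simp [huv.symm]
    · have hxv' : (x : ℕ) ≠ v := fun h => hxv (Fin.ext h)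
      rw [hR2def, Function.update_of_ne (by omega)]
      by_cases hxu : x = u
      · subst hxu
        rw [Function.update_self, hl1]
        simp [hxv]
      · have hxu' : (x : ℕ) ≠ u := fun h => hxu (Fin.ext h)
        rw [Function.update_of_ne (by omega)]
        simp [hxu, hxv]
  refine Det.seq ((det_ite_rowErase hw hn3 hR3 (x := u) ((hf3.1 2 (by simp)).trans hu) ?_).mono ?_)
  · rw [hR2n, hG.2, mem_nonisolated]
    exact ⟨v, hadj⟩
  rintro t4 s4 ⟨ht4, hf4, l4, hl4, hR4⟩
  have hn4 := (hf4.1 0 (by simp)).trans hn3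
  refine (det_ite_rowErase hw hn4 hR4 (x := v)
    ((hf4.1 3 (by simp)).trans ((hf3.1 3 (by simp)).trans hv)) ?_).mono ?_
  · rw [Function.update_self, hl4, hR2n, hG.2, mem_nonisolated]
    exact ⟨⟨u, hadj.symm⟩, fun h => absurd h huv.symm⟩
  rintro t5 s5 ⟨ht5, hf5, l5, hl5, hR5⟩
  rw [Function.update_self, Function.update_of_ne (by omega)] at hl5
  refine ⟨by omega, hf3.trans ((hf4.trans hf5).mono (by simp) (by simp)), ?_, _, hR5, ⟨?_, ?_⟩, ?_⟩
  · rw [hf5.1 6 (by simp), hf4.1 6 (by simp), ncard_delete hval, hs3]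
    simp
  · intro x y
    have hx2 := x.2
    rw [Function.update_of_ne (by omega), Function.update_of_ne (by omega), hrow]
  · intro x
    rw [Function.update_self, hl5, hl4, hR2n, hG.2, mem_nonisolated, mem_nonisolated]
    constructor
    · rintro ⟨⟨⟨y, hy⟩, h1⟩, h2⟩
      by_cases hx : R2 x = []
      · refine ⟨y, ?_⟩
        rw [delete_adj]
        refine ⟨hy, fun h => ?_, fun h => ?_⟩
        · exact h1 h.1 (h.1 ▸ hx)
        · exact h2 h.1 (h.1 ▸ hx)
      · obtain ⟨z, hz⟩ := List.exists_mem_of_ne_nil _ hx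
        exact ⟨z, (hrow x z).1 hz⟩
    · rintro ⟨y, hy⟩
      have hne : R2 x ≠ [] := List.ne_nil_of_mem ((hrow x y).2 hy)
      rw [delete_adj] at hy
      exact ⟨⟨⟨y, hy.1⟩, fun h => h ▸ hne⟩, fun h => h ▸ hne⟩
  · intro x
    rw [Function.update_of_ne (by omega), Function.update_of_ne (by omega), hR2def,
      Function.update_of_ne (by omega), Function.update_of_ne (by omega)]

theorem det_updateGraph (hw : WordOK n w) (hR : Rows n s R) (hG : GraphRows G R)
    (hm : s.var 6 = G.edgeSet.ncard) {u : Update n} (hu : u.Valid G) :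
    Det w updateGraph (u.load s) fun t s' => t ≤ 40 ∧ Frame [0, 1, 2, 3, 6] [2, 3, 4] s s' ∧
      s'.var 0 = n ∧ s'.var 1 = u.kind ∧ s'.var 2 = u.fst ∧ s'.var 3 = u.snd ∧
      s'.var 6 = (u.apply G).edgeSet.ncard ∧ ∃ R', Rows n s' R' ∧ GraphRows (u.apply G) R' ∧
        ∀ x : Fin n, R' (n + 1 + x) = R (n + 1 + x) := by
  cases u with
  | insert a b =>
    have hf0 : Frame [0, 1, 2, 3, 6] [2, 3, 4] s ((Update.insert a b).load s) :=
      (((((Frame.refl _ _ s).setVar (by simp) _).setVar (by simp) _).setVar (by simp) _).setVar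
        (by simp) _)
    refine Det.ite (fun _ => ?_) fun h => absurd h (by simp [Update.load, Expr.eval])
    refine (det_insertEdge hw (s := (Update.insert a b).load s) (u := a) (v := b)
      (by simp [Update.load]) (hR.congr rfl rfl rfl) hG (by simp [Update.load]) (by simp [Update.load])
      (by simp [Update.load, hm]) hu).mono ?_
    rintro t s' ⟨ht, hf, hm', hR'⟩
    refine ⟨by omega, hf0.trans (hf.mono (by simp) (by simp)), ?_, ?_, ?_, ?_, hm', hR'⟩
    all_goals
      rw [hf.1 _ (by simp)]
      simp [Update.load, Update.kind, Update.fst, Update.snd]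
  | delete a b =>
    have hf0 : Frame [0, 1, 2, 3, 6] [2, 3, 4] s ((Update.delete a b).load s) :=
      (((((Frame.refl _ _ s).setVar (by simp) _).setVar (by simp) _).setVar (by simp) _).setVar
        (by simp) _)
    refine Det.ite (fun h => absurd h (by simp [Update.load, Expr.eval])) fun _ => ?_
    refine (det_deleteEdge hw (s := (Update.delete a b).load s) (u := a) (v := b)
      (by simp [Update.load]) (hR.congr rfl rfl rfl) hG (by simp [Update.load])
      (by simp [Update.load]) (by simp [Update.load, hm]) hu).mono ?_
    rintro t s' ⟨ht, hf, hm', hR'⟩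
    refine ⟨by omega, hf0.trans (hf.mono (by simp) (by simp)), ?_, ?_, ?_, ?_, hm', hR'⟩
    all_goals
      rw [hf.1 _ (by simp)]
      simp [Update.load, Update.kind, Update.fst, Update.snd]

end UpdateGraph

/-! ## The length of a phase -/

/-- The number of updates from one reconstruction to the next. -/
noncomputable def rootCeil (m : ℕ) : ℕ := ⌈√((max m 1 : ℕ) : ℝ)⌉₊

/-- Together with `mul_self_lt_max` this pins down `rootCeil m` by inequalities between natural
numbers, so the analysis of the program needs no real square roots. -/
theorem max_le_rootCeil_mul_self (m : ℕ) : max m 1 ≤ rootCeil m * rootCeil m := by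
  have h := Nat.le_ceil (√((max m 1 : ℕ) : ℝ))
  have h2 := Real.mul_self_sqrt (Nat.cast_nonneg (α := ℝ) (max m 1))
  have h3 := Real.sqrt_nonneg ((max m 1 : ℕ) : ℝ)
  have h4 : ((max m 1 : ℕ) : ℝ) ≤ ((rootCeil m * rootCeil m : ℕ) : ℝ) := by
    rw [← h2, Nat.cast_mul]
    exact mul_self_le_mul_self h3 h
  exact_mod_cast h4

theorem rootCeil_pos (m : ℕ) : 1 ≤ rootCeil m := by
  have := max_le_rootCeil_mul_self m
  by_contra h
  have h0 : rootCeil m = 0 := by omega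
  rw [h0] at this
  omega

theorem mul_self_lt_max {m r : ℕ} (h : r < rootCeil m) : r * r < max m 1 := by
  have h1 := Nat.lt_ceil.1 h
  have h2 : ((r * r : ℕ) : ℝ) < ((max m 1 : ℕ) : ℝ) := by
    rw [← Real.mul_self_sqrt (Nat.cast_nonneg (α := ℝ) (max m 1))]
    rw [Nat.cast_mul]
    exact mul_self_lt_mul_self (Nat.cast_nonneg _) h1
  exact_mod_cast h2

theorem rootCeil_le {n m : ℕ} (h : m ≤ n * n) : rootCeil m ≤ n + 1 := by
  by_contra h'
  have := mul_self_lt_max (m := m) (r := n + 1) (by omega)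
  have h2 : n * n < (n + 1) * (n + 1) := by nlinarith
  rcases max_cases m 1 with h3 | h3 <;> nlinarith

/-- What is known about the remaining length `left` of a phase that was started with parameter `r`,
when there are `m` edges. -/
structure PhaseOK (left r m : ℕ) : Prop where
  left_le : left ≤ r
  upper : m + left ≤ r * r + r
  lower : r * r + left ≤ m + 3 * r

/-- From `(r - 1) ^ 2 ≤ m ≤ r ^ 2`. The remaining length is `r - 1`, since the `r`-th update after
this one is the next reconstruction. -/
theorem PhaseOK.rootCeil (m : ℕ) : PhaseOK (rootCeil m - 1) (rootCeil m) m := by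
  have h1 := max_le_rootCeil_mul_self m
  have h2 := rootCeil_pos m
  have h3 := mul_self_lt_max (m := m) (r := DynMIS.rootCeil m - 1) (by omega)
  generalize DynMIS.rootCeil m = r at *
  obtain ⟨r, rfl⟩ : ∃ q, r = q + 1 := ⟨r - 1, by omega⟩
  rw [Nat.add_sub_cancel] at *
  refine ⟨by omega, ?_, ?_⟩
  · have := le_max_left m 1
    omega
  · have : (r + 1) * (r + 1) = r * r + 2 * r + 1 := by ring
    have h4 : r * r ≤ m := by
      rcases max_cases m 1 with h5 | h5
      · omega
      · have : r * r < 1 := by omega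
        omega
    omega

/-- An update changes the number of edges by at most one and lowers the remaining length by one, so
neither `m + left` nor `left - m` grows. -/
theorem PhaseOK.next {left r m m' : ℕ} (h : PhaseOK (left + 1) r m) (h1 : m' ≤ m + 1)
    (h2 : m ≤ m' + 1) : PhaseOK left r m' := by
  obtain ⟨h3, h4, h5⟩ := h
  exact ⟨by omega, by omega, by omega⟩

/-! ## The program -/

/-- Compute the parameter of a new phase. -/
def newPhase : Stmt :=
  .seq (.assign 5 (.lit 1))
    (.seq (.while (.lt (.mul (.var 5) (.var 5)) (.var 6)) (.assign 5 (.add (.var 5) (.lit 1))))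
      (.assign 4 (.sub (.var 5) (.lit 1))))

/-- One or both end points of the updated edge are among the vertices taken first. -/
def topTouched : Expr := .add (.eq (.get 1 (.var 2)) (.lit 1)) (.eq (.get 1 (.var 3)) (.lit 1))

/-- Process an update inside a phase. -/
def stepPhase : Stmt :=
  .seq (.assign 4 (.sub (.var 4) (.lit 1)))
    (.ite topTouched rebuild
      (.ite (.add (.get 1 (.var 2)) (.get 1 (.var 3))) .skip
        (.ite (.var 1) localInsert localDelete)))

/-- Process an update. -/
def program : Stmt := .seq updateGraph (.ite (.var 4) stepPhase (.seq newPhase rebuild))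

section Update
variable {n w : ℕ} {s : Store} {G : SimpleGraph (Fin n)}

/-- Linear search for the root costs `O(r)`, dominated by the `O(r²)` of the reconstruction. The
candidates stay at most `n + 1`, so their squares fit into a word. -/
theorem det_newPhase (hw : WordOK n w) {m : ℕ} (hm : s.var 6 = m) (hmn : m ≤ n * n) :
    Det w newPhase s fun t s' => t ≤ 10 + 10 * rootCeil m ∧ Frame [4, 5] [] s s' ∧
      s'.var 4 = rootCeil m - 1 ∧ s'.var 5 = rootCeil m := by
  have hle := rootCeil_le hmn
  have hpos := rootCeil_pos m
  have hbig : (n + 1) * (n + 1) < 2 ^ w := by unfold WordOK at hw; nlinarith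
  have loop : ∀ d r (s1 : Store), r + d = rootCeil m → 1 ≤ r → s1.var 6 = m → s1.var 5 = r →
      Det w (.while (.lt (.mul (.var 5) (.var 5)) (.var 6)) (.assign 5 (.add (.var 5) (.lit 1)))) s1
        fun t s' => t ≤ 1 + 3 * d ∧ Frame [4, 5] [] s1 s' ∧ s'.var 5 = rootCeil m := by
    intro d
    induction d with
    | zero =>
      intro r s1 hr hr1 hm1 h5
      have hrn : r * r ≤ (n + 1) * (n + 1) := Nat.mul_le_mul (by omega) (by omega)
      refine Det.while_false ?_ ⟨by omega, Frame.refl _ _ _, by omega⟩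
      by_contra h
      have := (eval_lt_ne_zero hw.one_lt
        (f := .var 6) (eval_mul (e := .var 5) (f := .var 5) h5 h5 (by omega)) hm1).1 h
      have h2 := max_le_rootCeil_mul_self m
      rw [← hr, Nat.add_zero] at h2
      have := le_max_left m 1
      omega
    | succ d ih =>
      intro r s1 hr hr1 hm1 h5
      have hrn : r * r ≤ (n + 1) * (n + 1) := Nat.mul_le_mul (by omega) (by omega)
      have hlt := mul_self_lt_max (m := m) (r := r) (by omega)
      have hrm : r * r < m := by
        have : 1 ≤ r * r := Nat.mul_le_mul hr1 hr1
        rcases max_cases m 1 with h5 | h5 <;> omega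
      refine Det.while_true ((eval_lt_ne_zero hw.one_lt
        (f := .var 6) (eval_mul (e := .var 5) (f := .var 5) h5 h5 (by omega)) hm1).2 hrm) (Det.assign ?_)
      rw [eval_add (e := .var 5) h5 (eval_lit hw.one_lt) (hw.lt (by omega))]
      refine (ih (r + 1) (s1.setVar 5 (r + 1)) (by omega) (by omega) (by simpa using hm1)
        (by simp)).mono ?_
      rintro t s' ⟨ht, hf, h⟩
      exact ⟨by omega, ((Frame.refl _ _ _).setVar (by simp) _).trans hf, h⟩
  refine Det.seq (Det.assign ?_)
  rw [eval_lit hw.one_lt]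
  refine Det.seq ((loop (rootCeil m - 1) 1 (s.setVar 5 1) (by omega) le_rfl (by simpa using hm)
    (by simp)).mono ?_)
  rintro t s1 ⟨ht, hf, h5⟩
  refine Det.assign ⟨by omega, ?_, ?_, ?_⟩
  · exact (((Frame.refl _ _ _).setVar (by simp) _).trans hf).setVar (by simp) _
  · simp [Expr.eval, h5, Nat.mod_eq_of_lt hw.one_lt]
  · simp [h5]

/-! ## One update -/

theorem apply_adj_of_ne {u : Update n} (hu : u.Valid G) {x : Fin n} (h1 : x ≠ u.fst)
    (h2 : x ≠ u.snd) (y : Fin n) : (u.apply G).Adj x y ↔ G.Adj x y := by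
  cases u with
  | insert a b =>
    rw [insert_adj hu.1]
    exact or_iff_left fun h => h.elim (fun h => h1 h.1) fun h => h2 h.1
  | delete a b =>
    rw [delete_adj]
    exact and_iff_left ⟨fun h => h1 h.1, fun h => h2 h.1⟩

theorem ncard_apply_le {u : Update n} (hu : u.Valid G) :
    (u.apply G).edgeSet.ncard ≤ G.edgeSet.ncard + 1 ∧
      G.edgeSet.ncard ≤ (u.apply G).edgeSet.ncard + 1 := by
  cases u with
  | insert a b =>
    rw [ncard_insert hu]
    omega
  | delete a b =>
    rw [ncard_delete hu]
    omega

/-- The vertex set that is stored. -/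
def outSet (n : ℕ) (s : Store) : Finset (Fin n) := Finset.univ.filter fun v => s.arr 0 v = 0

@[simp] theorem mem_outSet {v : Fin n} : v ∈ outSet n s ↔ s.arr 0 v = 0 := by simp [outSet]

/-- The store represents the graph `G`, a set `T` of vertices taken first, the residual set `H`, the
number `p.1` of updates before the next reconstruction, and the parameter `p.2` of the phase. -/
structure State (s : Store) (G : SimpleGraph (Fin n)) (T H : Finset (Fin n)) (p : ℕ × ℕ) :
    Prop where
  inv : Inv s G T H
  edges : s.var 6 = G.edgeSet.ncard
  left : s.var 4 = p.1
  root : s.var 5 = p.2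
  phase : PhaseOK p.1 p.2 G.edgeSet.ncard
  root_le : p.2 ≤ n + 1

/-- Blank memory describes the empty graph with every vertex residual and in the set. Remaining
length `0` makes the first update a reconstruction, in agreement with `rebuildTime us 1 = 1`. -/
theorem State.blank : State Store.blank (⊥ : SimpleGraph (Fin n)) ∅ Finset.univ (0, 0) where
  inv := by
    refine ⟨⟨fun _ => [], fun ρ _ => ⟨List.nodup_nil, rfl, by simp⟩,
      ⟨by simp, by simp [mem_nonisolated]⟩, by simp [mem_nbrsIn]⟩, by simp [Store.blank], by simp,
      by simp, by simp, by simp, by simp, by simp, ?_⟩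
    intro v _
    have : nbrsIn (⊥ : SimpleGraph (Fin n)) Finset.univ v = ∅ := by ext; simp [mem_nbrsIn]
    simp [this, Store.blank]
  edges := by simp [Store.blank]
  left := rfl
  root := rfl
  phase := ⟨le_rfl, by simp, by simp⟩
  root_le := by simp

theorem Inv.isNbhd (G : SimpleGraph (Fin n)) (H : Finset (Fin n)) : IsNbhd (nbrsIn G H) H where
  symm x y h := by
    rw [mem_nbrsIn] at h ⊢
    exact ⟨h.2.1, h.1, h.2.2.symm⟩
  sub x y h := (mem_nbrsIn.1 h).2.1
  irrefl x h := (mem_nbrsIn.1 h).2.2.ne rfl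

theorem Inv.counts {T H : Finset (Fin n)} (h : Inv s G T H) :
    Counts s (nbrsIn G H) H (H ∩ outSet n s) where
  sub := Finset.inter_subset_left
  out x hx := by
    rw [h.out_res x hx]
    congr 1
    ext y
    simp only [Finset.mem_filter, Finset.mem_inter, mem_outSet, mem_nbrsIn]
    tauto
  mem_iff x hx := by simp [hx]

theorem Counts.eq_inter {nb : Fin n → Finset (Fin n)} {H M : Finset (Fin n)} (h : Counts s nb H M) :
    M = H ∩ outSet n s := by
  ext x
  rw [Finset.mem_inter, mem_outSet]
  exact ⟨fun hx => ⟨h.sub hx, (h.mem_iff x (h.sub hx)).1 hx⟩, fun hx => (h.mem_iff x hx.1).2 hx.2⟩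

/-- The stored set is a maximal independent set. -/
theorem Inv.maximal {T H : Finset (Fin n)} (h : Inv s G T H) :
    Maximal (fun S : Set (Fin n) => G.IsIndepSet S) (outSet n s : Set (Fin n)) := by
  have key : ∀ v : Fin n, s.arr 0 v = 0 → v ∈ T ∨ v ∈ H := by
    intro v hv
    by_contra h'
    rw [not_or] at h'
    exact h.out_dom v h'.1 h'.2 hv
  refine ⟨?_, ?_⟩
  · intro u hu v hv huv hadj
    rw [Finset.mem_coe, mem_outSet] at hu hv
    rcases key u hu with huT | huH
    · exact h.indep u huT v (key v hv) hadj
    rcases key v hv with hvT | hvH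
    · exact h.indep v hvT u (Or.inr huH) hadj.symm
    have := h.out_res u huH
    rw [hu, eq_comm, Finset.card_eq_zero] at this
    have h2 : v ∈ (nbrsIn G H u).filter fun w : Fin n => s.arr 0 w = 0 :=
      Finset.mem_filter.2 ⟨mem_nbrsIn.2 ⟨huH, hvH, hadj⟩, hv⟩
    rw [this] at h2
    simp at h2
  · intro S hS hsub v hv
    rw [Finset.mem_coe, mem_outSet]
    have hS' : ∀ u : Fin n, s.arr 0 u = 0 → ¬ G.Adj v u := by
      intro u hu hadj
      exact hS hv (hsub (by simpa using hu)) hadj.ne hadj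
    by_cases hvT : v ∈ T
    · exact h.out_top v hvT
    by_cases hvH : v ∈ H
    · rw [h.out_res v hvH, Finset.card_eq_zero, Finset.filter_eq_empty_iff]
      intro u hu hu'
      exact hS' u hu' (mem_nbrsIn.1 hu).2.2
    · obtain ⟨u, hu, hadj⟩ := h.dom v hvT hvH
      exact absurd hadj (hS' u (h.out_top u hu))

/-- The situation after the graph has been updated. -/
structure Updated (s s1 : Store) (u : Update n) (G : SimpleGraph (Fin n)) (R1 : ℕ → List (Fin n))
    (H : Finset (Fin n)) : Prop where
  frame : Frame [0, 1, 2, 3, 6] [2, 3, 4] s s1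
  num : s1.var 0 = n
  kind : s1.var 1 = u.kind
  fst : s1.var 2 = u.fst
  snd : s1.var 3 = u.snd
  edges : s1.var 6 = (u.apply G).edgeSet.ncard
  rows : Rows n s1 R1
  graph : GraphRows (u.apply G) R1
  res : ResRows R1 (nbrsIn G H)

theorem det_updateGraph_state (hw : WordOK n w) {T H : Finset (Fin n)} {p : ℕ × ℕ}
    (hS : State s G T H p) {u : Update n} (hu : u.Valid G) :
    Det w updateGraph (u.load s) fun t s1 => t ≤ 40 ∧ ∃ R1, Updated s s1 u G R1 H := by
  obtain ⟨R, hR, hG, hres⟩ := hS.inv.rows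
  refine (det_updateGraph hw hR hG hS.edges hu).mono ?_
  rintro t s1 ⟨ht, hf, h0, h1, h2, h3, h6, R1, hR1, hG1, hrow⟩
  exact ⟨ht, R1, hf, h0, h1, h2, h3, h6, hR1, hG1, fun x y => by rw [hrow, hres]⟩

/-- Such a vertex was isolated before the update too. Members of `T` and dominated vertices have
neighbours, so it was in `H`, with counter `0`, status `0` and an empty residual row. -/
theorem Updated.cleared {s1 : Store} {u : Update n} {R1 : ℕ → List (Fin n)} {T H : Finset (Fin n)}
    (h : Updated s s1 u G R1 H) (hI : Inv s G T H) (hu : u.Valid G) :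
    Cleared s1 R1 fun v => v ∉ nonisolated (u.apply G) ∧ v ≠ u.fst ∧ v ≠ u.snd := by
  refine ⟨R1, h.rows, fun _ _ => rfl, ?_⟩
  rintro v ⟨hv, h1, h2⟩
  have hiso : ∀ y, ¬ G.Adj v y := by
    intro y hy
    exact hv (mem_nonisolated.2 ⟨y, (apply_adj_of_ne hu h1 h2 y).2 hy⟩)
  have hvT : v ∉ T := fun h => by
    obtain ⟨y, hy⟩ := mem_nonisolated.1 (hI.sub h)
    exact hiso y hy
  have hvH : v ∈ H := by
    by_contra hvH
    obtain ⟨y, -, hy⟩ := hI.dom v hvT hvH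
    exact hiso y hy
  have hnb : nbrsIn G H v = ∅ := by
    ext y
    simp [mem_nbrsIn, hiso]
  refine ⟨?_, ?_, ?_⟩
  · rw [h.frame.2 0 (by simp), hI.out_res v hvH, hnb]
    simp
  · rw [h.frame.2 1 (by simp), hI.status v, if_neg hvT, if_pos hvH]
  · rw [List.eq_nil_iff_forall_not_mem]
    intro y hy
    rw [h.res, hnb] at hy
    simp at hy

/-- The vertices that greedy takes first, for the order `l`. -/
noncomputable def topGreedy (G : SimpleGraph (Fin n)) (r : ℕ) (l : List (Fin n)) :
    Finset (Fin n) :=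
  greedyFrom G ∅ (l.take ((nonisolated G).card / (8 * r)))

theorem spec_rebuild_state (hw : WordOK n w) {s1 s2 : Store} {u : Update n}
    {R1 : ℕ → List (Fin n)} {T H : Finset (Fin n)} (h : Updated s s1 u G R1 H) (hI : Inv s G T H)
    (hu : u.Valid G) (hf : Frame [4, 5] [] s1 s2) {p : ℕ × ℕ} (h4 : s2.var 4 = p.1)
    (h5 : s2.var 5 = p.2) (hp : PhaseOK p.1 p.2 (u.apply G).edgeSet.ncard) (hp2 : p.2 ≤ n + 1) :
    Spec w rebuild s2 (randomOrder (nonisolated (u.apply G))) fun l t s' =>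
      t ≤ 40 + 200 * (u.apply G).edgeSet.ncard ∧
        State s' (u.apply G) (topGreedy (u.apply G) p.2 l)
          (residual (u.apply G) (topGreedy (u.apply G) p.2 l)) p ∧
        outSet n s' = greedyFrom (u.apply G) ∅ l ∪ (nonisolated (u.apply G))ᶜ := by
  refine (spec_rebuild hw ((hf.1 0 (by simp)).trans h.num) ((hf.1 2 (by simp)).trans h.fst)
    ((hf.1 3 (by simp)).trans h.snd) h.graph h5 hp2
    ((h.cleared hI hu).congr hf (by simp))).mono ?_
  rintro l t s' ⟨ht, hf', hI', ho⟩
  refine ⟨ht, ⟨hI', ?_, ?_, ?_, hp, hp2⟩, ?_⟩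
  · rw [hf'.1 6 (by simp), hf.1 6 (by simp), h.edges]
  · rw [hf'.1 4 (by simp), h4]
  · rw [hf'.1 5 (by simp), h5]
  · ext v
    rw [mem_outSet, ho]

theorem spec_program_reconstruct (hw : WordOK n w) {T H : Finset (Fin n)} {r : ℕ}
    (hS : State s G T H (0, r)) {u : Update n} (hu : u.Valid G) {r' : ℕ}
    (hr' : r' = rootCeil (u.apply G).edgeSet.ncard) :
    Spec w program (u.load s) (randomOrder (nonisolated (u.apply G))) fun l t s' =>
      t ≤ 100 + 10 * r' + 200 * (u.apply G).edgeSet.ncard ∧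
        State s' (u.apply G) (topGreedy (u.apply G) r' l)
          (residual (u.apply G) (topGreedy (u.apply G) r' l)) (r' - 1, r') ∧
        outSet n s' = greedyFrom (u.apply G) ∅ l ∪ (nonisolated (u.apply G))ᶜ := by
  subst hr'
  refine Det.seq_spec ((det_updateGraph_state hw hS hu).mono ?_)
  rintro t1 s1 ⟨ht1, R1, h1⟩
  refine Spec.ite ?_
  have h4 : (Expr.var 4).eval w s1 = 0 := (h1.frame.1 4 (by simp)).trans hS.left
  rw [if_neg (by simp [h4])]
  refine Det.seq_spec ((det_newPhase hw h1.edges (ncard_le_mul_self _)).mono ?_)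
  rintro t2 s2 ⟨ht2, hf2, h42, h52⟩
  refine (spec_rebuild_state hw h1 hS.inv hu hf2 (p := (_, _)) h42 h52 (PhaseOK.rootCeil _)
    (rootCeil_le (ncard_le_mul_self _))).mono ?_
  rintro l t3 s3 ⟨ht3, h⟩
  exact ⟨by omega, h⟩

theorem topTouched_eval (hw : WordOK n w) {s1 : Store} {u : Update n} {R1 : ℕ → List (Fin n)}
    {T H : Finset (Fin n)} (h : Updated s s1 u G R1 H) (hI : Inv s G T H) {s2 : Store}
    (hf : Frame [4] [] s1 s2) : topTouched.eval w s2 ≠ 0 ↔ u.fst ∈ T ∨ u.snd ∈ T := by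
  have key : ∀ (i : ℕ) (v : Fin n), s2.var i = v →
      ((Expr.eq (.get 1 (.var i)) (.lit 1)).eval w s2 = if v ∈ T then 1 else 0) := by
    intro i v hv
    have hst := hI.status v
    rw [← h.frame.2 1 (by simp), ← hf.2 1 (by simp), ← eval_get_var (w := w) hv] at hst
    rw [Expr.eval, hst, eval_lit hw.one_lt, Nat.mod_eq_of_lt hw.one_lt]
    split_ifs <;> simp_all
  have h2 : 2 < 2 ^ w := hw.lt (by omega)
  rw [topTouched, eval_add (key 2 u.fst ((hf.1 2 (by simp)).trans h.fst))
    (key 3 u.snd ((hf.1 3 (by simp)).trans h.snd)) (by split_ifs <;> omega)]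
  split_ifs <;> simp_all

/-- The greedy run is repeated with the old `r` and the clock keeps running, so the times of
reconstruction do not depend on the random choices. -/
theorem spec_program_touched (hw : WordOK n w) {T H : Finset (Fin n)} {left r : ℕ}
    (hS : State s G T H (left + 1, r)) {u : Update n} (hu : u.Valid G)
    (hT : u.fst ∈ T ∨ u.snd ∈ T) :
    Spec w program (u.load s) (randomOrder (nonisolated (u.apply G))) fun l t s' =>
      t ≤ 100 + 200 * (u.apply G).edgeSet.ncard ∧
        State s' (u.apply G) (topGreedy (u.apply G) r l)
          (residual (u.apply G) (topGreedy (u.apply G) r l)) (left, r) := by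
  refine Det.seq_spec ((det_updateGraph_state hw hS hu).mono ?_)
  rintro t1 s1 ⟨ht1, R1, h1⟩
  refine Spec.ite ?_
  have h4 : (Expr.var 4).eval w s1 = left + 1 := (h1.frame.1 4 (by simp)).trans hS.left
  rw [if_pos (by simp [h4])]
  refine Det.seq_spec (Det.assign ?_)
  rw [show (Expr.sub (.var 4) (.lit 1)).eval w s1 = left by
    rw [Expr.eval, eval_lit hw.one_lt, h4, Nat.add_sub_cancel]]
  have hf2 : Frame [4] [] s1 (s1.setVar 4 left) := (Frame.refl _ _ _).setVar (by simp) _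
  refine Spec.ite ?_
  rw [if_pos ((topTouched_eval hw h1 hS.inv hf2).2 hT)]
  have hm := ncard_apply_le hu
  refine (spec_rebuild_state hw h1 hS.inv hu (hf2.mono (by simp) (by simp)) (p := (left, r))
    (by simp) (by simpa using (h1.frame.1 5 (by simp)).trans hS.root)
    (hS.phase.next hm.1 hm.2) hS.root_le).mono ?_
  rintro l t3 s3 ⟨ht3, h, -⟩
  exact ⟨by omega, h⟩

/-- No edge at `T` changes, so `T` still dominates the vertices outside `T ∪ H` and has no neighbour
in `H`. Counters outside `H` are left alone; those of dominated vertices may be out of date, but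
only being nonzero matters for them. -/
theorem Inv.local {T H : Finset (Fin n)} {s' : Store} {G' : SimpleGraph (Fin n)}
    (h : Inv s G T H) (hadj : ∀ v ∈ T, ∀ y, G'.Adj v y ↔ G.Adj v y)
    {R : ℕ → List (Fin n)} (hR : Rows n s' R) (hG : GraphRows G' R) (hres : ResRows R (nbrsIn G' H))
    (h1 : s'.arr 1 = s.arr 1) (hoff : ∀ x : Fin n, x ∉ H → s'.arr 0 x = s.arr 0 x)
    {M : Finset (Fin n)} (hc : Counts s' (nbrsIn G' H) H M) : Inv s' G' T H where
  rows := ⟨R, hR, hG, hres⟩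
  status v := by rw [h1, h.status]
  disj := h.disj
  sub v hv := by
    obtain ⟨y, hy⟩ := mem_nonisolated.1 (h.sub hv)
    exact mem_nonisolated.2 ⟨y, (hadj v hv y).2 hy⟩
  indep u hu v hv hadj' := h.indep u hu v hv ((hadj u hu v).1 hadj')
  dom v hvT hvH := by
    obtain ⟨u, hu, huv⟩ := h.dom v hvT hvH
    exact ⟨u, hu, ((hadj u hu v).2 huv.symm).symm⟩
  out_top v hv := by rw [hoff v (h.disj v hv), h.out_top v hv]
  out_dom v hvT hvH := by
    rw [hoff v hvH]
    exact h.out_dom v hvT hvH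
  out_res v hv := by
    rw [hc.out v hv]
    congr 1
    ext y
    simp only [Finset.mem_filter, Finset.mem_inter]
    exact and_congr_right fun hy => hc.mem_iff y (mem_nbrsIn.1 hy).2.1

/-- If an end point is dominated by `T`, the edge is not in the residual graph and that end point
cannot enter the set, so the local structure needs no change. Otherwise both end points are in `H`
and the local procedures apply. -/
theorem det_program_untouched (hw : WordOK n w) {T H : Finset (Fin n)} {left r : ℕ}
    (hS : State s G T H (left + 1, r)) {u : Update n} (hu : u.Valid G)
    (hT : ¬ (u.fst ∈ T ∨ u.snd ∈ T)) :
    Det w program (u.load s) fun t s' =>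
      State s' (u.apply G) T H (left, r) ∧
        t + 10 * outDeg (nbrsIn (u.apply G) H) H (H ∩ outSet n s') ≤
          10 * outDeg (nbrsIn G H) H (H ∩ outSet n s) + 30 * (nbrsIn G H u.snd).card + 149 := by
  refine Det.seq ((det_updateGraph_state hw hS hu).mono ?_)
  rintro t1 s1 ⟨ht1, R1, h1⟩
  have h4 : (Expr.var 4).eval w s1 = left + 1 := (h1.frame.1 4 (by simp)).trans hS.left
  refine Det.ite (fun _ => ?_) fun h => absurd h (by simp [h4])
  refine Det.seq (Det.assign ?_)
  rw [show (Expr.sub (.var 4) (.lit 1)).eval w s1 = left by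
    rw [Expr.eval, eval_lit hw.one_lt, h4, Nat.add_sub_cancel]]
  have hf2 : Frame [4] [] s1 (s1.setVar 4 left) := (Frame.refl _ _ _).setVar (by simp) _
  have h42 : (s1.setVar 4 left).var 4 = left := by simp
  generalize s1.setVar 4 left = s2 at hf2 h42
  refine Det.ite (fun h => absurd ((topTouched_eval hw h1 hS.inv hf2).1 h) hT) fun _ => ?_
  rw [not_or] at hT
  have hm := ncard_apply_le hu
  have hphase := hS.phase.next hm.1 hm.2
  have hR2 : Rows n s2 R1 := h1.rows.frame hf2 (by simp)
  have hn2 := (hf2.1 0 (by simp)).trans h1.num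
  have h12 := (hf2.1 1 (by simp)).trans h1.kind
  have h22 := (hf2.1 2 (by simp)).trans h1.fst
  have h32 := (hf2.1 3 (by simp)).trans h1.snd
  have h02 : s2.arr 0 = s.arr 0 := (hf2.2 0 (by simp)).trans (h1.frame.2 0 (by simp))
  have h12' : s2.arr 1 = s.arr 1 := (hf2.2 1 (by simp)).trans (h1.frame.2 1 (by simp))
  have hadj : ∀ v ∈ T, ∀ y, (u.apply G).Adj v y ↔ G.Adj v y := fun v hv =>
    apply_adj_of_ne hu (fun h => hT.1 (h ▸ hv)) fun h => hT.2 (h ▸ hv)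
  have hc : Counts s2 (nbrsIn G H) H (H ∩ outSet n s) :=
    ⟨hS.inv.counts.sub, by rw [h02]; exact hS.inv.counts.out,
      by rw [h02]; exact hS.inv.counts.mem_iff⟩
  have finish : ∀ (s3 : Store), Frame [7, 8, 9, 10] [0, 2, 3, 4] s2 s3 →
      (∀ x : Fin n, x ∉ H → s3.arr 0 x = s2.arr 0 x) →
      (∃ R', Rows n s3 R' ∧ (∀ ρ ≤ n, R' ρ = R1 ρ) ∧ ResRows R' (nbrsIn (u.apply G) H)) →
      ∀ M', Counts s3 (nbrsIn (u.apply G) H) H M' → State s3 (u.apply G) T H (left, r) ∧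
        M' = H ∩ outSet n s3 := by
    rintro s3 hf3 hoff ⟨R', hR', hRn, hres⟩ M' hM'
    refine ⟨⟨hS.inv.local hadj hR' (h1.graph.congr hRn) hres ?_ ?_ hM', ?_, ?_, ?_, hphase,
      hS.root_le⟩, hM'.eq_inter⟩
    · rw [hf3.2 1 (by simp), h12']
    · intro x hx
      rw [hoff x hx, h02]
    · rw [hf3.1 6 (by simp), hf2.1 6 (by simp), h1.edges]
    · rw [hf3.1 4 (by simp), h42]
    · rw [hf3.1 5 (by simp), hf2.1 5 (by simp), h1.frame.1 5 (by simp), hS.root]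
  have hst : ∀ v : Fin n, s2.arr 1 v = if v ∈ T then 1 else if v ∈ H then 0 else 2 := by
    rw [h12']
    exact hS.inv.status
  have hsum : (Expr.add (.get 1 (.var 2)) (.get 1 (.var 3))).eval w s2 =
      (if u.fst ∈ H then 0 else 2) + if u.snd ∈ H then 0 else 2 := by
    rw [eval_add ((eval_get_var h22).trans (hst _)) ((eval_get_var h32).trans (hst _)),
      if_neg hT.1, if_neg hT.2]
    have h2 : 4 < 2 ^ w := hw.lt (by omega)
    split_ifs <;> omega
  refine Det.ite ?_ ?_
  · intro h
    rw [hsum] at h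
    have hH : ¬ (u.fst ∈ H ∧ u.snd ∈ H) := fun h' => by simp [h'] at h
    have hnb : nbrsIn (u.apply G) H = nbrsIn G H := by
      funext x
      ext y
      rw [mem_nbrsIn, mem_nbrsIn]
      refine and_congr_right fun hx => and_congr_right fun hy => ?_
      cases u with
      | insert a b =>
        rw [insert_adj hu.1]
        refine or_iff_left ?_
        rintro (⟨rfl, rfl⟩ | ⟨rfl, rfl⟩)
        · exact hH ⟨hx, hy⟩
        · exact hH ⟨hy, hx⟩
      | delete a b =>
        rw [delete_adj]
        refine and_iff_left ⟨?_, ?_⟩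
        · rintro ⟨rfl, rfl⟩
          exact hH ⟨hx, hy⟩
        · rintro ⟨rfl, rfl⟩
          exact hH ⟨hy, hx⟩
    obtain ⟨h5, h6⟩ := finish s2 (Frame.refl _ _ _) (fun _ _ => rfl)
      ⟨R1, hR2, fun _ _ => rfl, by rw [hnb]; exact h1.res⟩ (H ∩ outSet n s) (by rw [hnb]; exact hc)
    refine Det.skip ⟨h5, ?_⟩
    rw [← h6, hnb]
    omega
  · intro h
    rw [hsum] at h
    have hH1 : u.fst ∈ H := by
      by_contra h'
      simp [h'] at h
    have hH2 : u.snd ∈ H := by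
      by_contra h'
      simp [h'] at h
    cases u with
    | insert a b =>
      refine Det.ite (fun _ => ?_) fun h => ?_
      · refine (det_localInsert hw hn2 hR2 h22 h32 (nb' := nbrsIn (Update.apply G (.insert a b)) H)
          h1.res (Inv.isNbhd G H) hc hH1 hH2 hu.1 (fun h => hu.2 (mem_nbrsIn.1 h).2.2) ?_).mono ?_
        · intro x y
          rw [mem_nbrsIn, mem_nbrsIn, insert_adj hu.1]
          constructor
          · rintro ⟨hx, hy, h⟩
            exact h.imp (fun h => ⟨hx, hy, h⟩) id
          · rintro (h | ⟨rfl, rfl⟩ | ⟨rfl, rfl⟩)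
            · exact ⟨h.1, h.2.1, Or.inl h.2.2⟩
            · exact ⟨hH1, hH2, Or.inr (Or.inl ⟨rfl, rfl⟩)⟩
            · exact ⟨hH2, hH1, Or.inr (Or.inr ⟨rfl, rfl⟩)⟩
        · rintro t3 s3 ⟨hf3, hoff, hrow, M', hM', ht3⟩
          obtain ⟨h5, rfl⟩ := finish s3 hf3 hoff hrow M' hM'
          refine ⟨h5, ?_⟩
          simp only [Update.snd] at ht3 ⊢
          omega
      · exact absurd (h12.symm.trans h) (by simp [Update.kind])
    | delete a b =>
      refine Det.ite (fun h => ?_) fun _ => ?_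
      · exact absurd h12 h
      · have hab : G.Adj a b := hu
        refine (det_localDelete hw hn2 hR2 h22 h32 (nb' := nbrsIn (Update.apply G (.delete a b)) H)
          h1.res (Inv.isNbhd G H) hc hH1 hH2 hab.ne (mem_nbrsIn.2 ⟨hH1, hH2, hab⟩) ?_).mono ?_
        · intro x y
          rw [mem_nbrsIn, mem_nbrsIn, delete_adj]
          tauto
        · rintro t3 s3 ⟨hf3, hoff, hrow, M', hM', ht3⟩
          obtain ⟨h5, rfl⟩ := finish s3 hf3 hoff hrow M' hM'
          exact ⟨h5, by omega⟩

end Update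

/-! ## Using specifications -/

section Apply
variable {w n : ℕ} {s : Store} {α : Type} {ν : PMF α} {Q : α → ℕ → Store → Prop} {p P : Stmt}
  {γ : ℝ≥0∞} {F : Config n → ℝ≥0∞}

theorem Spec.apply_eq (h : Spec w p s ν Q) (hF : Harmonic P w γ F) {k : List Stmt}
    {us : List (Update n)} {B : α → ℝ≥0∞}
    (hB : ∀ a t s', Q a t s' → γ * t + F ⟨k, s', us⟩ = B a) : F ⟨p :: k, s, us⟩ = expect ν B := by
  obtain ⟨ξ, rfl, hQ, h⟩ := h.exists_expect_eq
  rw [h P n γ F hF, expect_map]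
  exact expect_congr fun z hz => hB _ _ _ (hQ z hz)

theorem Spec.apply_le (h : Spec w p s ν Q) (hF : Harmonic P w γ F) {k : List Stmt}
    {us : List (Update n)} {B : α → ℝ≥0∞}
    (hB : ∀ a t s', Q a t s' → γ * t + F ⟨k, s', us⟩ ≤ B a) : F ⟨p :: k, s, us⟩ ≤ expect ν B := by
  obtain ⟨ξ, rfl, hQ, h⟩ := h.exists_expect_eq
  rw [h P n γ F hF, expect_map]
  exact expect_mono fun z hz => hB _ _ _ (hQ z hz)

theorem Harmonic.load (hF : Harmonic P w γ F) (s : Store) (u : Update n) (us : List (Update n)) :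
    F ⟨[], s, u :: us⟩ = γ + F ⟨[P], u.load s, us⟩ := by
  rw [hF _ (by simp [Config.Done])]
  have : step P w ⟨[], s, u :: us⟩ = PMF.pure ⟨[P], u.load s, us⟩ := rfl
  rw [this, expect_pure]

end Apply

/-! ## Phases -/

/-- The remaining length and the parameter of the phase after an update, when `m` edges are present
after that update. -/
noncomputable def phaseStep (m : ℕ) (p : ℕ × ℕ) : ℕ × ℕ :=
  if p.1 = 0 then (rootCeil m - 1, rootCeil m) else (p.1 - 1, p.2)

/-- The remaining length and the parameter of the phase after a sequence of updates of `G`. -/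
noncomputable def phaseAfter {n : ℕ} : SimpleGraph (Fin n) → ℕ × ℕ → List (Update n) → ℕ × ℕ
  | _, p, [] => p
  | G, p, u :: us => phaseAfter (u.apply G) (phaseStep (u.apply G).edgeSet.ncard p) us

section Phases
variable {n : ℕ}

theorem phaseAfter_concat (us : List (Update n)) (u : Update n) (G : SimpleGraph (Fin n))
    (p : ℕ × ℕ) : phaseAfter G p (us ++ [u]) =
      phaseStep ((us ++ [u]).foldl Update.apply G).edgeSet.ncard (phaseAfter G p us) := by
  induction us generalizing G p with
  | nil => rfl
  | cons a us ih => exact ih _ _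

theorem edgesAfter_append (us vs : List (Update n)) {t : ℕ} (h : t ≤ us.length) :
    edgesAfter (us ++ vs) t = edgesAfter us t := by
  rw [edgesAfter, edgesAfter, List.take_append_of_le_length h]

theorem rebuildTime_succ (us : List (Update n)) (i : ℕ) :
    rebuildTime us (i + 1) = rebuildTime us i + rootCeil (edgesAfter us (rebuildTime us i)) := rfl

theorem rebuildTime_strictMono (us : List (Update n)) : StrictMono (rebuildTime us) :=
  strictMono_nat_of_lt_succ fun i => by
    have := rootCeil_pos (edgesAfter us (rebuildTime us i))
    rw [rebuildTime_succ]
    omega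

/-- The next reconstruction time is fixed by the number of edges at the previous one, so later
updates have no influence on it. -/
theorem rebuildTime_append (us vs : List (Update n)) (i : ℕ) (h : rebuildTime us i ≤ us.length) :
    rebuildTime (us ++ vs) i = rebuildTime us i ∧
      rebuildTime (us ++ vs) (i + 1) = rebuildTime us (i + 1) := by
  have key : rebuildTime (us ++ vs) i = rebuildTime us i := by
    induction i with
    | zero => rfl
    | succ i ih =>
      have h' : rebuildTime us i ≤ us.length :=
        ((rebuildTime_strictMono us) (Nat.lt_succ_self i)).le.trans h
      rw [rebuildTime_succ, rebuildTime_succ, ih h', edgesAfter_append us vs h']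
  exact ⟨key, by rw [rebuildTime_succ, rebuildTime_succ, key, edgesAfter_append us vs h]⟩

/-- Ties the clock of the program to `rebuildTime`: the next reconstruction comes one update after
the remaining length has run out. -/
theorem exists_rebuildTime (us : List (Update n)) : ∃ j, rebuildTime us j ≤ us.length ∧
    rebuildTime us (j + 1) = us.length + (phaseAfter ⊥ (0, 0) us).1 + 1 := by
  induction us using List.reverseRecOn with
  | nil =>
    refine ⟨0, le_rfl, ?_⟩
    have h1 := rootCeil_pos 0
    have h2 : rootCeil 0 ≤ 1 := rootCeil_le (n := 0) (by simp)
    rw [rebuildTime_succ]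
    simp only [rebuildTime, edgesAfter, List.take_nil, graphAfter, List.foldl_nil,
      SimpleGraph.edgeSet_bot, Set.ncard_empty, phaseAfter, List.length_nil]
    omega
  | append_singleton us u ih =>
    obtain ⟨j, h1, h2⟩ := ih
    obtain ⟨h3, h4⟩ := rebuildTime_append us [u] j h1
    rw [phaseAfter_concat, phaseStep, List.length_append, List.length_singleton]
    split_ifs with h
    · refine ⟨j + 1, by omega, ?_⟩
      have h5 : edgesAfter (us ++ [u]) (us.length + 1) =
          ((us ++ [u]).foldl Update.apply ⊥).edgeSet.ncard := by
        rw [edgesAfter, graphAfter, List.take_of_length_le (by simp)]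
      rw [rebuildTime_succ, show rebuildTime (us ++ [u]) (j + 1) = us.length + 1 by omega, h5]
      have := rootCeil_pos ((us ++ [u]).foldl Update.apply ⊥).edgeSet.ncard
      simp only
      omega
    · exact ⟨j, by omega, by simp only; omega⟩

/-- Reconstruction times increase strictly, so none lies between the `j`-th and the next; the next
one must be the update `u` itself. -/
theorem phaseAfter_eq_zero {vs : List (Update n)} {u : Update n} {i : ℕ}
    (h : rebuildTime (vs ++ [u]) i = (vs ++ [u]).length) : (phaseAfter ⊥ (0, 0) vs).1 = 0 := by
  obtain ⟨j, h1, h2⟩ := exists_rebuildTime vs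
  obtain ⟨h3, h4⟩ := rebuildTime_append vs [u] j h1
  rw [List.length_append, List.length_singleton] at h
  have hij : j < i := by
    rw [← (rebuildTime_strictMono (vs ++ [u])).lt_iff_lt]
    omega
  have := (rebuildTime_strictMono (vs ++ [u])).monotone (show j + 1 ≤ i from hij)
  omega

end Phases

/-! ## Correctness -/

section Correct
variable {n w : ℕ} {s : Store} {G : SimpleGraph (Fin n)}

theorem exists_spec_program (hw : WordOK n w) {T H : Finset (Fin n)} {p : ℕ × ℕ}
    (hS : State s G T H p) {u : Update n} (hu : u.Valid G) :
    ∃ (α : Type) (ν : PMF α), Spec w program (u.load s) ν fun _ _ s' =>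
      ∃ T' H', State s' (u.apply G) T' H' (phaseStep (u.apply G).edgeSet.ncard p) := by
  obtain ⟨left, r⟩ := p
  cases left with
  | zero =>
    exact ⟨_, _, (spec_program_reconstruct hw hS hu rfl).mono fun l t s' h => ⟨_, _, h.2.1⟩⟩
  | succ left =>
    by_cases hT : u.fst ∈ T ∨ u.snd ∈ T
    · exact ⟨_, _, (spec_program_touched hw hS hu hT).mono fun l t s' h => ⟨_, _, h.2⟩⟩
    · exact ⟨_, _, Spec.mono (det_program_untouched hw hS hu hT) fun _ t s' h => ⟨_, _, h.1⟩⟩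

/-- The probability of ending outside the invariant satisfies `Harmonic` with cost `0` and vanishes
at the end; specifications carry this back through the updates. -/
theorem State.of_mem_support (hw : WordOK n w) {T H : Finset (Fin n)} {p : ℕ × ℕ}
    (hS : State s G T H p) {us : List (Update n)} (hus : ValidFrom G us) {k : ℕ} {x : Config n}
    (hx : x ∈ (runFrom program w ⟨[], s, us⟩ k).support) (hd : x.Done) :
    ∃ T' H', State x.store (us.foldl Update.apply G) T' H' (phaseAfter G p us) := by
  set A : Config n → Prop := fun c =>
    ∃ T' H', State c.store (us.foldl Update.apply G) T' H' (phaseAfter G p us) with hA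
  refine (doneProb_not_eq_zero_iff A _).1 ?_ k x hx hd
  clear hx hd
  have key : ∀ (vs : List (Update n)) (G' : SimpleGraph (Fin n)) (s' : Store) (T' H') (p' : ℕ × ℕ),
      State s' G' T' H' p' → ValidFrom G' vs →
      vs.foldl Update.apply G' = us.foldl Update.apply G → phaseAfter G' p' vs = phaseAfter G p us →
      doneProb program w (fun c => ¬ A c) ⟨[], s', vs⟩ = 0 := by
    intro vs
    induction vs with
    | nil =>
      intro G' s' T' H' p' hS' _ h1 h2
      rw [doneProb_of_done _ ⟨rfl, rfl⟩, Set.indicator_of_notMem]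
      rw [Set.mem_ofPred_eq, not_not, hA]
      exact ⟨T', H', h1 ▸ h2 ▸ hS'⟩
    | cons u vs ih =>
      intro G' s' T' H' p' hS' hv h1 h2
      obtain ⟨α, ν, h⟩ := exists_spec_program hw hS' hv.1
      have hF := harmonic_doneProb (P := program) (w := w) fun c : Config n => ¬ A c
      rw [hF.load, zero_add, h.apply_eq hF (B := fun _ => 0), expect_const]
      rintro a t s'' ⟨T'', H'', hS''⟩
      rw [zero_mul, zero_add]
      exact ih _ _ _ _ _ hS'' hv.2 h1 h2
  exact key us G s T H p hS hus rfl rfl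

/-- Of the memory `s` only the invariant is used, and the law on the right does not mention it;
hence the conditional form of the claim about reconstructions. -/
theorem outcomeProb_reconstruct (hw : WordOK n w) {T H : Finset (Fin n)} {r : ℕ}
    (hS : State s G T H (0, r)) {u : Update n} (hu : u.Valid G) (S : Finset (Fin n)) :
    outcomeProb program w ⟨[], s, [u]⟩ S = randomGreedy (u.apply G) S := by
  classical
  have hF := harmonic_doneProb (P := program) (w := w) fun c : Config n => c.output = S
  rw [outcomeProb_eq, hF.load, zero_add, (spec_program_reconstruct hw hS hu rfl).apply_eq hF
    (B := fun l => if S = greedyFrom (u.apply G) ∅ l ∪ (nonisolated (u.apply G))ᶜ then 1 else 0),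
    randomGreedy_eq (nonisolated (u.apply G)) fun a b h => mem_nonisolated.2 ⟨b, h⟩,
    PMF.map_apply]
  · refine tsum_congr fun l => ?_
    by_cases h : S = greedyFrom (u.apply G) ∅ l ∪ (nonisolated (u.apply G))ᶜ
    · rw [if_pos h]
      exact (congrArg _ (if_pos h)).trans (mul_one _)
    · rw [if_neg h]
      exact (congrArg _ (if_neg h)).trans (mul_zero _)
  · rintro l t s' ⟨-, -, h⟩
    rw [zero_mul, zero_add, doneProb_of_done _ ⟨rfl, rfl⟩]
    have ho : (Config.output ⟨[], s', []⟩ : Finset (Fin n)) = outSet n s' := rfl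
    by_cases h' : S = greedyFrom (u.apply G) ∅ l ∪ (nonisolated (u.apply G))ᶜ
    · rw [if_pos h', Set.indicator_of_mem (by rw [Set.mem_ofPred_eq, ho, h, h'])]
      rfl
    · rw [if_neg h', Set.indicator_of_notMem]
      rw [Set.mem_ofPred_eq, ho, h]
      exact fun h'' => h' h''.symm

end Correct

/-! ## The potential -/

section Potential
variable {n : ℕ} {G : SimpleGraph (Fin n)}

theorem outDeg_le (H M : Finset (Fin n)) : outDeg (nbrsIn G H) H M ≤ 2 * G.edgeSet.ncard := by
  classical
  rw [Set.ncard_eq_toFinset_card', Set.toFinset_card, ← SimpleGraph.edgeFinset_card,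
    ← G.sum_degrees_eq_twice_card_edges]
  refine (Finset.sum_le_sum_of_subset (Finset.subset_univ _)).trans (Finset.sum_le_sum fun v _ => ?_)
  refine Finset.card_le_card fun y hy => ?_
  rw [SimpleGraph.mem_neighborFinset]
  exact (mem_nbrsIn.1 hy).2.2

theorem card_nbrsIn_apply_le {u : Update n} (hu : u.Valid G) (H : Finset (Fin n)) (x : Fin n) :
    (nbrsIn (u.apply G) H x).card ≤ (nbrsIn G H x).card + 1 := by
  classical
  cases u with
  | insert a b =>
    refine (Finset.card_le_card (t := insert (if x = a then b else a) (nbrsIn G H x))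
      fun y hy => ?_).trans (Finset.card_insert_le _ _)
    rw [mem_nbrsIn, insert_adj hu.1] at hy
    rw [Finset.mem_insert, mem_nbrsIn]
    obtain ⟨h1, h2, h | ⟨rfl, rfl⟩ | ⟨rfl, rfl⟩⟩ := hy
    · exact Or.inr ⟨h1, h2, h⟩
    · simp
    · simp [hu.1.symm]
  | delete a b =>
    refine (Finset.card_le_card fun y hy => ?_).trans (Nat.le_succ _)
    rw [mem_nbrsIn, delete_adj] at hy
    exact mem_nbrsIn.2 ⟨hy.1, hy.2.1, hy.2.2.1⟩

/-- Each vertex belongs to the vertices taken first with probability at most `1 / (8 * r)`. -/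
theorem mul_expect_mem_topGreedy_le (r : ℕ) (a : Fin n) :
    (8 * r : ℝ≥0∞) * expect (randomOrder (nonisolated G))
      (fun l => if a ∈ topGreedy G r l then 1 else 0) ≤ 1 := by
  set N := (nonisolated G).card with hN
  have h1 : expect (randomOrder (nonisolated G)) (fun l => if a ∈ topGreedy G r l then 1 else 0) ≤
      expect (randomOrder (nonisolated G)) (fun l => if a ∈ l.take (N / (8 * r)) then 1 else 0) := by
    refine expect_mono fun l _ => ?_
    split_ifs with h h'
    · exact le_rfl
    · refine absurd (greedyFrom_subset ∅ _ h) ?_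
      simpa using h'
    · exact zero_le
    · exact le_rfl
  rcases Nat.eq_zero_or_pos N with h0 | h0
  · refine (mul_le_mul_right h1 _).trans ?_
    simp [h0, expect]
  · have h2 := card_mul_expect_mem_take (N / (8 * r)) (nonisolated G) a
    rw [← hN] at h2
    have h0' : (N : ℝ≥0∞) ≠ 0 := by exact_mod_cast h0.ne'
    rw [← ENNReal.mul_le_mul_iff_left h0' (ENNReal.natCast_ne_top N)]
    calc _ ≤ (8 * r : ℝ≥0∞) * _ * N := mul_le_mul_left (mul_le_mul_right h1 _) _
      _ = (8 * r : ℝ≥0∞) * (N * expect (randomOrder (nonisolated G))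
          fun l => if a ∈ l.take (N / (8 * r)) then 1 else 0) := by ring
      _ ≤ (8 * r : ℝ≥0∞) * (N / (8 * r) : ℕ) := mul_le_mul_right h2 _
      _ = ((8 * r * (N / (8 * r)) : ℕ) : ℝ≥0∞) := by push_cast; ring
      _ ≤ 1 * N := by
        rw [one_mul]
        exact_mod_cast Nat.mul_div_le N (8 * r)

/-- The expected residual degree of each vertex is at most `16 * r`. -/
theorem expect_card_nbrsIn_le {r : ℕ} (hr : 1 ≤ r) (a : Fin n) :
    expect (randomOrder (nonisolated G)) (fun l =>
      ((nbrsIn G (residual G (topGreedy G r l)) a).card : ℝ≥0∞)) ≤ 16 * r := by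
  set N := (nonisolated G).card with hN
  have hsub : ∀ H, nbrsIn G H a ⊆ nonisolated G := fun H y hy =>
    mem_nonisolated.2 ⟨a, (mem_nbrsIn.1 hy).2.2.symm⟩
  -- For `N < 8 * r` no vertex belongs to the top part, but then all degrees are below `8 * r`
  -- anyway. Otherwise `k = N / (8 * r) ≥ 1`, and rounding down loses at most a factor `2`, so `N ≤
  -- 16 * r * k`.
  rcases lt_or_ge N (8 * r) with h | h
  · refine (expect_mono (F' := fun _ => 16 * (r : ℝ≥0∞)) fun l _ => ?_).trans (expect_const _ _).le
    have : (nbrsIn G (residual G (topGreedy G r l)) a).card ≤ 16 * r :=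
      (Finset.card_le_card (hsub _)).trans (by omega)
    exact_mod_cast this
  · have hk : 1 ≤ N / (8 * r) := (Nat.one_le_div_iff (by omega)).2 h
    have h1 := mul_expect_card_nbrsIn_le a (N / (8 * r)) (nonisolated G) ∅ (hsub _)
    rw [← hN] at h1
    have h2 : N ≤ N / (8 * r) * (16 * r) := by
      have h3 := Nat.lt_div_mul_add (a := N) (b := 8 * r) (by omega)
      nlinarith
    have h0 : ((N / (8 * r) : ℕ) : ℝ≥0∞) ≠ 0 := by
      have : N / (8 * r) ≠ 0 := by omega
      exact_mod_cast this
    rw [← ENNReal.mul_le_mul_iff_left h0 (ENNReal.natCast_ne_top _), mul_comm]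
    refine h1.trans ?_
    rw [mul_comm]
    exact_mod_cast h2

/-- The contribution of a future update to the potential. -/
noncomputable def futureCost (G : SimpleGraph (Fin n)) (T H : Finset (Fin n)) (r : ℕ)
    (u : Update n) : ℕ :=
  30 * (nbrsIn G H u.snd).card +
    1600 * (r * r) * ((if u.fst ∈ T then 1 else 0) + if u.snd ∈ T then 1 else 0)

/-- The degree term gives `30 * 16 * r`; each end point gives at most `1600 * r ^ 2 / (8 * r) = 200
* r`. -/
theorem expect_futureCost_le {r : ℕ} (hr : 1 ≤ r) (u : Update n) :
    expect (randomOrder (nonisolated G)) (fun l =>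
      (futureCost G (topGreedy G r l) (residual G (topGreedy G r l)) r u : ℝ≥0∞)) ≤ 880 * r := by
  have h1 := expect_card_nbrsIn_le (G := G) hr u.snd
  have h2 := mul_expect_mem_topGreedy_le (G := G) r u.fst
  have h3 := mul_expect_mem_topGreedy_le (G := G) r u.snd
  simp only [futureCost, Nat.cast_add, Nat.cast_mul, Nat.cast_ite, Nat.cast_one, Nat.cast_zero,
    Nat.cast_ofNat, expect_add, expect_const_mul]
  generalize expect (randomOrder (nonisolated G)) _ = X at h1 ⊢
  generalize expect (randomOrder (nonisolated G)) _ = Y at h2 ⊢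
  generalize expect (randomOrder (nonisolated G)) _ = Z at h3 ⊢
  calc _ = 30 * X + 200 * r * (8 * r * Y + 8 * r * Z) := by ring
    _ ≤ 30 * (16 * r) + 200 * r * (1 + 1) := by gcongr
    _ = 880 * r := by ring

theorem expect_sum_le {α β : Type} (ν : PMF α) (f : α → β → ℕ) (b : ℝ≥0∞)
    (h : ∀ y, expect ν (fun a => (f a y : ℝ≥0∞)) ≤ b) (L : List β) :
    expect ν (fun a => ((L.map (f a)).sum : ℝ≥0∞)) ≤ L.length * b := by
  induction L with
  | nil => simp
  | cons y L ih =>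
    simp only [List.map_cons, List.sum_cons, Nat.cast_add, expect_add, List.length_cons,
      Nat.cast_one, add_mul, one_mul]
    rw [add_comm]
    exact add_le_add ih (h y)

/-- This is where the adversary has to be oblivious: the list `us` is fixed before the order `l` is
drawn, so linearity applies update by update. -/
theorem expect_futureCost_sum_le {left r : ℕ} (hr : 1 ≤ r) (h : left ≤ r) (us : List (Update n)) :
    expect (randomOrder (nonisolated G)) (fun l => (((us.take left).map
      (futureCost G (topGreedy G r l) (residual G (topGreedy G r l)) r)).sum : ℝ≥0∞)) ≤
        (880 * (r * r) : ℕ) := by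
  refine (expect_sum_le _ _ _ (fun u => expect_futureCost_le hr u) _).trans ?_
  have h1 : (us.take left).length * (880 * r) ≤ 880 * (r * r) := by
    have : (us.take left).length ≤ r := (List.length_take_le _ _).trans h
    calc _ ≤ r * (880 * r) := Nat.mul_le_mul_right _ this
      _ = _ := by ring
  exact_mod_cast h1

/-- The cost of the future updates that does not depend on the random choices. -/
noncomputable def work : SimpleGraph (Fin n) → ℕ × ℕ → List (Update n) → ℕ
  | _, _, [] => 0
  | G, p, u :: us =>
    (if p.1 = 0 then 1600 * (rootCeil (u.apply G).edgeSet.ncard * rootCeil (u.apply G).edgeSet.ncard)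
      else 180 * p.2) +
        work (u.apply G) (phaseStep (u.apply G).edgeSet.ncard p) us

variable {w : ℕ} {s : Store}

/-- Amortized analysis with a potential that looks into the future of the phase: given `T` and `H`,
the remaining updates carry definite charges, and a fresh order replaces them by their expectation,
at most `880 * r ^ 2`. -/
theorem expectedTime_le (hw : WordOK n w) {us : List (Update n)} {G : SimpleGraph (Fin n)}
    {s : Store} {T H : Finset (Fin n)} {p : ℕ × ℕ} (hS : State s G T H p) (hus : ValidFrom G us) :
    expectedTime program w ⟨[], s, us⟩ ≤
      ((10 * outDeg (nbrsIn G H) H (H ∩ outSet n s) +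
        ((us.take p.1).map (futureCost G T H p.2)).sum + work G p us : ℕ) : ℝ≥0∞) := by
  induction us generalizing G s T H p with
  | nil => rw [expectedTime_of_done ⟨rfl, rfl⟩]; exact zero_le
  | cons u us ih =>
    obtain ⟨hu, hus⟩ := hus
    have hF := harmonic_expectedTime (P := program) (w := w) (n := n)
    rw [hF.load]
    -- the cost of a reconstruction
    have main : ∀ (p' : ℕ × ℕ) (A : ℕ) (Q : List (Fin n) → ℕ → Store → Prop),
        phaseStep (u.apply G).edgeSet.ncard p = p' → 1 ≤ p'.2 →
        PhaseOK p'.1 p'.2 (u.apply G).edgeSet.ncard →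
        Spec w program (u.load s) (randomOrder (nonisolated (u.apply G))) Q →
        (∀ l t s', Q l t s' → t ≤ A ∧ State s' (u.apply G) (topGreedy (u.apply G) p'.2 l)
          (residual (u.apply G) (topGreedy (u.apply G) p'.2 l)) p') →
        1 + expectedTime program w ⟨[program], u.load s, us⟩ ≤
          ((1 + A + 40 * (p'.2 * p'.2) + 880 * (p'.2 * p'.2) + work (u.apply G) p' us : ℕ) :
            ℝ≥0∞) := by
      intro p' A Q hp hr hph hspec hQ
      -- During a phase `m ≤ r ^ 2 + r ≤ 2 * r ^ 2`, so ten times the new `outDeg` is at most `20 *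
      -- m ≤ 40 * r ^ 2`.
      have hm : (u.apply G).edgeSet.ncard ≤ 2 * (p'.2 * p'.2) := by
        have := hph.upper
        nlinarith
      have h1 := hspec.apply_le hF (k := []) (us := us) (B := fun l =>
        ((A + 40 * (p'.2 * p'.2) + work (u.apply G) p' us : ℕ) : ℝ≥0∞) +
          (((us.take p'.1).map (futureCost (u.apply G) (topGreedy (u.apply G) p'.2 l)
            (residual (u.apply G) (topGreedy (u.apply G) p'.2 l)) p'.2)).sum : ℝ≥0∞)) ?_
      · rw [expect_add, expect_const] at h1
        refine (add_le_add le_rfl (h1.trans (add_le_add le_rfl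
          (expect_futureCost_sum_le hr hph.left_le us)))).trans (le_of_eq ?_)
        push_cast
        ring
      · intro l t s' h
        obtain ⟨ht, hS'⟩ := hQ l t s' h
        refine (add_le_add le_rfl (ih hS' hus)).trans ?_
        rw [one_mul]
        have ho := outDeg_le (G := u.apply G) (residual (u.apply G) (topGreedy (u.apply G) p'.2 l))
          (residual (u.apply G) (topGreedy (u.apply G) p'.2 l) ∩ outSet n s')
        generalize outDeg _ _ _ = o at ho ⊢
        generalize ((us.take p'.1).map (futureCost (u.apply G) (topGreedy (u.apply G) p'.2 l)
          (residual (u.apply G) (topGreedy (u.apply G) p'.2 l)) p'.2)).sum = f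
        have : t + (10 * o + f + work (u.apply G) p' us) ≤
            A + 40 * (p'.2 * p'.2) + work (u.apply G) p' us + f := by omega
        exact_mod_cast this
    obtain ⟨left, r⟩ := p
    cases left with
    | zero =>
      have hr := rootCeil_pos (u.apply G).edgeSet.ncard
      have hm := (le_max_left _ _).trans (max_le_rootCeil_mul_self (u.apply G).edgeSet.ncard)
      refine (main (_, _) _ _ rfl hr (PhaseOK.rootCeil _)
        (spec_program_reconstruct hw hS hu rfl) fun l t s' h => ⟨h.1, h.2.1⟩).trans ?_
      simp only [work, ↓reduceIte]
      have hrr : rootCeil (u.apply G).edgeSet.ncard ≤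
        rootCeil (u.apply G).edgeSet.ncard * rootCeil (u.apply G).edgeSet.ncard :=
        Nat.le_mul_of_pos_right _ hr
      have hps : phaseStep (u.apply G).edgeSet.ncard (0, r) =
        (rootCeil (u.apply G).edgeSet.ncard - 1, rootCeil (u.apply G).edgeSet.ncard) := rfl
      rw [hps]
      refine Nat.cast_le.2 ?_
      generalize rootCeil (u.apply G).edgeSet.ncard *
        rootCeil (u.apply G).edgeSet.ncard = q at *
      omega
    | succ left =>
      have hps : phaseStep (u.apply G).edgeSet.ncard (left + 1, r) = (left, r) := rfl
      have hr : 1 ≤ r := by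
        have := hS.phase.left_le
        simp only at this
        omega
      simp only [work, hps, if_neg (Nat.succ_ne_zero left), List.take_succ_cons, List.map_cons,
        List.sum_cons]
      by_cases hT : u.fst ∈ T ∨ u.snd ∈ T
      · have hmm := ncard_apply_le hu
        have hph := hS.phase.next hmm.1 hmm.2
        refine (main (left, r) _ _ hps hr hph (spec_program_touched hw hS hu hT)
          fun l t s' h => h).trans ?_
        have hm : (u.apply G).edgeSet.ncard ≤ 2 * (r * r) := by
          have := hph.upper
          simp only at this
          nlinarith
        -- The charge for touching `T` covers `101 + 200 * m` steps with `m ≤ 2 * r ^ 2`, the new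
        -- potential `40 * r ^ 2` and the fresh charges `880 * r ^ 2`, a total of at most `1421 * r
        -- ^ 2`.
        have hcost : 1600 * (r * r) ≤ futureCost G T H r u := by
          unfold futureCost
          have : 1 ≤ (if u.fst ∈ T then 1 else 0) + if u.snd ∈ T then 1 else 0 := by
            rcases hT with h | h <;> simp [h]
          exact (Nat.le_mul_of_pos_right _ this).trans (Nat.le_add_left _ _)
        have hrr : 1 ≤ r * r := Nat.mul_le_mul hr hr
        refine Nat.cast_le.2 ?_
        simp only
        omega
      · have hspec := det_program_untouched hw hS hu hT
        refine (add_le_add le_rfl (Spec.apply_le hspec hF (k := []) (us := us) (B := fun _ =>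
          ((10 * outDeg (nbrsIn G H) H (H ∩ outSet n s) + (futureCost G T H r u +
            ((us.take left).map (futureCost G T H r)).sum) + 149 + 30 * r +
              work (u.apply G) (left, r) us : ℕ) : ℝ≥0∞)) ?_)).trans ?_
        · rintro - t s' ⟨hS', ht⟩
          refine (add_le_add le_rfl (ih hS' hus)).trans ?_
          -- An insertion can raise a residual degree by one, hence each of the at most `r`
          -- remaining charges by `30`. With the `150` constant steps this stays below `180 * r`,
          -- the amount in `work`.
          have hfut : ((us.take left).map (futureCost (u.apply G) T H r)).sum ≤
              ((us.take left).map (futureCost G T H r)).sum + 30 * r := by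
            have h1 : ∀ L : List (Update n), (L.map (futureCost (u.apply G) T H r)).sum ≤
                (L.map (futureCost G T H r)).sum + 30 * L.length := by
              intro L
              induction L with
              | nil => simp
              | cons v L ih =>
                have h2 : futureCost (u.apply G) T H r v ≤ futureCost G T H r v + 30 := by
                  unfold futureCost
                  have := card_nbrsIn_apply_le hu H v.snd
                  omega
                simp only [List.map_cons, List.sum_cons, List.length_cons]
                omega
            refine (h1 _).trans ?_
            have h3 := hS.phase.left_le
            have h4 := List.length_take_le left us
            simp only at h3
            omega
          have hcost : 30 * (nbrsIn G H u.snd).card ≤ futureCost G T H r u := Nat.le_add_right _ _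
          rw [one_mul, ← Nat.cast_add, Nat.cast_le]
          dsimp only
          omega
        · rw [expect_const, ← Nat.cast_one, ← Nat.cast_add, Nat.cast_le]
          omega

end Potential

/-! ## Summation over the updates -/

section Amortization
variable {n : ℕ}

theorem rootCeil_mul_self_le (m : ℕ) : rootCeil m * rootCeil m ≤ 4 * max m 1 := by
  have h1 := rootCeil_pos m
  have h2 := mul_self_lt_max (m := m) (r := rootCeil m - 1) (by omega)
  generalize rootCeil m = r at *
  obtain ⟨r, rfl⟩ : ∃ q, r = q + 1 := ⟨r - 1, by omega⟩
  rw [Nat.add_sub_cancel] at h2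
  have := le_max_right m 1
  rcases Nat.eq_zero_or_pos r with rfl | h <;> nlinarith

/-- From `r ^ 2 ≤ m + 3 * r`: for `r ≥ 5` the linear term is at most `3 / 5 * r ^ 2`, and for `r ≤
4` the bound holds because of the replacement of small `m` by `2`. -/
theorem PhaseOK.le_sqrt {left r m : ℕ} (h : PhaseOK left r m) :
    (r : ℝ) ≤ 4 * √((max m 2 : ℕ) : ℝ) := by
  have h1 : r * r ≤ 16 * max m 2 := by
    have := h.lower
    have h3 := le_max_left m 2
    have h4 := le_max_right m 2
    generalize max m 2 = q at *
    rcases le_or_gt r 4 with h5 | h5 <;> nlinarith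
  have h2 := Real.mul_self_sqrt (Nat.cast_nonneg (α := ℝ) (max m 2))
  have h3 := Real.sqrt_nonneg ((max m 2 : ℕ) : ℝ)
  have h4 : (r : ℝ) * r ≤ 16 * ((max m 2 : ℕ) : ℝ) := by exact_mod_cast h1
  nlinarith

theorem PhaseOK.step {left r m m' : ℕ} (h : PhaseOK left r m) (h1 : m' ≤ m + 1) (h2 : m ≤ m' + 1) :
    PhaseOK (phaseStep m' (left, r)).1 (phaseStep m' (left, r)).2 m' := by
  cases left with
  | zero => exact PhaseOK.rootCeil m'
  | succ left => exact h.next h1 h2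

/-- Each update of a phase saves `19200 * r` towards the next reconstruction; the first term is what
has been saved so far. This avoids grouping the sum by phases, and an unfinished last phase needs no
special treatment. -/
theorem work_le {us : List (Update n)} {G : SimpleGraph (Fin n)} {left r : ℕ}
    (hp : PhaseOK left r G.edgeSet.ncard) (hus : ValidFrom G us) :
    (work G (left, r) us : ℝ) ≤ 19200 * r * (r - left) + 102400 *
      ∑ t ∈ Finset.range us.length,
        √((max ((us.take (t + 1)).foldl Update.apply G).edgeSet.ncard 2 : ℕ) : ℝ) := by
  induction us generalizing G left r with
  | nil =>
    have : (left : ℝ) ≤ r := by exact_mod_cast hp.left_le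
    simp only [work, List.length_nil, Finset.range_zero, Finset.sum_empty, mul_zero, add_zero,
      Nat.cast_zero]
    have h2 : (0 : ℝ) ≤ r := Nat.cast_nonneg r
    have h3 : (0 : ℝ) ≤ r - left := by linarith
    positivity
  | cons u us ih =>
    obtain ⟨hu, hus⟩ := hus
    obtain ⟨hm1, hm2⟩ := ncard_apply_le hu
    have hp' := hp.step hm1 hm2
    have ih' := ih hp' hus
    rw [List.length_cons, Finset.sum_range_succ']
    simp only [List.take_succ_cons, List.foldl_cons, zero_add, List.take_zero, List.foldl_nil, work,
      Nat.cast_add]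
    generalize ∑ t ∈ Finset.range us.length, √((max ((us.take (t + 1)).foldl Update.apply
      (u.apply G)).edgeSet.ncard 2 : ℕ) : ℝ) = B' at ih' ⊢
    have hx := hp'.le_sqrt
    have hx1 : (1 : ℝ) ≤ √((max (u.apply G).edgeSet.ncard 2 : ℕ) : ℝ) := by
      rw [Real.one_le_sqrt]
      have : 1 ≤ max (u.apply G).edgeSet.ncard 2 := by omega
      exact_mod_cast this
    generalize √((max (u.apply G).edgeSet.ncard 2 : ℕ) : ℝ) = x at hx hx1 ⊢
    cases left with
    | zero =>
      have hps : phaseStep (u.apply G).edgeSet.ncard (0, r) =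
        (rootCeil (u.apply G).edgeSet.ncard - 1, rootCeil (u.apply G).edgeSet.ncard) := rfl
      rw [hps] at ih' hx ⊢
      have hpos := rootCeil_pos (u.apply G).edgeSet.ncard
      have hsq := rootCeil_mul_self_le (u.apply G).edgeSet.ncard
      simp only [Nat.cast_sub hpos, Nat.cast_one] at ih' hx ⊢
      have hup := hp.upper
      generalize rootCeil (u.apply G).edgeSet.ncard = r' at *
      -- At most `r ^ 2 + r + 1` edges are present when the next phase starts. Since `1600 * 12 =
      -- 19200`, the savings `19200 * r ^ 2` pay for its reconstruction up to a constant.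
      have hrr : r' * r' ≤ 12 * (r * r) + 4 := by
        have : max (u.apply G).edgeSet.ncard 1 ≤ r * r + r + 1 := by omega
        nlinarith [Nat.zero_le r, Nat.le_mul_self r]
      have hrr' : (r' : ℝ) * r' ≤ 12 * (r * r) + 4 := by exact_mod_cast hrr
      rw [if_pos trivial]
      push_cast
      nlinarith
    | succ left =>
      have hps : phaseStep (u.apply G).edgeSet.ncard (left + 1, r) = (left, r) := rfl
      rw [hps] at ih' hx ⊢
      rw [if_neg (Nat.succ_ne_zero left)]
      simp only at ih' hx ⊢
      push_cast
      nlinarith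

/-- The analysis gives `√m` without a logarithm. Since the logarithm is at least `log 2 > 1 / 2`,
its power `3 / 2` is at least `1 / 4`. -/
theorem sqrt_le_updateBound (m : ℕ) : √((max m 2 : ℕ) : ℝ) ≤ 4 * updateBound m := by
  have h1 : (1 / 2 : ℝ) ≤ Real.log ((max m 2 : ℕ) : ℝ) := by
    have h2 := Real.log_two_gt_d9
    have h3 : Real.log 2 ≤ Real.log ((max m 2 : ℕ) : ℝ) := by
      refine Real.log_le_log (by norm_num) ?_
      exact_mod_cast le_max_right m 2
    linarith
  have h4 : (1 / 4 : ℝ) ≤ Real.log ((max m 2 : ℕ) : ℝ) ^ (3 / 2 : ℝ) := by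
    calc (1 / 4 : ℝ) = (1 / 2 : ℝ) ^ (2 : ℝ) := by norm_num
      _ ≤ (1 / 2 : ℝ) ^ (3 / 2 : ℝ) :=
        Real.rpow_le_rpow_of_exponent_ge (by norm_num) (by norm_num) (by norm_num)
      _ ≤ _ := Real.rpow_le_rpow (by norm_num) h1 (by norm_num)
  have h5 := Real.sqrt_nonneg ((max m 2 : ℕ) : ℝ)
  unfold updateBound
  nlinarith

/-- With `x = 2 ^ (⌊log₂ n⌋ + 1)`, two of the eight factors `x` bound `(n + 1) ^ 2` and the other
six are at least `2 ^ 6 ≥ 16`. -/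
theorem wordOK_wordLength (n : ℕ) : WordOK n (wordLength 8 n) := by
  have h1 : n + 1 ≤ 2 ^ (Nat.log 2 n + 1) := Nat.lt_pow_succ_log_self (by norm_num) n
  have h2 : 2 ^ 1 ≤ 2 ^ (Nat.log 2 n + 1) := Nat.pow_le_pow_right (by norm_num) (by omega)
  unfold WordOK wordLength
  rw [mul_comm 8, pow_mul]
  generalize 2 ^ (Nat.log 2 n + 1) = x at *
  calc 16 * ((n + 1) * (n + 1)) ≤ (2 ^ 1) ^ 6 * (x * x) := by
        refine Nat.mul_le_mul (by norm_num) (Nat.mul_le_mul h1 h1)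
    _ ≤ x ^ 6 * (x * x) := Nat.mul_le_mul_right _ (Nat.pow_le_pow_left h2 6)
    _ = x ^ 8 := by ring

/-- The initial potential is zero apart from `work`, and `409600 = 4 * 102400` combines
`sqrt_le_updateBound` with `work_le`. -/
theorem expectedTime_start_le {us : List (Update n)} (hus : ValidFrom ⊥ us) :
    expectedTime program (wordLength 8 n) (Config.start us) ≤ ENNReal.ofReal
      (409600 * ∑ t ∈ Finset.Icc 1 us.length, updateBound (edgesAfter us t)) := by
  refine (expectedTime_le (wordOK_wordLength n) State.blank hus).trans ?_
  have h1 : outDeg (nbrsIn (⊥ : SimpleGraph (Fin n)) Finset.univ) Finset.univ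
      (Finset.univ ∩ outSet n Store.blank) = 0 := by
    have := outDeg_le (G := (⊥ : SimpleGraph (Fin n))) Finset.univ
      (Finset.univ ∩ outSet n Store.blank)
    simpa using this
  rw [h1, List.take_zero, List.map_nil, List.sum_nil, mul_zero, zero_add, zero_add,
    ← ENNReal.ofReal_natCast]
  refine ENNReal.ofReal_le_ofReal ((work_le State.blank.phase hus).trans ?_)
  have h2 : ∑ t ∈ Finset.Icc 1 us.length, updateBound (edgesAfter us t) =
      ∑ t ∈ Finset.range us.length, updateBound (edgesAfter us (t + 1)) := by
    rw [Finset.range_eq_Ico, Finset.sum_Ico_add' (fun t => updateBound (edgesAfter us t)) 0 _ 1,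
      zero_add]
    rfl
  have h3 : ∑ t ∈ Finset.range us.length,
      √((max ((us.take (t + 1)).foldl Update.apply ⊥).edgeSet.ncard 2 : ℕ) : ℝ) ≤
        4 * ∑ t ∈ Finset.range us.length, updateBound (edgesAfter us (t + 1)) := by
    rw [Finset.mul_sum]
    exact Finset.sum_le_sum fun t _ => sqrt_le_updateBound _
  rw [h2]
  simp only [Nat.cast_zero, mul_zero, zero_mul, zero_add]
  linarith

theorem ValidFrom.of_append {G : SimpleGraph (Fin n)} {us vs : List (Update n)}
    (h : ValidFrom G (us ++ vs)) :
    ValidFrom G us ∧ ValidFrom (us.foldl Update.apply G) vs := by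
  induction us generalizing G with
  | nil => exact ⟨trivial, h⟩
  | cons u us ih => exact ⟨⟨h.1, (ih h.2).1⟩, (ih h.2).2⟩

end Amortization

end DynMIS

open DynMIS in
theorem mainTheorem2 :
    ∃ (P : Stmt) (c : ℕ) (C : ℝ), 0 < c ∧ ∀ (n : ℕ) (us : List (Update n)), ValidFrom ⊥ us →
      -- whatever the random choices, the stored set is a maximal independent set
      (∀ k : ℕ, ∀ x ∈ (runFrom P (wordLength c n) (Config.start us) k).support, x.Done →
        Maximal (fun S : Set (Fin n) => (graphAfter us).IsIndepSet S) (x.output : Set (Fin n))) ∧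
      -- the expected total time
      expectedTime P (wordLength c n) (Config.start us) ≤
        ENNReal.ofReal (C * ∑ t ∈ Finset.Icc 1 us.length, updateBound (edgesAfter us t)) ∧
      -- at a time of reconstruction, whatever the memory before the update, the new set is the
      -- greedy set for a fresh uniformly random order of the vertices
      (∀ (vs : List (Update n)) (u : Update n) (i : ℕ), us = vs ++ [u] →
        rebuildTime us i = us.length →
        ∀ k : ℕ, ∀ x ∈ (runFrom P (wordLength c n) (Config.start vs) k).support, x.Done →
          ∀ S : Finset (Fin n),
            outcomeProb P (wordLength c n) ⟨[], x.store, [u]⟩ S =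
              randomGreedy (graphAfter us) S) := by
  refine ⟨program, 8, 409600, by norm_num, fun n us hus => ⟨?_, expectedTime_start_le hus, ?_⟩⟩
  · intro k x hx hd
    obtain ⟨T, H, hS⟩ := State.blank.of_mem_support (wordOK_wordLength n) hus hx hd
    exact hS.inv.maximal
  · rintro vs u i rfl hi k x hx hd S
    obtain ⟨hvs, hu, -⟩ := hus.of_append
    obtain ⟨T, H, hS⟩ := State.blank.of_mem_support (wordOK_wordLength n) hvs hx hd
    -- The last update falls on a reconstruction time, so the clock stands at `0` in every memory
    -- reachable after `vs`, and the program draws a fresh order.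
    have h0 := phaseAfter_eq_zero hi
    rw [← Prod.mk.eta (p := phaseAfter ⊥ (0, 0) vs), h0] at hS
    rw [outcomeProb_reconstruct (wordOK_wordLength n) hS hu, graphAfter, List.foldl_append]
    rfl
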